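/- Notation. Let $d\ge 1$, write $z=(x,v)\in\mathbb R^{d}\times\mathbb R^{d}=\mathbb R^{2d}$, let $a=(3,1)$ and $|z|_a:=|x|^{1/3}+|v|$, and for $r>0$ put $r^{a}z:=(r^3x,rv)$. Let $\mathscr P_{\rm w}=\{\varrho^\kappa:\kappa\in\mathbb R\}$ with $\varrho(x,v)=((1+|x|^2)^{1/3}+1+|v|^2)^{-1/2}$, and $\|g\|_{L^\infty(\rho)}:=\|\rho g\|_{L^\infty}$. Fix a smooth $\phi_{-1}:\mathbb R^{2d}\to[0,\infty)$ with $\phi_{-1}(-\xi)=\phi_{-1}(\xi)$, $\phi_{-1}=1$ on $\{|\xi|_a\le\frac12\}$ and $\phi_{-1}=0$ off $\{|\xi|_a\le\frac23\}$. For integers $j\ge0$ put $\phi_j(\xi)=\phi_{-1}(2^{-a(j+1)}\xi)-\phi_{-1}(2^{-aj}\xi)$, where $2^{-aj}:=(2^{-j})^a$. For $j\ge-1$ let $\mathcal R_jf=\mathcal F^{-1}(\phi_j\,\mathcal Ff)$ for tempered distributions $f$ on $\mathbb R^{2d}$, with $\mathcal F$ the Fourier transform of phase $e^{-i\xi\cdot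 z}$. For $s\in\mathbb R$ and $\rho\in\mathscr P_{\rm w}$ let $$\|f\|_{\mathbf C^s_a(\rho)}=\sup_{j\ge-1}2^{sj}\|\mathcal R_jf\|_{L^\infty(\rho)},\qquad \mathbf C^s_a(\rho)=\{f\in\mathscr S'(\mathbb R^{2d}):\|f\|_{\mathbf C^s_a(\rho)}<\infty\},$$ and let $L^q_T\mathbf C^s_a(\rho):=L^q([0,T];\mathbf C^s_a(\rho))$. Let $\Gamma_t(x,v)=(x+tv,v)$ and $\Gamma_tg=g\circ\Gamma_t$. For $\alpha\in(0,2)$, $T>0$ and $u:[0,T]\to\mathscr S'(\mathbb R^{2d})$ the kinetic Hölder norm is $$\|u\|_{\mathbb S^\alpha_{T,a}(\rho)}=\sup_{0\le t\le T}\|u(t)\|_{\mathbf C^\alpha_a(\rho)}+\sup_{0\le t\le T}\|u(t)\|_{L^\infty(\rho)}+\sup_{s\ne t\in[0,T]}\frac{\|u(t)-\Gamma_{t-s}u(s)\|_{L^\infty(\rho)}}{|t-s|^{\alpha/2}}.$$ For $t>0$ let $$p_t(x,v)=\Big(\frac{4\pi^2t^4}{3}\Big)^{-d/2}\exp\Big(-\frac{3|x|^2+|3x-2tv|^2}{4t^3}\Big),$$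 $P_tf=\Gamma_t(p_t*f)$, and for $\lambda\ge0$ let $$\mathscr I_\lambda f(t)=\int_0^te^{-\lambda(t-s)}P_{t-s}f(s)\,ds .$$ **Lemma (Schauder estimates).** Let $\rho\in\mathscr P_{\rm w}$, $\beta\in(0,2)$ and $\theta\in(\beta,2]$. For any $q\in[\frac{2}{2-\theta},\infty]$ (where $\frac20:=\infty$) and $T>0$ there is a constant $C>0$, depending only on $d,\rho,\beta,\theta,q,T$ and the fixed function $\phi_{-1}$, such that for all $\lambda\ge0$ and all $f\in L^q_T\mathbf C^{-\beta}_a(\rho)$ the integral $\mathscr I_\lambda f(t)$ converges in $\mathscr S'(\mathbb R^{2d})$ for every $t\in[0,T]$, and $$\|\mathscr I_\lambda f\|_{\mathbb S^{\theta-\beta}_{T,a}(\rho)}\le C\,(\lambda\vee1)^{\frac\theta2+\frac1q-1}\,\|f\|_{L^q_T\mathbf C^{-\beta}_a(\rho)} .$$ -/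

import Mathlib

open MeasureTheory Set
open scoped ENNReal SchwartzMap FourierTransform ContDiff

noncomputable section

namespace Kinetic

/-! ## Phase space and its anisotropic geometry -/

/-- The Euclidean space `ℝ^d`. -/
abbrev Space (d : ℕ) : Type := EuclideanSpace ℝ (Fin d)

/-- The phase space `ℝ^d × ℝ^d` of points `z = (x, v)` (`x = z.fst`, `v = z.snd`), with the Euclidean
norm of `ℝ^{2d}`. -/
abbrev Phase (d : ℕ) : Type := WithLp 2 (Space d × Space d)

variable {d : ℕ}

/-- `|z|_a = |x|^{1/3} + |v|`, for the multi-scale parameter `a = (3, 1)`. -/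
def anorm (z : Phase d) : ℝ := ‖z.fst‖ ^ (1 / 3 : ℝ) + ‖z.snd‖

/-- The linear automorphism of the phase space that acts on pairs as `L`, with inverse `M`. -/
def phaseEquiv
    (L M : (Space d × Space d) →L[ℝ]
      (Space d × Space d))
    (h₁ : Function.LeftInverse M L) (h₂ : Function.RightInverse M L) : Phase d ≃L[ℝ] Phase d :=
  ((WithLp.prodContinuousLinearEquiv 2 ℝ _ _).trans
    (ContinuousLinearEquiv.equivOfInverse L M h₁ h₂)).trans
      (WithLp.prodContinuousLinearEquiv 2 ℝ _ _).symm

/-- The transport `Γ_t (x, v) = (x + t v, v)`. -/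
def transport (t : ℝ) : Phase d ≃L[ℝ] Phase d :=
  phaseEquiv
    (ContinuousLinearMap.prod
      (ContinuousLinearMap.fst ℝ (Space d) (Space d) +
        t • ContinuousLinearMap.snd ℝ (Space d) (Space d))
      (ContinuousLinearMap.snd ℝ (Space d) (Space d)))
    (ContinuousLinearMap.prod
      (ContinuousLinearMap.fst ℝ (Space d) (Space d) -
        t • ContinuousLinearMap.snd ℝ (Space d) (Space d))
      (ContinuousLinearMap.snd ℝ (Space d) (Space d)))
    (fun p => by simp) (fun p => by simp)

theorem transport_apply (t : ℝ) (z : Phase d) :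
    transport t z = WithLp.toLp 2 (z.fst + t • z.snd, z.snd) := rfl

/-- The dilation `2^{a j} (x, v) = (2^{3j} x, 2^j v)`, for an integer `j`. -/
def dilation (j : ℤ) : Phase d ≃L[ℝ] Phase d :=
  phaseEquiv
    (ContinuousLinearMap.prod
      ((2 : ℝ) ^ (3 * j) • ContinuousLinearMap.fst ℝ (Space d) (Space d))
      ((2 : ℝ) ^ j • ContinuousLinearMap.snd ℝ (Space d) (Space d)))
    (ContinuousLinearMap.prod
      ((2 : ℝ) ^ (-(3 * j)) • ContinuousLinearMap.fst ℝ (Space d) (Space d))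
      ((2 : ℝ) ^ (-j) • ContinuousLinearMap.snd ℝ (Space d) (Space d)))
    (fun p => by
      have h (k : ℤ) : (2 : ℝ) ^ k ≠ 0 := zpow_ne_zero k two_ne_zero
      simp [smul_smul, inv_mul_cancel₀ (h _)])
    (fun p => by
      have h (k : ℤ) : (2 : ℝ) ^ k ≠ 0 := zpow_ne_zero k two_ne_zero
      simp [smul_smul, mul_inv_cancel₀ (h _)])

theorem dilation_apply (j : ℤ) (z : Phase d) :
    dilation j z = WithLp.toLp 2 ((2 : ℝ) ^ (3 * j) • z.fst, (2 : ℝ) ^ j • z.snd) := rfl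

/-- The base weight `ϱ(x, v) = ((1 + |x|²)^{1/3} + 1 + |v|²)^{-1/2}`. -/
def baseWeight (z : Phase d) : ℝ :=
  ((1 + ‖z.fst‖ ^ 2) ^ (1 / 3 : ℝ) + 1 + ‖z.snd‖ ^ 2) ^ (-(1 / 2) : ℝ)

/-- The polynomial weight `ρ = ϱ^κ`. -/
def weight (κ : ℝ) (z : Phase d) : ℝ := baseWeight z ^ κ

/-! ## Weighted `L^∞` norms -/

/-- `‖h‖_{L^∞(ρ)} = ‖ρ h‖_{L^∞}` for a function `h`. -/
def normLinfFun (ρ : Phase d → ℝ) (h : Phase d → ℂ) : ℝ≥0∞ :=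
  eLpNorm (fun z => (ρ z : ℂ) * h z) ⊤ volume

/-- The tempered distribution `g` is the function `h`. -/
structure IsFun (g : 𝓢'(Phase d, ℂ)) (h : Phase d → ℂ) : Prop where
  aestronglyMeasurable : AEStronglyMeasurable h volume
  integrable : ∀ ψ : 𝓢(Phase d, ℂ), Integrable (fun z => h z * ψ z) volume
  eq_integral : ∀ ψ : 𝓢(Phase d, ℂ), g ψ = ∫ z, h z * ψ z

/-- `‖g‖_{L^∞(ρ)}` for a tempered distribution `g`: the norm of the function (unique up to null
sets) that represents `g`, and `∞` if `g` is not a function. -/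
def normLinf (ρ : Phase d → ℝ) (g : 𝓢'(Phase d, ℂ)) : ℝ≥0∞ :=
  ⨅ (h : Phase d → ℂ) (_ : IsFun g h), normLinfFun ρ h

/-! ## Littlewood-Paley blocks and weighted anisotropic Besov-Hölder norms -/

/-- The low-frequency function `φ_{-1}` of a dyadic partition of unity: a symmetric nonnegative
smooth function, equal to `1` on `{|ξ|_a ≤ 1/2}` and to `0` off `{|ξ|_a ≤ 2/3}`. -/
structure DyadicCutoff (d : ℕ) where
  toFun : Phase d → ℝ
  contDiff : ContDiff ℝ ∞ toFun
  symm : ∀ ξ, toFun (-ξ) = toFun ξ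
  nonneg : ∀ ξ, 0 ≤ toFun ξ
  eq_one : ∀ ξ, anorm ξ ≤ 1 / 2 → toFun ξ = 1
  eq_zero : ∀ ξ, 2 / 3 < anorm ξ → toFun ξ = 0

theorem DyadicCutoff.hasCompactSupport (φ : DyadicCutoff d) : HasCompactSupport φ.toFun := by
  refine HasCompactSupport.of_support_subset_isCompact
    (isCompact_closedBall (0 : Phase d) 2) fun ξ hξ => ?_
  have h : anorm ξ ≤ 2 / 3 := by
    by_contra hlt
    exact hξ (φ.eq_zero ξ (not_le.1 hlt))
  have h1 : 0 ≤ ‖ξ.fst‖ ^ (1 / 3 : ℝ) := Real.rpow_nonneg (norm_nonneg _) _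
  have h2 : ‖ξ.snd‖ ≤ 1 := by
    unfold anorm at h; linarith
  have h3 : ‖ξ.fst‖ ≤ 1 := by
    by_contra hlt
    have := Real.one_lt_rpow (not_le.1 hlt) (z := 1 / 3) (by norm_num)
    have := norm_nonneg ξ.snd
    unfold anorm at h; linarith
  rw [mem_closedBall_zero_iff]
  have h4 := WithLp.prod_norm_sq_eq_of_L2 ξ
  have h5 := norm_nonneg ξ
  have h6 := norm_nonneg ξ.fst
  have h7 := norm_nonneg ξ.snd
  nlinarith

/-- The symbols `φ_j`, `j ≥ -1`: `φ_{-1}` is given, and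
`φ_j(ξ) = φ_{-1}(2^{-a(j+1)} ξ) - φ_{-1}(2^{-aj} ξ)` for `j ≥ 0`. -/
def symbol (φ : DyadicCutoff d) (j : ℤ) (ξ : Phase d) : ℝ :=
  if j = -1 then φ.toFun ξ
  else φ.toFun (dilation (-(j + 1)) ξ) - φ.toFun (dilation (-j) ξ)

theorem symbol_hasCompactSupport (φ : DyadicCutoff d) (j : ℤ) :
    HasCompactSupport (symbol φ j) := by
  have hd (k : ℤ) : HasCompactSupport fun ξ => φ.toFun (dilation k ξ) :=
    φ.hasCompactSupport.comp_homeomorph (dilation k).toHomeomorph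
  unfold symbol
  split_ifs
  · exact φ.hasCompactSupport
  · exact (hd _).sub (hd _)

theorem symbol_contDiff (φ : DyadicCutoff d) (j : ℤ) : ContDiff ℝ ∞ (symbol φ j) := by
  unfold symbol
  split_ifs
  · exact φ.contDiff
  · exact (φ.contDiff.comp (dilation _).contDiff).sub (φ.contDiff.comp (dilation _).contDiff)

/-- Multiplication by `2π`. -/
def scale2pi : Phase d ≃L[ℝ] Phase d :=
  ContinuousLinearEquiv.smulLeft (Units.mk0 (2 * Real.pi) Real.two_pi_pos.ne')

theorem scale2pi_apply (z : Phase d) : scale2pi z = (2 * Real.pi) • z := rfl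

/-- The Schwartz function `η ↦ φ_j(2π η)`. -/
def symbolSchwartz (φ : DyadicCutoff d) (j : ℤ) : 𝓢(Phase d, ℂ) :=
  HasCompactSupport.toSchwartzMap (f := fun η => (symbol φ j (scale2pi η) : ℂ))
    (((symbol_hasCompactSupport φ j).comp_homeomorph scale2pi.toHomeomorph).comp_left
      (g := fun r : ℝ => (r : ℂ)) Complex.ofReal_zero)
    (Complex.ofRealCLM.contDiff.comp ((symbol_contDiff φ j).comp scale2pi.contDiff))

/-- The convolution kernel of the block operator `R_j`, i.e. of the Fourier multiplier with symbol
`φ_j`: `K_j(z) = (2π)^{-2d} ∫ e^{i ξ·z} φ_j(ξ) dξ`. Mathlib's transform has the phase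
`e^{2π i η·z}`, hence the substitution `ξ = 2π η`. -/
def blockKernel (φ : DyadicCutoff d) (j : ℤ) : 𝓢(Phase d, ℂ) := 𝓕⁻ (symbolSchwartz φ j)

/-- For a Schwartz function `ψ` and a point `z`, the Schwartz function `y ↦ ψ (z - y)`. -/
def reflectAt (z : Phase d) (ψ : 𝓢(Phase d, ℂ)) : 𝓢(Phase d, ℂ) :=
  SchwartzMap.compSubConstCLM ℂ z
    (SchwartzMap.compCLMOfContinuousLinearEquiv ℂ (ContinuousLinearEquiv.neg ℝ) ψ)

theorem reflectAt_apply (z : Phase d) (ψ : 𝓢(Phase d, ℂ)) (y : Phase d) :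
    reflectAt z ψ y = ψ (z - y) := by
  simp [reflectAt]

/-- The convolution `ψ * f` of a Schwartz function and a tempered distribution, a smooth function:
`(ψ * f)(z) = ⟨f, ψ(z - ·)⟩`. -/
def conv (ψ : 𝓢(Phase d, ℂ)) (f : 𝓢'(Phase d, ℂ)) (z : Phase d) : ℂ := f (reflectAt z ψ)

/-- The block operator `R_j f = (φ_j f^)ˇ = K_j * f`, for `j ≥ -1`. -/
def block (φ : DyadicCutoff d) (j : ℤ) (f : 𝓢'(Phase d, ℂ)) : Phase d → ℂ :=
  conv (blockKernel φ j) f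

/-- The norm of `C^s_a(ρ) = B^{s,a}_{∞,∞}(ρ)`: `sup_{j ≥ -1} 2^{sj} ‖R_j f‖_{L^∞(ρ)}`. -/
def normC (φ : DyadicCutoff d) (ρ : Phase d → ℝ) (s : ℝ) (f : 𝓢'(Phase d, ℂ)) : ℝ≥0∞ :=
  ⨆ (j : ℤ) (_ : -1 ≤ j), ENNReal.ofReal ((2 : ℝ) ^ (s * j)) * normLinfFun ρ (block φ j f)

/-- The norm of `L^q([0,T]; C^s_a(ρ))`. -/
def normLqC (φ : DyadicCutoff d) (ρ : Phase d → ℝ) (s : ℝ) (q : ℝ≥0∞) (T : ℝ)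
    (f : ℝ → 𝓢'(Phase d, ℂ)) : ℝ≥0∞ :=
  eLpNorm (fun t => normC φ ρ s (f t)) q (volume.restrict (Icc 0 T))

/-- `f ∈ L^q([0,T]; C^s_a(ρ))`. Measurability in time is only asked for in the weak sense, which
is implied by strong measurability. -/
structure MemLqC (φ : DyadicCutoff d) (ρ : Phase d → ℝ) (s : ℝ) (q : ℝ≥0∞) (T : ℝ)
    (f : ℝ → 𝓢'(Phase d, ℂ)) : Prop where
  aestronglyMeasurable : ∀ ψ : 𝓢(Phase d, ℂ),
    AEStronglyMeasurable (fun t => f t ψ) (volume.restrict (Icc 0 T))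
  norm_lt_top : normLqC φ ρ s q T f < ⊤

/-! ## Kinetic Hölder spaces -/

/-- `Γ_t g = g ∘ Γ_t` for a tempered distribution `g`: `⟨Γ_t g, ψ⟩ = ⟨g, ψ ∘ Γ_{-t}⟩`, since `Γ_t`
preserves Lebesgue measure and has the inverse `Γ_{-t}`. -/
def transportDist (t : ℝ) (g : 𝓢'(Phase d, ℂ)) : 𝓢'(Phase d, ℂ) :=
  PointwiseConvergenceCLM.precomp ℂ
    (SchwartzMap.compCLMOfContinuousLinearEquiv ℂ (transport (-t))) g

/-- The kinetic Hölder norm of `S^α_{T,a}(ρ)`: the sum of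
`sup_{t ∈ [0,T]} ‖u(t)‖_{C^α_a(ρ)}`, `sup_{t ∈ [0,T]} ‖u(t)‖_{L^∞(ρ)}` and
`sup_{s ≠ t ∈ [0,T]} ‖u(t) - Γ_{t-s} u(s)‖_{L^∞(ρ)} / |t-s|^{α/2}`. -/
def normS (φ : DyadicCutoff d) (ρ : Phase d → ℝ) (α T : ℝ) (u : ℝ → 𝓢'(Phase d, ℂ)) : ℝ≥0∞ :=
  (⨆ t ∈ Icc 0 T, normC φ ρ α (u t)) +
    ((⨆ t ∈ Icc 0 T, normLinf ρ (u t)) +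
      ⨆ (s ∈ Icc 0 T) (t ∈ Icc 0 T) (_ : s ≠ t),
        normLinf ρ (u t - transportDist (t - s) (u s)) / ENNReal.ofReal (|t - s| ^ (α / 2)))

/-! ## The kinetic semigroup and the Duhamel operator -/

/-- The exponent of the kinetic heat kernel. -/
def kinPhase (t : ℝ) (z : Phase d) : ℝ :=
  (3 * ‖z.fst‖ ^ 2 + ‖(3 : ℝ) • z.fst - (2 * t) • z.snd‖ ^ 2) / (4 * t ^ 3)

/-- The kinetic heat kernel
`p_t(x, v) = (4 π² t⁴ / 3)^{-d/2} exp (-(3|x|² + |3x - 2tv|²) / (4t³))`, `t > 0`: the density of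
`(√2 ∫_0^t B_s ds, √2 B_t)` for a standard Brownian motion `B` in `ℝ^d`. -/
def kinDensity (t : ℝ) (z : Phase d) : ℝ :=
  (4 * Real.pi ^ 2 * t ^ 4 / 3) ^ (-(d : ℝ) / 2) * Real.exp (-kinPhase t z)

theorem kinPhase_hasTemperateGrowth (t : ℝ) :
    (kinPhase t : Phase d → ℝ).HasTemperateGrowth := by
  have hf := (WithLp.fstL 2 ℝ (Space d)
    (Space d)).hasTemperateGrowth
  have hg := ((3 : ℝ) • WithLp.fstL 2 ℝ (Space d) (Space d) -
    (2 * t) • WithLp.sndL 2 ℝ (Space d)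
      (Space d)).hasTemperateGrowth
  have h1 := (Function.hasTemperateGrowth_norm_sq
    (H := Space d)).comp hf
  have h2 := (Function.hasTemperateGrowth_norm_sq
    (H := Space d)).comp hg
  exact (((Function.HasTemperateGrowth.const (3 : ℝ)).mul h1).add h2).mul
    (Function.HasTemperateGrowth.const ((4 * t ^ 3)⁻¹))

theorem kinPhase_coercive {t : ℝ} (ht : 0 < t) :
    ∃ c : ℝ, 0 < c ∧ ∀ z : Phase d, c * ‖z‖ ^ 2 ≤ kinPhase t z := by
  refine ⟨min (3 / 2) (t ^ 2 / 3) / (4 * t ^ 3), by positivity, fun z => ?_⟩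
  have h1 : 2 * t * ‖z.snd‖ ≤ ‖(3 : ℝ) • z.fst - (2 * t) • z.snd‖ + 3 * ‖z.fst‖ := by
    have h := norm_sub_le ((3 : ℝ) • z.fst) ((3 : ℝ) • z.fst - (2 * t) • z.snd)
    rw [sub_sub_cancel, norm_smul, norm_smul, Real.norm_of_nonneg (by positivity),
      Real.norm_of_nonneg (by norm_num)] at h
    linarith
  unfold kinPhase
  rw [div_mul_eq_mul_div]
  gcongr
  rw [WithLp.prod_norm_sq_eq_of_L2]
  have h2 := min_le_left (3 / 2 : ℝ) (t ^ 2 / 3)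
  have h3 := min_le_right (3 / 2 : ℝ) (t ^ 2 / 3)
  set w := ‖(3 : ℝ) • z.fst - (2 * t) • z.snd‖
  have hw : 0 ≤ w := norm_nonneg _
  have h4 : (2 * t * ‖z.snd‖) ^ 2 ≤ (w + 3 * ‖z.fst‖) ^ 2 := by
    gcongr
  have h5 := mul_le_mul_of_nonneg_right h2 (sq_nonneg ‖z.fst‖)
  have h6 := mul_le_mul_of_nonneg_right h3 (sq_nonneg ‖z.snd‖)
  nlinarith [sq_nonneg (w - 3 * ‖z.fst‖)]

/-- `exp (-Q)` is rapidly decreasing if `Q` is smooth, of temperate growth and coercive. -/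
theorem exp_neg_decay {Q : Phase d → ℝ} (hQ : Q.HasTemperateGrowth) {c : ℝ} (hc : 0 < c)
    (hQc : ∀ z, c * ‖z‖ ^ 2 ≤ Q z) (k n : ℕ) :
    ∃ C : ℝ, ∀ z, ‖z‖ ^ k * ‖iteratedFDeriv ℝ n (fun z => Real.exp (-Q z)) z‖ ≤ C := by
  obtain ⟨m, A, hA0, hA⟩ := hQ.neg.norm_iteratedFDeriv_le_uniform n
  set K : ℝ := max 1 c⁻¹
  have hK1 : 1 ≤ K := le_max_left _ _
  have hKc : 1 ≤ K * c := by
    have := mul_le_mul_of_nonneg_right (le_max_right 1 c⁻¹) hc.le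
    rwa [inv_mul_cancel₀ hc.ne'] at this
  set M : ℕ := k + m * n
  refine ⟨n.factorial * (A + 1) ^ n * ((2 * K) ^ M * (M.factorial * Real.exp 1)), fun z => ?_⟩
  have hz := norm_nonneg z
  have h1z : 1 ≤ 1 + ‖z‖ := by linarith
  have hD1 : 1 ≤ (A + 1) * (1 + ‖z‖) ^ m := by
    have := one_le_pow₀ h1z (n := m)
    nlinarith
  have hder : ‖iteratedFDeriv ℝ n (Real.exp ∘ fun z => -Q z) z‖ ≤
      n.factorial * Real.exp (-Q z) * ((A + 1) * (1 + ‖z‖) ^ m) ^ n := by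
    refine norm_iteratedFDeriv_comp_le (N := ∞) Real.contDiff_exp hQ.neg.1
      (by exact_mod_cast le_top) z (fun i _ => ?_) (fun i hi hin => ?_)
    · rw [norm_iteratedFDeriv_eq_norm_iteratedDeriv, iteratedDeriv_eq_iterate, Real.iter_deriv_exp,
        Real.norm_of_nonneg (Real.exp_pos _).le]
      exact le_rfl
    · calc _ ≤ A * (1 + ‖z‖) ^ m := hA i hin z
        _ ≤ (A + 1) * (1 + ‖z‖) ^ m := by gcongr; linarith
        _ = ((A + 1) * (1 + ‖z‖) ^ m) ^ 1 := (pow_one _).symm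
        _ ≤ _ := pow_le_pow_right₀ hD1 hi
  have hexp : (1 + ‖z‖) ^ M * Real.exp (-Q z) ≤
      (2 * K) ^ M * (M.factorial * Real.exp 1) := by
    have hb : 1 + ‖z‖ ≤ 2 * K * (1 + c * ‖z‖ ^ 2) := by
      nlinarith [sq_nonneg (‖z‖ - 1), sq_nonneg ‖z‖, mul_nonneg (sub_nonneg.2 hKc) (sq_nonneg ‖z‖)]
    have hy : 0 ≤ 1 + c * ‖z‖ ^ 2 := by positivity
    have he := Real.pow_div_factorial_le_exp (1 + c * ‖z‖ ^ 2) hy M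
    rw [div_le_iff₀ (by positivity)] at he
    calc (1 + ‖z‖) ^ M * Real.exp (-Q z)
        ≤ (2 * K * (1 + c * ‖z‖ ^ 2)) ^ M * Real.exp (-(c * ‖z‖ ^ 2)) := by
          gcongr
          exact hQc z
      _ = (2 * K) ^ M * ((1 + c * ‖z‖ ^ 2) ^ M * Real.exp (-(c * ‖z‖ ^ 2))) := by
          rw [mul_pow]; ring
      _ ≤ (2 * K) ^ M * ((Real.exp (1 + c * ‖z‖ ^ 2) * M.factorial) *
            Real.exp (-(c * ‖z‖ ^ 2))) := by
          gcongr
      _ = (2 * K) ^ M * (M.factorial * (Real.exp (1 + c * ‖z‖ ^ 2) *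
            Real.exp (-(c * ‖z‖ ^ 2)))) := by ring
      _ = _ := by
          rw [← Real.exp_add]
          congr 4
          ring
  calc ‖z‖ ^ k * ‖iteratedFDeriv ℝ n (fun z => Real.exp (-Q z)) z‖
      ≤ (1 + ‖z‖) ^ k *
          (n.factorial * Real.exp (-Q z) * ((A + 1) * (1 + ‖z‖) ^ m) ^ n) := by
        gcongr
        · linarith
        · exact hder
    _ = n.factorial * (A + 1) ^ n * ((1 + ‖z‖) ^ M * Real.exp (-Q z)) := by
        rw [mul_pow, ← pow_mul, pow_add]; ring
    _ ≤ _ := by gcongr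

/-- The kinetic heat kernel as a Schwartz function. -/
def kinKernel (t : ℝ) (ht : 0 < t) : 𝓢(Phase d, ℂ) where
  toFun z := (kinDensity t z : ℂ)
  smooth' := by
    have h := (kinPhase_hasTemperateGrowth (d := d) t).1
    exact Complex.ofRealCLM.contDiff.comp
      (contDiff_const.mul (Real.contDiff_exp.comp h.neg))
  decay' k n := by
    obtain ⟨c, hc, hQc⟩ := kinPhase_coercive (d := d) ht
    obtain ⟨C, hC⟩ := exp_neg_decay (kinPhase_hasTemperateGrowth (d := d) t) hc hQc k n
    have h := (kinPhase_hasTemperateGrowth (d := d) t).1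
    set a : ℝ := (4 * Real.pi ^ 2 * t ^ 4 / 3) ^ (-(d : ℝ) / 2)
    refine ⟨‖a • Complex.ofRealCLM‖ * C, fun z => ?_⟩
    have he : (fun z : Phase d => (kinDensity t z : ℂ)) =
        (a • Complex.ofRealCLM) ∘ fun z => Real.exp (-kinPhase t z) := by
      funext z
      simp [kinDensity, a]
    have hs : ContDiffAt ℝ ∞ (fun z : Phase d => Real.exp (-kinPhase t z)) z :=
      (Real.contDiff_exp.comp h.neg).contDiffAt
    rw [he]
    have hb := ContinuousLinearMap.norm_iteratedFDeriv_comp_left (a • Complex.ofRealCLM) hs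
      (n := n) (by exact_mod_cast le_top)
    calc _ ≤ ‖z‖ ^ k * (‖a • Complex.ofRealCLM‖ *
          ‖iteratedFDeriv ℝ n (fun z : Phase d => Real.exp (-kinPhase t z)) z‖) := by gcongr
      _ = ‖a • Complex.ofRealCLM‖ * (‖z‖ ^ k *
          ‖iteratedFDeriv ℝ n (fun z : Phase d => Real.exp (-kinPhase t z)) z‖) := by ring
      _ ≤ _ := by gcongr; exact hC z

/-- The kinetic semigroup `P_t f = Γ_t (p_t * f)`, `t > 0`, on tempered distributions, a smooth
function: `(P_t f)(z) = (p_t * f)(Γ_t z)`. (The value for `t ≤ 0` is not used.) -/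
def kinSemigroup (t : ℝ) (f : 𝓢'(Phase d, ℂ)) (z : Phase d) : ℂ :=
  if ht : 0 < t then conv (kinKernel t ht) f (transport t z) else 0

/-- `u = I_λ f` on `[0,T]`, where `I_λ f(t) = ∫_0^t e^{-λ(t-s)} P_{t-s} f(s) ds`. The integral is
an integral of tempered distributions, i.e. it is taken after testing with a Schwartz function `ψ`,
where `⟨P_{t-s} f(s), ψ⟩ = ∫ (P_{t-s} f(s))(z) ψ(z) dz`; that the integrals converge is part of the
definition. -/
structure IsDuhamel (lam T : ℝ) (f u : ℝ → 𝓢'(Phase d, ℂ)) : Prop where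
  integrable_space : ∀ t ∈ Icc 0 T, ∀ s ∈ Ico 0 t, ∀ ψ : 𝓢(Phase d, ℂ),
    Integrable (fun z => kinSemigroup (t - s) (f s) z * ψ z) volume
  integrable_time : ∀ t ∈ Icc 0 T, ∀ ψ : 𝓢(Phase d, ℂ),
    IntervalIntegrable (fun s => (Real.exp (-lam * (t - s)) : ℂ) *
      ∫ z, kinSemigroup (t - s) (f s) z * ψ z) volume 0 t
  eq_integral : ∀ t ∈ Icc 0 T, ∀ ψ : 𝓢(Phase d, ℂ),
    u t ψ = ∫ s in (0 : ℝ)..t, (Real.exp (-lam * (t - s)) : ℂ) *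
      ∫ z, kinSemigroup (t - s) (f s) z * ψ z

end Kinetic

end

/-! Write L = λ ∨ 1, b = (θ-β)/2 and γ = 1 - 1/q - θ/2 (`gainExp`); the condition on q says that γ ≥
0 and forces q > 1.

In space, everything is reduced to weighted L¹ norms of kernels. The blocks of a distribution g are
continuous functions whose weighted size is at most 2^{βl}M. The symbol of a fattened block is 1 on
the support of the symbol of the block, so g is recovered by testing its blocks against fattened
test functions (`tendsto_sum_conv`). The weights are moderate, ρ(z) ≤ C ρ(y) (1+|z-y|)^m, and so the
weighted sup norm of G * g is at most C M Σ_l 2^{βl} ∫ (1+|y|)^m |fat_l * G|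
(`weight_mul_norm_conv_le`). The kernel p_t is an anisotropic rescaling of p_1. A block kernel has
Fourier support in an annulus, hence is a sum of derivatives of kernels of the same kind, to any
order; four integrations by parts give fat_l * p_t the size (1+4^l t)^{-2}. Summing over l yields
three bounds for the semigroup: t^{-β/2} for P_t g, an additional factor min(1, h/t) for its
increment along the transport, and 2^{βk}(1+4^k t)^{-2} for its k-th block.

The last bound is the delicate one, because the transport does not commute with the blocks: R_k P_t
g is the convolution of g with p_t and a sheared block kernel, evaluated at Γ_t z. The kinetic
scaling, which turns Γ_t into Γ_{R²t}, shows that the shear is harmless as long as 4^k t ≤ 1; for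
larger times it is moved onto the heat kernel, where it becomes a shear by time 1
(`exists_sconv_transport_blk_kinKernel_le`).

In time, e^{-λτ} ≤ C (Lτ)^{-γ} min(1, (Lτ)^{-1}) trades the exponential for the power of L. With p
conjugate to q one has -γ - β/2 = b - 1/p, and Hölder's inequality leaves the L^p norm of τ^{b-1/p}
min(1, (a/τ)^k), which is a multiple of a^b (`lintegral_timeKernel_rpow_le`). The choice a = 1/L
bounds the sup norm, a = |t-s| the increments, and b = θ/2, a = 4^{-k} the k-th block. An increment
of the Duhamel integral consists of the increment of the semigroup on [0,s], the new part on [s,t],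
and (e^{-λ(t-s)} - 1) u(s); in the last term (L|t-s|)^b is compensated by the surplus factor L^{-b}
in the bound for u(s).

Since f is only weakly measurable in time, it is replaced by an almost everywhere equal family with
measurable blocks (`MemLqC.exists_modification`). Then the pointwise Duhamel integral is jointly
measurable, and Fubini's theorem identifies it with the distributional one. -/

noncomputable section

namespace Kinetic

variable {d : ℕ}

/-! ## Translations and convolutions of Schwartz functions -/

section General

open LineDeriv BoundedContinuousFunction

set_option linter.unusedSectionVars false

variable {E : Type*} [NormedAddCommGroup E] [InnerProductSpace ℝ E]

/-- The translate `x ↦ ψ (x - a)` of a Schwartz function. -/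
abbrev translate (a : E) (ψ : 𝓢(E, ℂ)) : 𝓢(E, ℂ) := SchwartzMap.compSubConstCLM ℂ a ψ

theorem exists_one_add_norm_pow_mul_iteratedFDeriv_le (ψ : 𝓢(E, ℂ)) (k n : ℕ) :
    ∃ C : ℝ, 0 ≤ C ∧ ∀ x, (1 + ‖x‖) ^ k * ‖iteratedFDeriv ℝ n ψ x‖ ≤ C :=
  ⟨_, by positivity,
    SchwartzMap.one_add_le_sup_seminorm_apply (𝕜 := ℂ) (m := (k, n)) le_rfl le_rfl ψ⟩

theorem one_add_norm_le_mul_sub (x a : E) : 1 + ‖x‖ ≤ (1 + ‖a‖) * (1 + ‖x - a‖) := by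
  have h := norm_add_le (x - a) a
  rw [sub_add_cancel] at h
  nlinarith [norm_nonneg a, norm_nonneg (x - a)]

theorem exists_seminorm_translate_le (ψ : 𝓢(E, ℂ)) (k n : ℕ) :
    ∃ C : ℝ, 0 ≤ C ∧ ∀ a, SchwartzMap.seminorm ℂ k n (translate a ψ) ≤ C * (1 + ‖a‖) ^ k := by
  obtain ⟨C, hC, h⟩ := exists_one_add_norm_pow_mul_iteratedFDeriv_le ψ k n
  refine ⟨C, hC, fun a => SchwartzMap.seminorm_le_bound ℂ k n _ (by positivity) fun x => ?_⟩
  have h1 : iteratedFDeriv ℝ n (translate a ψ) x = iteratedFDeriv ℝ n ψ (x - a) :=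
    iteratedFDeriv_comp_sub (f := ψ) n a x
  rw [h1]
  calc ‖x‖ ^ k * ‖iteratedFDeriv ℝ n ψ (x - a)‖
      ≤ ((1 + ‖a‖) * (1 + ‖x - a‖)) ^ k * ‖iteratedFDeriv ℝ n ψ (x - a)‖ := by
        gcongr
        linarith [one_add_norm_le_mul_sub x a]
    _ = (1 + ‖a‖) ^ k * ((1 + ‖x - a‖) ^ k * ‖iteratedFDeriv ℝ n ψ (x - a)‖) := by
        rw [mul_pow]; ring
    _ ≤ (1 + ‖a‖) ^ k * C := by gcongr; exact h _
    _ = _ := mul_comm _ _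

/-- The mean value inequality in each seminorm costs one more derivative. This continuity makes the
blocks of a distribution continuous functions. -/
theorem continuous_translate (ψ : 𝓢(E, ℂ)) : Continuous fun a => translate a ψ := by
  rw [continuous_iff_continuousAt]
  intro a₀
  rw [ContinuousAt, (schwartz_withSeminorms ℂ E ℂ).tendsto_nhds]
  rintro ⟨k, n⟩ ε hε
  obtain ⟨K, hK, hb⟩ := exists_one_add_norm_pow_mul_iteratedFDeriv_le ψ k (n + 1)
  -- `K` bounds the weighted derivative of order `n + 1`; replacing the weight at `x` by the weight
  -- at a point within distance 1 of `x - a₀` costs the other factor.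
  set D : ℝ := K * (2 + ‖a₀‖) ^ k with hD
  have hD0 : 0 ≤ D := by positivity
  have hball : Metric.ball a₀ (min 1 (ε / (D + 1))) ∈ nhds a₀ :=
    Metric.ball_mem_nhds _ (by positivity)
  filter_upwards [hball] with a ha
  rw [Metric.mem_ball, dist_eq_norm, lt_min_iff] at ha
  refine lt_of_le_of_lt (b := D * ‖a - a₀‖) ?_ ?_
  swap
  · calc D * ‖a - a₀‖ ≤ D * (ε / (D + 1)) := by gcongr; exact ha.2.le
      _ < ε := by
        rw [mul_div_assoc', div_lt_iff₀ (by positivity)]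
        nlinarith
  refine SchwartzMap.seminorm_le_bound ℂ k n _ (by positivity) fun x => ?_
  have h1 (b : E) : iteratedFDeriv ℝ n (translate b ψ) x = iteratedFDeriv ℝ n ψ (x - b) :=
    iteratedFDeriv_comp_sub (f := ψ) n b x
  have h2 : iteratedFDeriv ℝ n (translate a ψ - translate a₀ ψ : 𝓢(E, ℂ)) x =
      iteratedFDeriv ℝ n ψ (x - a) - iteratedFDeriv ℝ n ψ (x - a₀) := by
    rw [← h1, ← h1]
    exact iteratedFDeriv_sub_apply ((translate a ψ).smooth n).contDiffAt
      ((translate a₀ ψ).smooth n).contDiffAt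
  rw [h2]
  have hmvt : ‖iteratedFDeriv ℝ n ψ (x - a) - iteratedFDeriv ℝ n ψ (x - a₀)‖ ≤
      D / (1 + ‖x‖) ^ k * ‖(x - a) - (x - a₀)‖ := by
    refine Convex.norm_image_sub_le_of_norm_fderiv_le (𝕜 := ℝ)
      (s := Metric.closedBall (x - a₀) 1) (fun y _ => ?_) (fun y hy => ?_)
      (convex_closedBall _ _) (Metric.mem_closedBall_self zero_le_one) ?_
    · exact ((ψ.smooth ⊤).differentiable_iteratedFDeriv
        (by exact_mod_cast ENat.natCast_lt_top n)) y
    · rw [norm_fderiv_iteratedFDeriv, le_div_iff₀ (by positivity)]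
      have hxy : 1 + ‖x‖ ≤ (2 + ‖a₀‖) * (1 + ‖y‖) := by
        have e : x = y + (a₀ - (y - (x - a₀))) := by abel
        have n1 : ‖x‖ ≤ ‖y‖ + (‖a₀‖ + ‖y - (x - a₀)‖) := by
          conv_lhs => rw [e]
          exact (norm_add_le _ _).trans (by gcongr; exact norm_sub_le _ _)
        rw [Metric.mem_closedBall, dist_eq_norm] at hy
        nlinarith [norm_nonneg y, norm_nonneg a₀]
      calc ‖iteratedFDeriv ℝ (n + 1) ψ y‖ * (1 + ‖x‖) ^ k
          ≤ ‖iteratedFDeriv ℝ (n + 1) ψ y‖ * ((2 + ‖a₀‖) * (1 + ‖y‖)) ^ k := by gcongr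
        _ = ((1 + ‖y‖) ^ k * ‖iteratedFDeriv ℝ (n + 1) ψ y‖) * (2 + ‖a₀‖) ^ k := by
          rw [mul_pow]; ring
        _ ≤ D := by rw [hD]; gcongr; exact hb y
    · rw [Metric.mem_closedBall, dist_eq_norm]
      have : x - a - (x - a₀) = -(a - a₀) := by abel
      rw [this, norm_neg]
      exact ha.1.le
  have h3 : ‖(x - a) - (x - a₀)‖ = ‖a - a₀‖ := by
    have : x - a - (x - a₀) = -(a - a₀) := by abel
    rw [this, norm_neg]
  rw [h3] at hmvt
  have h4 : ‖x‖ ^ k / (1 + ‖x‖) ^ k ≤ 1 := by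
    rw [div_le_one (by positivity)]
    gcongr
    linarith
  calc ‖x‖ ^ k * ‖iteratedFDeriv ℝ n ψ (x - a) - iteratedFDeriv ℝ n ψ (x - a₀)‖
      ≤ ‖x‖ ^ k * (D / (1 + ‖x‖) ^ k * ‖a - a₀‖) := by gcongr
    _ = (‖x‖ ^ k / (1 + ‖x‖) ^ k) * (D * ‖a - a₀‖) := by ring
    _ ≤ 1 * (D * ‖a - a₀‖) := by gcongr
    _ = _ := one_mul _

/-! ### Factorisation of tempered distributions through Banach spaces of jets. -/

/-- The Banach space of the tuples of bounded continuous functions in which the weighted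
derivatives `x ↦ ‖x‖^k ∂^n ψ(x)`, `(k, n) ∈ s`, of a Schwartz function live. -/
def JetSpace (E : Type*) [NormedAddCommGroup E] [InnerProductSpace ℝ E]
    (s : Finset (ℕ × ℕ)) : Type _ :=
  (i : s) → (E →ᵇ (E [×i.1.2]→L[ℝ] ℂ))

instance (s : Finset (ℕ × ℕ)) : NormedAddCommGroup (JetSpace E s) :=
  inferInstanceAs (NormedAddCommGroup ((i : s) → (E →ᵇ (E [×i.1.2]→L[ℝ] ℂ))))

instance (s : Finset (ℕ × ℕ)) : NormedSpace ℂ (JetSpace E s) :=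
  inferInstanceAs (NormedSpace ℂ ((i : s) → (E →ᵇ (E [×i.1.2]→L[ℝ] ℂ))))

instance (s : Finset (ℕ × ℕ)) : CompleteSpace (JetSpace E s) :=
  inferInstanceAs (CompleteSpace ((i : s) → (E →ᵇ (E [×i.1.2]→L[ℝ] ℂ))))

theorem JetSpace.norm_apply_le {s : Finset (ℕ × ℕ)} (F : JetSpace E s) (i : s) (x : E) :
    ‖F i x‖ ≤ ‖F‖ :=
  ((F i).norm_coe_le_norm x).trans
    (norm_le_pi_norm (ι := s) (G := fun i => (E →ᵇ (E [×i.1.2]→L[ℝ] ℂ))) F i)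

theorem JetSpace.norm_le {s : Finset (ℕ × ℕ)} (F : JetSpace E s) {C : ℝ} (hC : 0 ≤ C)
    (h : ∀ i x, ‖F i x‖ ≤ C) : ‖F‖ ≤ C :=
  (pi_norm_le_iff_of_nonneg (ι := s) (G := fun i => (E →ᵇ (E [×i.1.2]→L[ℝ] ℂ))) hC).2
    fun i => (BoundedContinuousFunction.norm_le hC).2 fun x => h i x

/-- The evaluation of a component of a jet. -/
def JetSpace.eval {s : Finset (ℕ × ℕ)} (i : s) (x : E) (v : Fin i.1.2 → E) :
    JetSpace E s →L[ℂ] ℂ :=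
  LinearMap.mkContinuous
    { toFun F := F i x v
      map_add' _ _ := rfl
      map_smul' _ _ := rfl } (∏ k, ‖v k‖) fun F => by
    rw [mul_comm]
    exact ((F i x).le_opNorm v).trans (by gcongr; exact F.norm_apply_le i x)

theorem JetSpace.ext {s : Finset (ℕ × ℕ)} {F G : JetSpace E s}
    (h : ∀ (i : s) (x : E) (v : Fin i.1.2 → E), F i x v = G i x v) : F = G := by
  funext i
  ext x v
  exact h i x v

/-- The tuple of the functions `x ↦ ‖x‖^k ∂^n ψ(x)`, `(k, n) ∈ s`. -/
def weightedJet (s : Finset (ℕ × ℕ)) : 𝓢(E, ℂ) →ₗ[ℂ] JetSpace E s where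
  toFun ψ i := BoundedContinuousFunction.ofNormedAddCommGroup
    (fun x => (‖x‖ ^ i.1.1 : ℝ) • iteratedFDeriv ℝ i.1.2 ψ x)
    ((continuous_norm.pow _).smul ((ψ.smooth _).continuous_iteratedFDeriv le_rfl))
    (SchwartzMap.seminorm ℂ i.1.1 i.1.2 ψ) (fun x => by
      rw [norm_smul, Real.norm_of_nonneg (by positivity)]
      exact SchwartzMap.le_seminorm ℂ _ _ ψ x)
  map_add' ψ χ := by
    refine JetSpace.ext fun i x v => ?_
    have : iteratedFDeriv ℝ i.1.2 (ψ + χ : 𝓢(E, ℂ)) x =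
        iteratedFDeriv ℝ i.1.2 ψ x + iteratedFDeriv ℝ i.1.2 χ x :=
      iteratedFDeriv_add_apply (ψ.smooth _).contDiffAt (χ.smooth _).contDiffAt
    change ((‖x‖ ^ i.1.1 : ℝ) • iteratedFDeriv ℝ i.1.2 (ψ + χ : 𝓢(E, ℂ)) x) v =
      ((‖x‖ ^ i.1.1 : ℝ) • iteratedFDeriv ℝ i.1.2 ψ x +
        (‖x‖ ^ i.1.1 : ℝ) • iteratedFDeriv ℝ i.1.2 χ x) v
    rw [this, smul_add]
  map_smul' c ψ := by
    refine JetSpace.ext fun i x v => ?_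
    have : iteratedFDeriv ℝ i.1.2 (c • ψ : 𝓢(E, ℂ)) x = c • iteratedFDeriv ℝ i.1.2 ψ x :=
      iteratedFDeriv_const_smul_apply (ψ.smooth _).contDiffAt
    change ((‖x‖ ^ i.1.1 : ℝ) • iteratedFDeriv ℝ i.1.2 (c • ψ : 𝓢(E, ℂ)) x) v =
      (c • ((‖x‖ ^ i.1.1 : ℝ) • iteratedFDeriv ℝ i.1.2 ψ x)) v
    rw [this, smul_comm]

theorem weightedJet_apply (s : Finset (ℕ × ℕ)) (ψ : 𝓢(E, ℂ)) (i : s) (x : E) :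
    weightedJet s ψ i x = (‖x‖ ^ i.1.1 : ℝ) • iteratedFDeriv ℝ i.1.2 ψ x := rfl

theorem norm_weightedJet_apply (s : Finset (ℕ × ℕ)) (ψ : 𝓢(E, ℂ)) (i : s) (x : E) :
    ‖weightedJet s ψ i x‖ = ‖x‖ ^ i.1.1 * ‖iteratedFDeriv ℝ i.1.2 ψ x‖ := by
  rw [weightedJet_apply, norm_smul, Real.norm_of_nonneg (by positivity)]

theorem norm_weightedJet_le (s : Finset (ℕ × ℕ)) (ψ : 𝓢(E, ℂ)) :
    ‖weightedJet s ψ‖ ≤ s.sup (schwartzSeminormFamily ℂ E ℂ) ψ :=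
  JetSpace.norm_le _ (apply_nonneg _ _) fun i x => by
    rw [norm_weightedJet_apply]
    exact (SchwartzMap.le_seminorm ℂ _ _ ψ x).trans
      (Seminorm.le_finset_sup_apply (p := schwartzSeminormFamily ℂ E ℂ) i.2)

theorem continuous_weightedJet (s : Finset (ℕ × ℕ)) :
    Continuous (weightedJet s : 𝓢(E, ℂ) →ₗ[ℂ] JetSpace E s) := by
  apply WithSeminorms.continuous_normedSpace_rng (JetSpace E s) (schwartz_withSeminorms ℂ E ℂ)
  exact ⟨s, 1, fun ψ => by simpa using norm_weightedJet_le s ψ⟩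

theorem exists_seminorm_bound (g : 𝓢'(E, ℂ)) : ∃ (s : Finset (ℕ × ℕ)) (C : ℝ), 0 ≤ C ∧
    ∀ ψ : 𝓢(E, ℂ), ‖g ψ‖ ≤ C * s.sup (schwartzSeminormFamily ℂ E ℂ) ψ := by
  obtain ⟨s, C, -, hb⟩ := Seminorm.bound_of_continuous (schwartz_withSeminorms ℂ E ℂ)
    ((normSeminorm ℂ ℂ).comp (g : 𝓢(E, ℂ) →L[ℂ] ℂ).toLinearMap)
    (continuous_norm.comp g.continuous)
  exact ⟨s, C, C.2, fun ψ => hb ψ⟩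

/-- Every tempered distribution factors through a Banach space of jets. -/
theorem exists_weightedJet_factor (g : 𝓢'(E, ℂ)) :
    ∃ (s : Finset (ℕ × ℕ)) (G : JetSpace E s →L[ℂ] ℂ), ∀ ψ, G (weightedJet s ψ) = g ψ := by
  obtain ⟨s, C, hC, hb⟩ := exists_seminorm_bound g
  -- The component `(0, 0)` is the function itself; adjoining it makes the jet map injective, so
  -- that `g` descends to its range.
  set s' := insert (0, 0) s
  have hinj : Function.Injective (weightedJet s' : 𝓢(E, ℂ) →ₗ[ℂ] _) := by
    intro ψ χ h
    ext x
    have h1 : weightedJet s' ψ ⟨(0, 0), Finset.mem_insert_self _ _⟩ x ![] =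
        weightedJet s' χ ⟨(0, 0), Finset.mem_insert_self _ _⟩ x ![] := by rw [h]
    rw [weightedJet_apply, weightedJet_apply] at h1
    simpa using h1
  let e := LinearEquiv.ofInjective _ hinj
  let G₀ : LinearMap.range (weightedJet s' : 𝓢(E, ℂ) →ₗ[ℂ] JetSpace E s') →ₗ[ℂ] ℂ :=
    (g : 𝓢(E, ℂ) →L[ℂ] ℂ).toLinearMap ∘ₗ e.symm.toLinearMap
  have hG₁ (ψ : 𝓢(E, ℂ)) : G₀ (e ψ) = g ψ := by
    change g (e.symm (e ψ)) = g ψ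
    rw [LinearEquiv.symm_apply_apply]
  have hG₀ : ∀ y, ‖G₀ y‖ ≤ C * ‖y‖ := by
    intro y
    obtain ⟨ψ, rfl⟩ := e.surjective y
    rw [hG₁]
    refine (hb ψ).trans ?_
    gcongr
    refine Seminorm.finset_sup_apply_le (norm_nonneg _) fun i hi => ?_
    refine SchwartzMap.seminorm_le_bound ℂ i.1 i.2 _ (norm_nonneg _) fun x => ?_
    rw [← norm_weightedJet_apply s' ψ ⟨i, Finset.mem_insert_of_mem hi⟩ x]
    exact JetSpace.norm_apply_le _ _ _
  -- Hahn–Banach extends the functional from the range of the jet map to the whole space.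
  obtain ⟨G, hG, -⟩ := exists_extension_norm_eq _ (G₀.mkContinuous C hG₀)
  exact ⟨s', G, fun ψ => (hG (e ψ)).trans (hG₁ ψ)⟩

theorem exists_sup_seminorm_translate_le (ψ : 𝓢(E, ℂ)) (s : Finset (ℕ × ℕ)) :
    ∃ (C : ℝ) (k : ℕ), 0 ≤ C ∧
      ∀ a, s.sup (schwartzSeminormFamily ℂ E ℂ) (translate a ψ) ≤ C * (1 + ‖a‖) ^ k := by
  choose C hC h using fun i : ℕ × ℕ => exists_seminorm_translate_le ψ i.1 i.2
  refine ⟨∑ i ∈ s, C i, s.sup Prod.fst, Finset.sum_nonneg fun i _ => hC i, fun a => ?_⟩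
  refine Seminorm.finset_sup_apply_le (mul_nonneg (Finset.sum_nonneg fun i _ => hC i)
    (by positivity)) fun i hi => (h i a).trans ?_
  gcongr
  · exact Finset.sum_nonneg fun i _ => hC i
  · exact Finset.single_le_sum (fun i _ => hC i) hi
  · linarith [norm_nonneg a]
  · exact Finset.le_sup (f := Prod.fst) hi

/-- A tempered distribution, tested with translates of a Schwartz function, grows at most
polynomially. -/
theorem exists_norm_apply_translate_le (g : 𝓢'(E, ℂ)) (ψ : 𝓢(E, ℂ)) :
    ∃ (C : ℝ) (k : ℕ), 0 ≤ C ∧ ∀ a, ‖g (translate a ψ)‖ ≤ C * (1 + ‖a‖) ^ k := by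
  obtain ⟨s, C, hC, hb⟩ := exists_seminorm_bound g
  obtain ⟨D, k, hD, h⟩ := exists_sup_seminorm_translate_le ψ s
  exact ⟨C * D, k, by positivity, fun a => (hb _).trans (by rw [mul_assoc]; gcongr; exact h a)⟩

theorem continuous_apply_translate (g : 𝓢'(E, ℂ)) (ψ : 𝓢(E, ℂ)) :
    Continuous fun a => g (translate a ψ) :=
  g.continuous.comp (continuous_translate ψ)

/-! ### Convolution of Schwartz functions and its pairing with distributions. -/

variable [FiniteDimensional ℝ E] [MeasurableSpace E] [BorelSpace E]

/-- The convolution of Schwartz functions. -/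
abbrev sconv (f g : 𝓢(E, ℂ)) : 𝓢(E, ℂ) :=
  SchwartzMap.convolution (ContinuousLinearMap.mul ℂ ℂ) f g

theorem sconv_apply (f g : 𝓢(E, ℂ)) (x : E) : sconv f g x = ∫ y, f y * g (x - y) := by
  rw [SchwartzMap.convolution_apply]
  rfl

theorem fourier_sconv_apply (f g : 𝓢(E, ℂ)) (ξ : E) : 𝓕 (sconv f g) ξ = 𝓕 f ξ * 𝓕 g ξ := by
  rw [SchwartzMap.fourier_convolution, SchwartzMap.pairing_apply_apply]
  rfl

/-- Injectivity of the Fourier transform: identities between convolutions, derivatives and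
multipliers become pointwise identities of symbols. -/
theorem schwartz_ext_fourier {f g : 𝓢(E, ℂ)} (h : ∀ ξ, 𝓕 f ξ = 𝓕 g ξ) : f = g := by
  have : 𝓕 f = 𝓕 g := SchwartzMap.ext h
  have h1 : 𝓕⁻ (𝓕 f) = f := FourierTransform.fourierInv_fourier_eq f
  have h2 : 𝓕⁻ (𝓕 g) = g := FourierTransform.fourierInv_fourier_eq g
  rw [← h1, this, h2]

theorem sconv_comm (f g : 𝓢(E, ℂ)) : sconv f g = sconv g f :=
  schwartz_ext_fourier fun ξ => by simp only [fourier_sconv_apply, mul_comm]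

theorem sconv_assoc (f g h : 𝓢(E, ℂ)) : sconv (sconv f g) h = sconv f (sconv g h) :=
  schwartz_ext_fourier fun ξ => by simp only [fourier_sconv_apply, mul_assoc]

theorem fourier_lineDeriv_apply (f : 𝓢(E, ℂ)) (v ξ : E) :
    𝓕 (∂_{v} f) ξ = (2 * Real.pi * Complex.I) * (inner ℝ ξ v * 𝓕 f ξ) := by
  have hv : (inner ℝ · v : E → ℝ).HasTemperateGrowth := by fun_prop
  rw [SchwartzMap.fourier_lineDerivOp_eq]
  simp [SchwartzMap.smulLeftCLM_apply_apply hv]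

theorem lineDeriv_sconv (f g : 𝓢(E, ℂ)) (v : E) : ∂_{v} (sconv f g) = sconv f (∂_{v} g) :=
  schwartz_ext_fourier fun ξ => by
    simp only [fourier_sconv_apply, fourier_lineDeriv_apply]; ring

theorem lineDeriv_sconv' (f g : 𝓢(E, ℂ)) (v : E) : sconv (∂_{v} f) g = sconv f (∂_{v} g) :=
  schwartz_ext_fourier fun ξ => by
    simp only [fourier_sconv_apply, fourier_lineDeriv_apply]; ring

theorem iteratedLineDeriv_sconv (f g : 𝓢(E, ℂ)) {n : ℕ} (v : Fin n → E) :
    ∂^{v} (sconv f g) = sconv f (∂^{v} g) := by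
  induction n with
  | zero => simp
  | succ n ih => rw [iteratedLineDerivOp_succ_left, iteratedLineDerivOp_succ_left, ih,
      lineDeriv_sconv]

theorem integrable_one_add_norm_pow_mul (ψ : 𝓢(E, ℂ)) (k n : ℕ) :
    Integrable fun x => (1 + ‖x‖) ^ k * ‖iteratedFDeriv ℝ n ψ x‖ := by
  have h : (fun x => (1 + ‖x‖) ^ k * ‖iteratedFDeriv ℝ n ψ x‖) = fun x =>
      ∑ i ∈ Finset.range (k + 1), (k.choose i : ℝ) * (‖x‖ ^ i * ‖iteratedFDeriv ℝ n ψ x‖) := by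
    funext x
    rw [add_comm, add_pow, Finset.sum_mul]
    refine Finset.sum_congr rfl fun i _ => ?_
    simp only [one_pow]
    ring
  rw [h]
  exact integrable_finsetSum _ fun i _ =>
    (SchwartzMap.integrable_pow_mul_iteratedFDeriv volume ψ i n).const_mul _

theorem integrable_one_add_norm_pow_mul_norm (ψ : 𝓢(E, ℂ)) (k : ℕ) :
    Integrable fun x => (1 + ‖x‖) ^ k * ‖ψ x‖ := by
  simpa using integrable_one_add_norm_pow_mul ψ k 0

/-- A tempered distribution may be interchanged with the integral that defines a convolution. -/
theorem integral_mul_translate (g : 𝓢'(E, ℂ)) (χ ψ : 𝓢(E, ℂ)) :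
    ∫ a, χ a * g (translate a ψ) = g (sconv χ ψ) := by
  obtain ⟨s, G, hG⟩ := exists_weightedJet_factor g
  -- The Bochner integral is taken in the Banach space of jets, through which `g` factors. It
  -- converges because translates grow polynomially there while `χ` decays rapidly.
  let _ : NormedSpace ℝ (JetSpace E s) := NormedSpace.restrictScalars ℝ ℂ _
  have hint : Integrable fun a => χ a • weightedJet s (translate a ψ) := by
    obtain ⟨C, k, hC, h⟩ := exists_sup_seminorm_translate_le ψ s
    refine ((integrable_one_add_norm_pow_mul_norm χ k).const_mul C).mono'
      (χ.continuous.smul ((continuous_weightedJet s).comp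
        (continuous_translate ψ))).aestronglyMeasurable (Filter.Eventually.of_forall fun a => ?_)
    rw [norm_smul]
    calc ‖χ a‖ * ‖weightedJet s (translate a ψ)‖ ≤ ‖χ a‖ * (C * (1 + ‖a‖) ^ k) := by
          gcongr
          exact (norm_weightedJet_le _ _).trans (h a)
      _ = _ := by ring
  have h1 : ∫ a, χ a * g (translate a ψ) = G (∫ a, χ a • weightedJet s (translate a ψ)) := by
    rw [← ContinuousLinearMap.integral_comp_comm G hint]
    simp only [map_smul, hG, smul_eq_mul]
  rw [h1, ← hG]
  -- What remains is that the integral of the jets is the jet of the convolution. Evaluations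
  -- commute with the integral, and derivatives of a convolution fall on its second factor.
  congr 1
  refine JetSpace.ext fun i x v => ?_
  change JetSpace.eval i x v _ = _
  rw [← ContinuousLinearMap.integral_comp_comm _ hint]
  have hder (a : E) : iteratedFDeriv ℝ i.1.2 (translate a ψ) x v = (∂^{v} ψ : 𝓢(E, ℂ)) (x - a) := by
    rw [SchwartzMap.iteratedLineDerivOp_eq_iteratedFDeriv]
    change iteratedFDeriv ℝ i.1.2 (fun z => ψ (z - a)) x v = _
    rw [iteratedFDeriv_comp_sub]
  have h2 (a : E) : JetSpace.eval i x v (χ a • weightedJet s (translate a ψ)) =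
      (‖x‖ ^ i.1.1 : ℝ) • (χ a * (∂^{v} ψ : 𝓢(E, ℂ)) (x - a)) := by
    rw [map_smul, ← hder]
    change χ a * ((‖x‖ ^ i.1.1 : ℝ) • iteratedFDeriv ℝ i.1.2 (translate a ψ) x v) = _
    simp only [Complex.real_smul]
    ring
  simp_rw [h2]
  rw [integral_smul, ← sconv_apply, ← iteratedLineDeriv_sconv,
    SchwartzMap.iteratedLineDerivOp_eq_iteratedFDeriv]
  rfl

end General

/-! ## Linear rescaling and weighted `L¹` norms -/

section General

open LineDeriv

set_option linter.unusedSectionVars false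

variable {E : Type*} [NormedAddCommGroup E] [InnerProductSpace ℝ E]
variable [FiniteDimensional ℝ E] [MeasurableSpace E] [BorelSpace E]

/-- The absolute value of the determinant of a linear automorphism. -/
def absDet (L : E ≃L[ℝ] E) : ℝ := |LinearMap.det ((L : E →L[ℝ] E) : E →ₗ[ℝ] E)|

theorem absDet_pos (L : E ≃L[ℝ] E) : 0 < absDet L :=
  abs_pos.2 (LinearEquiv.isUnit_det' L.toLinearEquiv).ne_zero

theorem absDet_trans (L M : E ≃L[ℝ] E) : absDet (L.trans M) = absDet M * absDet L := by
  unfold absDet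
  rw [← abs_mul, ← LinearMap.det_comp]
  rfl

theorem absDet_refl : absDet (ContinuousLinearEquiv.refl ℝ E) = 1 := by
  unfold absDet
  rw [show (((ContinuousLinearEquiv.refl ℝ E : E ≃L[ℝ] E) : E →L[ℝ] E) : E →ₗ[ℝ] E) =
    LinearMap.id from rfl, LinearMap.det_id, abs_one]

theorem map_volume_equiv (L : E ≃L[ℝ] E) :
    Measure.map L volume = ENNReal.ofReal (absDet L)⁻¹ • (volume : Measure E) := by
  have h := Measure.map_linearMap_addHaar_eq_smul_addHaar (volume : Measure E)
    (f := ((L : E →L[ℝ] E) : E →ₗ[ℝ] E)) (LinearEquiv.isUnit_det' L.toLinearEquiv).ne_zero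
  rw [abs_inv] at h
  exact h

theorem integral_comp_equiv {F : Type*} [NormedAddCommGroup F] [NormedSpace ℝ F]
    (L : E ≃L[ℝ] E) (f : E → F) : ∫ x, f x = absDet L • ∫ x, f (L x) := by
  have h : ∫ x, f (L x) = ∫ y, f y ∂(Measure.map L volume) :=
    (L.toHomeomorph.measurableEmbedding.integral_map (g := f)).symm
  rw [h, map_volume_equiv, integral_smul_measure, ENNReal.toReal_ofReal
    (inv_nonneg.2 (absDet_pos L).le), smul_smul, mul_inv_cancel₀ (absDet_pos L).ne', one_smul]

theorem integrable_comp_equiv {F : Type*} [NormedAddCommGroup F]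
    (L : E ≃L[ℝ] E) {f : E → F} (hf : Integrable f) : Integrable fun x => f (L x) := by
  refine (L.toHomeomorph.measurableEmbedding.integrable_map_iff (g := f)).1 ?_
  change Integrable f (Measure.map L volume)
  rw [map_volume_equiv]
  exact hf.smul_measure ENNReal.ofReal_ne_top

/-- The rescaling `|det L| G ∘ L` of a Schwartz function. -/
def scale (L : E ≃L[ℝ] E) : 𝓢(E, ℂ) →L[ℂ] 𝓢(E, ℂ) :=
  (absDet L : ℂ) • SchwartzMap.compCLMOfContinuousLinearEquiv ℂ L

theorem scale_apply (L : E ≃L[ℝ] E) (G : 𝓢(E, ℂ)) (x : E) : scale L G x = absDet L * G (L x) := rfl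

theorem scale_scale (L M : E ≃L[ℝ] E) (G : 𝓢(E, ℂ)) :
    scale L (scale M G) = scale (L.trans M) G := by
  ext x
  simp only [scale_apply, absDet_trans, ContinuousLinearEquiv.trans_apply]
  push_cast
  ring

theorem scale_refl (G : 𝓢(E, ℂ)) : scale (ContinuousLinearEquiv.refl ℝ E) G = G := by
  ext x
  simp [scale_apply, absDet_refl]

theorem scale_sconv (L : E ≃L[ℝ] E) (f g : 𝓢(E, ℂ)) :
    scale L (sconv f g) = sconv (scale L f) (scale L g) := by
  ext x
  rw [scale_apply, sconv_apply, sconv_apply, integral_comp_equiv L]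
  simp only [scale_apply, map_sub, Complex.real_smul]
  rw [← integral_const_mul, ← integral_const_mul]
  refine integral_congr_ae (Filter.Eventually.of_forall fun y => ?_)
  ring

theorem lineDeriv_scale (L : E ≃L[ℝ] E) (G : 𝓢(E, ℂ)) (v : E) :
    ∂_{v} (scale L G) = scale L (∂_{L v} G) := by
  change ∂_{v} ((absDet L : ℂ) • SchwartzMap.compCLMOfContinuousLinearEquiv ℂ L G) =
    (absDet L : ℂ) • SchwartzMap.compCLMOfContinuousLinearEquiv ℂ L (∂_{L v} G)
  rw [LineDeriv.lineDerivOp_smul, SchwartzMap.lineDerivOp_compCLMOfContinuousLinearEquiv]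

/-- Symmetry of `M` lets it cross the inner product in the phase, so dilating a symbol by `M`
dilates the kernel by the inverse, with the normalisation that preserves L¹ norms. -/
theorem fourierInv_comp_equiv (M : E ≃L[ℝ] E) (hM : ∀ x y, inner ℝ (M x) y = inner ℝ x (M y))
    (a : 𝓢(E, ℂ)) :
    𝓕⁻ (SchwartzMap.compCLMOfContinuousLinearEquiv ℂ M a) = scale M.symm (𝓕⁻ a) := by
  ext z
  have hi (x y : E) : inner ℝ (M.symm x) y = inner ℝ x (M.symm y) := by
    rw [← M.apply_symm_apply y, ← hM, M.apply_symm_apply, M.symm_apply_apply]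
  rw [scale_apply, SchwartzMap.fourierInv_coe, SchwartzMap.fourierInv_coe,
    Real.fourierInv_eq', Real.fourierInv_eq', integral_comp_equiv M.symm, Complex.real_smul]
  congr 1
  refine integral_congr_ae (Filter.Eventually.of_forall fun y => ?_)
  simp only [SchwartzMap.compCLMOfContinuousLinearEquiv_apply, Function.comp_apply,
    ContinuousLinearEquiv.apply_symm_apply, hi]

/-- The weighted `L¹` norm `∫ (1 + |y|)^m |∂^n G(y)| dy`. -/
def derivL1 (m n : ℕ) (G : 𝓢(E, ℂ)) : ℝ := ∫ y, (1 + ‖y‖) ^ m * ‖iteratedFDeriv ℝ n G y‖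

/-- The weighted `L¹` norm `∫ (1 + |y|)^m |G(y)| dy`. -/
def weightedL1 (m : ℕ) (G : 𝓢(E, ℂ)) : ℝ := ∫ y, (1 + ‖y‖) ^ m * ‖G y‖

theorem derivL1_zero (m : ℕ) (G : 𝓢(E, ℂ)) : derivL1 m 0 G = weightedL1 m G := by
  simp [derivL1, weightedL1]

theorem derivL1_nonneg (m n : ℕ) (G : 𝓢(E, ℂ)) : 0 ≤ derivL1 m n G :=
  integral_nonneg fun _ => by positivity

theorem weightedL1_nonneg (m : ℕ) (G : 𝓢(E, ℂ)) : 0 ≤ weightedL1 m G :=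
  integral_nonneg fun _ => by positivity

theorem weightedL1_add_le (m : ℕ) (f g : 𝓢(E, ℂ)) :
    weightedL1 m (f + g) ≤ weightedL1 m f + weightedL1 m g := by
  unfold weightedL1
  rw [← integral_add (integrable_one_add_norm_pow_mul_norm f m)
    (integrable_one_add_norm_pow_mul_norm g m)]
  refine integral_mono (integrable_one_add_norm_pow_mul_norm _ m)
    ((integrable_one_add_norm_pow_mul_norm f m).add
      (integrable_one_add_norm_pow_mul_norm g m)) fun y => ?_
  simp only [← mul_add]
  gcongr
  exact norm_add_le _ _

theorem weightedL1_neg (m : ℕ) (f : 𝓢(E, ℂ)) : weightedL1 m (-f) = weightedL1 m f := by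
  simp [weightedL1]

theorem weightedL1_sub_le (m : ℕ) (f g : 𝓢(E, ℂ)) :
    weightedL1 m (f - g) ≤ weightedL1 m f + weightedL1 m g := by
  rw [sub_eq_add_neg, ← weightedL1_neg m g]
  exact weightedL1_add_le _ _ _

theorem weightedL1_sum_le {ι : Type*} (s : Finset ι) (m : ℕ) (f : ι → 𝓢(E, ℂ)) :
    weightedL1 m (∑ i ∈ s, f i) ≤ ∑ i ∈ s, weightedL1 m (f i) := by
  classical
  induction s using Finset.induction_on with
  | empty => simp [weightedL1]
  | insert i s hi ih =>
    rw [Finset.sum_insert hi, Finset.sum_insert hi]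
    exact (weightedL1_add_le _ _ _).trans (by gcongr)

/-- Young's inequality, combined with the submultiplicativity 1+|x| ≤ (1+|y|)(1+|x-y|) of the
weight. -/
theorem weightedL1_sconv_le (m : ℕ) (f g : 𝓢(E, ℂ)) :
    weightedL1 m (sconv f g) ≤ weightedL1 m f * weightedL1 m g := by
  set F : E → ℝ := fun y => (1 + ‖y‖) ^ m * ‖f y‖
  set G : E → ℝ := fun y => (1 + ‖y‖) ^ m * ‖g y‖
  have hF : Integrable F := integrable_one_add_norm_pow_mul_norm f m
  have hG : Integrable G := integrable_one_add_norm_pow_mul_norm g m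
  have h1 : Integrable (convolution F G (ContinuousLinearMap.mul ℝ ℝ) volume) :=
    hF.integrable_convolution _ hG
  have h2 : ∫ x, convolution F G (ContinuousLinearMap.mul ℝ ℝ) volume x =
      weightedL1 m f * weightedL1 m g := integral_convolution _ hF hG
  rw [← h2]
  have h3 : ∀ᵐ x : E, ConvolutionExistsAt F G x (ContinuousLinearMap.mul ℝ ℝ) volume :=
    hF.ae_convolution_exists _ hG
  refine integral_mono_ae (integrable_one_add_norm_pow_mul_norm _ m) h1 ?_
  filter_upwards [h3] with x hx
  change (1 + ‖x‖) ^ m * ‖sconv f g x‖ ≤ _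
  rw [sconv_apply]
  calc (1 + ‖x‖) ^ m * ‖∫ y, f y * g (x - y)‖
      = ‖∫ y, ((1 + ‖x‖) ^ m : ℝ) • (f y * g (x - y))‖ := by
        rw [integral_smul, norm_smul, Real.norm_of_nonneg (by positivity)]
    _ ≤ ∫ y, F y * G (x - y) := by
        refine norm_integral_le_of_norm_le hx (Filter.Eventually.of_forall fun y => ?_)
        rw [norm_smul, Real.norm_of_nonneg (by positivity), norm_mul]
        calc (1 + ‖x‖) ^ m * (‖f y‖ * ‖g (x - y)‖)
            ≤ ((1 + ‖y‖) * (1 + ‖x - y‖)) ^ m * (‖f y‖ * ‖g (x - y)‖) := by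
              gcongr
              exact one_add_norm_le_mul_sub x y
          _ = F y * G (x - y) := by simp only [F, G, mul_pow]; ring

/-- The Jacobian cancels the normalisation of `scale`; the chain rule produces the norm of `L`, and
the weight produces the norm of its inverse. -/
theorem derivL1_scale_le (L : E ≃L[ℝ] E) (m n : ℕ) (G : 𝓢(E, ℂ)) :
    derivL1 m n (scale L G) ≤
      max 1 ‖(L.symm : E →L[ℝ] E)‖ ^ m * ‖(L : E →L[ℝ] E)‖ ^ n * derivL1 m n G := by
  set A := max 1 ‖(L.symm : E →L[ℝ] E)‖
  have hA : 1 ≤ A := le_max_left _ _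
  have hder (y : E) : ‖iteratedFDeriv ℝ n (scale L G) y‖ ≤
      absDet L * (‖(L : E →L[ℝ] E)‖ ^ n * ‖iteratedFDeriv ℝ n G (L y)‖) := by
    have h1 : (scale L G : E → ℂ) = (absDet L : ℂ) • (G ∘ (L : E →L[ℝ] E)) := rfl
    rw [h1, iteratedFDeriv_const_smul_apply
      ((G.smooth n).contDiffAt.comp y (L : E →L[ℝ] E).contDiff.contDiffAt), norm_smul,
      Complex.norm_real, Real.norm_of_nonneg (absDet_pos L).le,
      ContinuousLinearMap.iteratedFDeriv_comp_right _ (G.smooth n) _ le_rfl, mul_comm (‖_‖ ^ n)]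
    gcongr
    · exact (absDet_pos L).le
    · refine (ContinuousMultilinearMap.norm_compContinuousLinearMap_le _ _).trans ?_
      simp
  have hw (y : E) : (1 + ‖y‖) ≤ A * (1 + ‖L y‖) := by
    have h := (L.symm : E →L[ℝ] E).le_opNorm (L y)
    simp only [ContinuousLinearEquiv.coe_coe, ContinuousLinearEquiv.symm_apply_apply] at h
    have h2 : ‖(L.symm : E →L[ℝ] E)‖ ≤ A := le_max_right _ _
    nlinarith [norm_nonneg (L y), mul_le_mul_of_nonneg_right h2 (norm_nonneg (L y))]
  have hi := integrable_one_add_norm_pow_mul G m n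
  unfold derivL1
  conv_rhs => rw [integral_comp_equiv L, smul_eq_mul, ← mul_assoc, ← integral_const_mul]
  refine integral_mono (integrable_one_add_norm_pow_mul _ m n)
    ((integrable_comp_equiv L hi).const_mul _) fun y => ?_
  calc (1 + ‖y‖) ^ m * ‖iteratedFDeriv ℝ n (scale L G) y‖
      ≤ (A * (1 + ‖L y‖)) ^ m *
        (absDet L * (‖(L : E →L[ℝ] E)‖ ^ n * ‖iteratedFDeriv ℝ n G (L y)‖)) := by
        gcongr
        · exact hw y
        · exact hder y
    _ = _ := by rw [mul_pow]; ring

theorem weightedL1_scale_le (L : E ≃L[ℝ] E) (m : ℕ) (G : 𝓢(E, ℂ)) :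
    weightedL1 m (scale L G) ≤ max 1 ‖(L.symm : E →L[ℝ] E)‖ ^ m * weightedL1 m G := by
  simpa [derivL1_zero] using derivL1_scale_le L m 0 G

theorem derivL1_lineDeriv_le (v : E) (m n : ℕ) (G : 𝓢(E, ℂ)) :
    derivL1 m n (∂_{v} G) ≤ ‖v‖ * derivL1 m (n + 1) G := by
  unfold derivL1
  rw [← integral_const_mul]
  refine integral_mono (integrable_one_add_norm_pow_mul _ m n)
    ((integrable_one_add_norm_pow_mul _ m (n + 1)).const_mul _) fun y => ?_
  have h1 : (∂_{v} G : 𝓢(E, ℂ)) = fun x => fderiv ℝ G x v := by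
    funext x
    exact SchwartzMap.lineDerivOp_apply_eq_fderiv v G x
  have h2 : ‖iteratedFDeriv ℝ n (∂_{v} G : 𝓢(E, ℂ)) y‖ ≤
      ‖v‖ * ‖iteratedFDeriv ℝ (n + 1) G y‖ := by
    rw [h1, ← norm_iteratedFDeriv_fderiv]
    exact norm_iteratedFDeriv_clm_apply_const
      ((G.smooth ⊤).fderiv_right (m := n) (by exact_mod_cast le_top)).contDiffAt le_rfl
  calc (1 + ‖y‖) ^ m * ‖iteratedFDeriv ℝ n (∂_{v} G : 𝓢(E, ℂ)) y‖
      ≤ (1 + ‖y‖) ^ m * (‖v‖ * ‖iteratedFDeriv ℝ (n + 1) G y‖) := by gcongr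
    _ = _ := by ring

/-! ### Cancellation -/

/-- A Schwartz function whose support is compact and does not contain the origin. -/
structure IsAnnular (a : 𝓢(E, ℂ)) : Prop where
  hasCompactSupport : HasCompactSupport a
  eventually_zero : a =ᶠ[nhds 0] 0

/-- Division by |ξ|² is smooth because `a` vanishes near the origin. The constant anticipates the
symbol 2πi⟨ξ, v⟩ of a directional derivative. -/
theorem IsAnnular.exists_div {a : 𝓢(E, ℂ)} (ha : IsAnnular a) (v : E) :
    ∃ b : 𝓢(E, ℂ), IsAnnular b ∧
      ∀ ξ, b ξ = (2 * Real.pi * Complex.I)⁻¹ * ((inner ℝ ξ v / ‖ξ‖ ^ 2 : ℝ) : ℂ) * a ξ := by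
  set f : E → ℂ := fun ξ => (2 * Real.pi * Complex.I)⁻¹ * ((inner ℝ ξ v / ‖ξ‖ ^ 2 : ℝ) : ℂ) * a ξ
  have hz : f =ᶠ[nhds 0] 0 := ha.eventually_zero.mono fun ξ hξ => by
    simp only [f, hξ, Pi.zero_apply, mul_zero]
  have hc : HasCompactSupport f := ha.hasCompactSupport.mul_left
  have hs : ContDiff ℝ ∞ f := by
    rw [contDiff_iff_contDiffAt]
    intro ξ
    by_cases h : ξ = 0
    · subst h
      exact (contDiffAt_const (c := (0 : ℂ))).congr_of_eventuallyEq hz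
    · have h1 : ContDiffAt ℝ ∞ (fun ξ : E => inner ℝ ξ v / ‖ξ‖ ^ 2) ξ := by
        refine ContDiffAt.div (contDiffAt_id.inner ℝ contDiffAt_const) (contDiff_norm_sq ℝ).contDiffAt ?_
        simpa using h
      exact (contDiffAt_const.mul (Complex.ofRealCLM.contDiff.contDiffAt.comp ξ h1)).mul
        (a.smooth ⊤).contDiffAt
  exact ⟨hc.toSchwartzMap hs, ⟨hc, hz⟩, fun ξ => rfl⟩

/-- On the Fourier side this is 1 = Σ_k ξ_k²/|ξ|². It puts an annular kernel into divergence form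
with annular kernels again, so it can be iterated. -/
theorem IsAnnular.exists_sum_lineDeriv {a : 𝓢(E, ℂ)} (ha : IsAnnular a) :
    ∃ b : Fin (Module.finrank ℝ E) → 𝓢(E, ℂ), (∀ k, IsAnnular (b k)) ∧
      𝓕⁻ a = ∑ k, ∂_{stdOrthonormalBasis ℝ E k} (𝓕⁻ (b k)) := by
  choose b hb hbe using fun k => ha.exists_div (stdOrthonormalBasis ℝ E k)
  refine ⟨b, hb, schwartz_ext_fourier fun ξ => ?_⟩
  have h1 : 𝓕 (𝓕⁻ a) = a := FourierTransform.fourier_fourierInv_eq a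
  have h2 (k) : 𝓕 (𝓕⁻ (b k)) = b k := FourierTransform.fourier_fourierInv_eq (b k)
  have h3 : 𝓕 (∑ k, ∂_{stdOrthonormalBasis ℝ E k} (𝓕⁻ (b k))) ξ =
      ∑ k, 𝓕 (∂_{stdOrthonormalBasis ℝ E k} (𝓕⁻ (b k))) ξ := by
    have := map_sum (FourierTransform.fourierCLM ℂ 𝓢(E, ℂ))
      (fun k => ∂_{stdOrthonormalBasis ℝ E k} (𝓕⁻ (b k))) Finset.univ
    simp only [FourierTransform.fourierCLM_apply] at this
    rw [this, sum_apply]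
  rw [h1, h3]
  simp only [fourier_lineDeriv_apply, h2, hbe]
  by_cases hξ : ξ = 0
  · subst hξ
    simpa using ha.eventually_zero.self_of_nhds
  have h4 := (stdOrthonormalBasis ℝ E).sum_sq_inner_left ξ
  have hn : (‖ξ‖ ^ 2 : ℝ) ≠ 0 := by simpa using hξ
  have hpi : (2 * Real.pi * Complex.I : ℂ) ≠ 0 := by
    simp [Real.pi_ne_zero]
  calc a ξ = (((∑ k, inner ℝ ξ (stdOrthonormalBasis ℝ E k) ^ 2) / ‖ξ‖ ^ 2 : ℝ) : ℂ) * a ξ := by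
        rw [h4, div_self hn, Complex.ofReal_one, one_mul]
    _ = _ := by
        rw [Finset.sum_div, Complex.ofReal_sum, Finset.sum_mul]
        refine Finset.sum_congr rfl fun k _ => ?_
        push_cast
        field_simp

/-- Integration by parts `n` times. A derivative along e_k before the rescaling is one along L⁻¹e_k
after it; moved onto `B`, it gains the factor ‖L⁻¹‖ and costs one derivative of `B`. -/
theorem IsAnnular.exists_weightedL1_sconv_le (n m : ℕ) {a : 𝓢(E, ℂ)} (ha : IsAnnular a) :
    ∃ C : ℝ, 0 ≤ C ∧ ∀ L : E ≃L[ℝ] E, ‖(L.symm : E →L[ℝ] E)‖ ≤ 1 → ∀ B : 𝓢(E, ℂ),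
      weightedL1 m (sconv (scale L (𝓕⁻ a)) B) ≤
        C * ‖(L.symm : E →L[ℝ] E)‖ ^ n * derivL1 m n B := by
  induction n generalizing a with
  | zero =>
    refine ⟨weightedL1 m (𝓕⁻ a), weightedL1_nonneg _ _, fun L hL B => ?_⟩
    rw [pow_zero, mul_one, derivL1_zero]
    refine (weightedL1_sconv_le _ _ _).trans ?_
    gcongr
    · exact weightedL1_nonneg _ _
    · simpa [max_eq_left hL] using weightedL1_scale_le L m (𝓕⁻ a)
  | succ n ih =>
    obtain ⟨b, hb, hab⟩ := ha.exists_sum_lineDeriv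
    choose C hC h using fun k => ih (hb k)
    refine ⟨∑ k, C k, Finset.sum_nonneg fun k _ => hC k, fun L hL B => ?_⟩
    set e := stdOrthonormalBasis ℝ E
    set ε := ‖(L.symm : E →L[ℝ] E)‖
    have h1 : sconv (scale L (𝓕⁻ a)) B =
        ∑ k, sconv (scale L (𝓕⁻ (b k))) (∂_{L.symm (e k)} B) := by
      rw [hab, map_sum]
      unfold sconv
      rw [map_sum, sum_apply]
      refine Finset.sum_congr rfl fun k _ => ?_
      have h2 : scale L (∂_{e k} (𝓕⁻ (b k))) = ∂_{L.symm (e k)} (scale L (𝓕⁻ (b k))) := by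
        rw [lineDeriv_scale, L.apply_symm_apply]
      rw [h2]
      exact lineDeriv_sconv' _ _ _
    rw [h1, Finset.sum_mul, Finset.sum_mul]
    refine (weightedL1_sum_le _ _ _).trans (Finset.sum_le_sum fun k _ => ?_)
    have h3 : ‖L.symm (e k)‖ ≤ ε := by
      simpa [e.orthonormal.1 k] using (L.symm : E →L[ℝ] E).le_opNorm (e k)
    calc weightedL1 m (sconv (scale L (𝓕⁻ (b k))) (∂_{L.symm (e k)} B))
        ≤ C k * ε ^ n * derivL1 m n (∂_{L.symm (e k)} B) := h k L hL _
      _ ≤ C k * ε ^ n * (ε * derivL1 m (n + 1) B) := by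
          have := hC k
          gcongr
          exact (derivL1_lineDeriv_le _ _ _ _).trans
            (mul_le_mul_of_nonneg_right h3 (derivL1_nonneg _ _ _))
      _ = _ := by ring

/-! ### Low frequency cut-offs -/

/-- At order zero `1 = s 0` and the mean value inequality gives ‖L‖‖x‖; at order i > 0 the constant
disappears and the chain rule gives ‖L‖^i ≤ ‖L‖. -/
theorem exists_iteratedFDeriv_comp_sub_one_le (s : 𝓢(E, ℂ)) (hs : s 0 = 1) (i : ℕ) :
    ∃ C : ℝ, 0 ≤ C ∧ ∀ L : E →L[ℝ] E, ‖L‖ ≤ 1 → ∀ x,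
      ‖iteratedFDeriv ℝ i (fun y => s (L y) - 1) x‖ ≤ C * ‖L‖ * (1 + ‖x‖) := by
  rcases Nat.eq_zero_or_pos i with rfl | hi
  · obtain ⟨C, hC, h⟩ := exists_one_add_norm_pow_mul_iteratedFDeriv_le s 0 1
    refine ⟨C, hC, fun L hL x => ?_⟩
    have h1 : ‖s (L x) - s 0‖ ≤ C * ‖L x - 0‖ := by
      refine Convex.norm_image_sub_le_of_norm_fderiv_le (𝕜 := ℝ) (s := Set.univ)
        (fun y _ => s.differentiableAt) (fun y _ => ?_) convex_univ (mem_univ _) (mem_univ _)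
      have := h y
      rwa [pow_zero, one_mul, ← norm_fderiv_iteratedFDeriv, norm_fderiv_iteratedFDeriv,
        norm_iteratedFDeriv_one] at this
    rw [norm_iteratedFDeriv_zero, ← hs]
    refine h1.trans ?_
    rw [sub_zero, mul_assoc]
    gcongr
    exact (L.le_opNorm x).trans (by gcongr; linarith)
  · obtain ⟨C, hC, h⟩ := exists_one_add_norm_pow_mul_iteratedFDeriv_le s 0 i
    refine ⟨C, hC, fun L hL x => ?_⟩
    have h1 : iteratedFDeriv ℝ i (fun y => s (L y) - 1) x = iteratedFDeriv ℝ i (s ∘ L) x := by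
      have := iteratedFDeriv_sub_apply (𝕜 := ℝ) (i := i) (f := s ∘ L) (g := fun _ => (1 : ℂ)) (x := x)
        ((s.smooth i).comp L.contDiff).contDiffAt contDiffAt_const
      rw [iteratedFDeriv_const_of_ne hi.ne', Pi.zero_apply, sub_zero] at this
      exact this
    rw [h1, ContinuousLinearMap.iteratedFDeriv_comp_right _ (s.smooth i) _ le_rfl]
    have h2 : ‖iteratedFDeriv ℝ i s (L x)‖ ≤ C := by simpa using h (L x)
    calc _ ≤ ‖iteratedFDeriv ℝ i s (L x)‖ * ∏ _k : Fin i, ‖L‖ :=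
          ContinuousMultilinearMap.norm_compContinuousLinearMap_le _ _
      _ = ‖iteratedFDeriv ℝ i s (L x)‖ * ‖L‖ ^ i := by simp
      _ ≤ C * ‖L‖ := by
          gcongr
          exact pow_le_of_le_one (norm_nonneg _) hL hi.ne'
      _ ≤ _ := le_mul_of_one_le_right (by positivity) (by linarith [norm_nonneg x])

theorem tendsto_pairing_comp (s ψ : 𝓢(E, ℂ)) (hs : s 0 = 1) (L : ℕ → E ≃L[ℝ] E)
    (hL : Filter.Tendsto (fun n => ‖(L n : E →L[ℝ] E)‖) Filter.atTop (nhds 0)) :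
    Filter.Tendsto (fun n => SchwartzMap.pairing (ContinuousLinearMap.mul ℂ ℂ)
      (SchwartzMap.compCLMOfContinuousLinearEquiv ℂ (L n) s) ψ) Filter.atTop (nhds ψ) := by
  rw [(schwartz_withSeminorms ℂ E ℂ).tendsto_nhds]
  rintro ⟨k, n⟩ ε hε
  choose C hC h using fun i => exists_iteratedFDeriv_comp_sub_one_le s hs i
  -- One additional power of the weight absorbs the growth 1+‖x‖ of the cut-off error.
  choose K hK hb using fun i => exists_one_add_norm_pow_mul_iteratedFDeriv_le ψ (k + 1) i
  set D : ℝ := ∑ i ∈ Finset.range (n + 1), (n.choose i : ℝ) * C i * K (n - i)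
  have hD : 0 ≤ D := Finset.sum_nonneg fun i _ => by have := hC i; have := hK (n - i); positivity
  have hev : ∀ᶠ N in Filter.atTop, ‖(L N : E →L[ℝ] E)‖ < min 1 (ε / (D + 1)) :=
    hL.eventually_lt_const (by positivity)
  filter_upwards [hev] with N hN
  rw [lt_min_iff] at hN
  set l := ‖(L N : E →L[ℝ] E)‖
  have hl0 : 0 ≤ l := norm_nonneg _
  refine lt_of_le_of_lt (b := D * l) ?_ ?_
  swap
  · calc D * l ≤ D * (ε / (D + 1)) := by gcongr; exact hN.2.le
      _ < ε := by
        rw [mul_div_assoc', div_lt_iff₀ (by positivity)]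
        nlinarith
  refine SchwartzMap.seminorm_le_bound ℂ k n _ (by positivity) fun x => ?_
  have h1 : ((SchwartzMap.pairing (ContinuousLinearMap.mul ℂ ℂ)
      (SchwartzMap.compCLMOfContinuousLinearEquiv ℂ (L N) s) ψ - ψ : 𝓢(E, ℂ)) : E → ℂ) =
      fun y => (s ((L N : E →L[ℝ] E) y) - 1) * ψ y := by
    funext y
    rw [sub_apply, SchwartzMap.pairing_apply_apply]
    simp [sub_mul]
  rw [h1]
  have h2 := norm_iteratedFDeriv_mul_le (𝕜 := ℝ) (N := n)
    (f := fun y => s ((L N : E →L[ℝ] E) y) - 1) (g := ψ)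
    (((s.smooth n).comp (L N : E →L[ℝ] E).contDiff).sub contDiff_const) (ψ.smooth n) x
    (n := n) le_rfl
  calc _ ≤ ‖x‖ ^ k * ∑ i ∈ Finset.range (n + 1), (n.choose i : ℝ) *
        ‖iteratedFDeriv ℝ i (fun y => s ((L N : E →L[ℝ] E) y) - 1) x‖ *
          ‖iteratedFDeriv ℝ (n - i) ψ x‖ := by gcongr
    _ ≤ D * l := by
      rw [Finset.mul_sum, Finset.sum_mul]
      refine Finset.sum_le_sum fun i _ => ?_
      have h3 := h i (L N : E →L[ℝ] E) hN.1.le x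
      have := hC i
      calc ‖x‖ ^ k * ((n.choose i : ℝ) *
            ‖iteratedFDeriv ℝ i (fun y => s ((L N : E →L[ℝ] E) y) - 1) x‖ *
              ‖iteratedFDeriv ℝ (n - i) ψ x‖)
          ≤ (1 + ‖x‖) ^ k * ((n.choose i : ℝ) * (C i * l * (1 + ‖x‖)) *
              ‖iteratedFDeriv ℝ (n - i) ψ x‖) := by
            gcongr
            linarith
        _ = (n.choose i : ℝ) * C i * l *
            ((1 + ‖x‖) ^ (k + 1) * ‖iteratedFDeriv ℝ (n - i) ψ x‖) := by ring
        _ ≤ (n.choose i : ℝ) * C i * l * K (n - i) := by gcongr; exact hb _ x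
        _ = _ := by ring

/-- The Fourier transform turns the low-pass filter into multiplication by `s ∘ L n`, which tends to
multiplication by 1 in the topology of Schwartz functions. -/
theorem tendsto_sconv_lowPass (s ψ : 𝓢(E, ℂ)) (hs : s 0 = 1) (L : ℕ → E ≃L[ℝ] E)
    (hL : Filter.Tendsto (fun n => ‖(L n : E →L[ℝ] E)‖) Filter.atTop (nhds 0)) :
    Filter.Tendsto (fun n => sconv
      (𝓕⁻ (SchwartzMap.compCLMOfContinuousLinearEquiv ℂ (L n) s)) ψ) Filter.atTop (nhds ψ) := by
  have h := ((FourierTransform.fourierInvCLM ℂ 𝓢(E, ℂ)).continuous.tendsto _).comp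
    (tendsto_pairing_comp s (𝓕 ψ) hs L hL)
  have h1 : FourierTransform.fourierInvCLM ℂ 𝓢(E, ℂ) (𝓕 ψ) = ψ :=
    (FourierTransform.fourierInv_fourier_eq ψ : 𝓕⁻ (𝓕 ψ) = ψ)
  rw [h1] at h
  refine h.congr fun n => schwartz_ext_fourier fun ξ => ?_
  have h2 (f : 𝓢(E, ℂ)) : 𝓕 (𝓕⁻ f) = f := FourierTransform.fourier_fourierInv_eq f
  rw [fourier_sconv_apply, h2, Function.comp_apply, FourierTransform.fourierInvCLM_apply, h2,
    SchwartzMap.pairing_apply_apply]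
  rfl

/-- Convolution with a function of finite weighted `L¹` norm preserves weighted `L^∞` bounds. -/
theorem weight_mul_norm_integral_le {ρ : E → ℝ} {C₀ A : ℝ} {m : ℕ} (hC₀ : 0 ≤ C₀)
    (hρ : ∀ z, 0 ≤ ρ z) (hmod : ∀ z y, ρ z ≤ C₀ * ρ y * (1 + ‖z - y‖) ^ m)
    {H : E → ℂ} (hA : ∀ z, ρ z * ‖H z‖ ≤ A) (G : 𝓢(E, ℂ)) (z : E) :
    ρ z * ‖∫ y, H y * G (z - y)‖ ≤ C₀ * A * weightedL1 m G := by
  have hint : Integrable fun y => (1 + ‖z - y‖) ^ m * ‖G (z - y)‖ :=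
    (integrable_one_add_norm_pow_mul_norm G m).comp_sub_left z
  have h1 : weightedL1 m G = ∫ y, (1 + ‖z - y‖) ^ m * ‖G (z - y)‖ :=
    (integral_sub_left_eq_self (fun y => (1 + ‖y‖) ^ m * ‖G y‖) volume z).symm
  have h2 : ρ z * ‖∫ y, H y * G (z - y)‖ = ‖∫ y, (ρ z : ℝ) • (H y * G (z - y))‖ := by
    rw [integral_smul, norm_smul, Real.norm_of_nonneg (hρ z)]
  rw [h1, h2, ← integral_const_mul]
  refine norm_integral_le_of_norm_le (hint.const_mul _) (Filter.Eventually.of_forall fun y => ?_)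
  rw [norm_smul, Real.norm_of_nonneg (hρ z), norm_mul]
  calc ρ z * (‖H y‖ * ‖G (z - y)‖)
      ≤ (C₀ * ρ y * (1 + ‖z - y‖) ^ m) * (‖H y‖ * ‖G (z - y)‖) := by gcongr; exact hmod z y
    _ = C₀ * (ρ y * ‖H y‖) * ((1 + ‖z - y‖) ^ m * ‖G (z - y)‖) := by ring
    _ ≤ _ := by gcongr; exact hA y

end General

/-! ## Dilations, transport and polynomial weights -/

theorem phase_ext {z w : Phase d} (h₁ : z.fst = w.fst) (h₂ : z.snd = w.snd) : z = w :=
  WithLp.ofLp_injective 2 (Prod.ext h₁ h₂)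

theorem norm_sq_phase (z : Phase d) : ‖z‖ ^ 2 = ‖z.fst‖ ^ 2 + ‖z.snd‖ ^ 2 :=
  WithLp.prod_norm_sq_eq_of_L2 z

theorem norm_fst_le_phase (z : Phase d) : ‖z.fst‖ ≤ ‖z‖ :=
  abs_le_of_sq_le_sq' (by rw [norm_sq_phase]; nlinarith [sq_nonneg ‖z.snd‖]) (norm_nonneg _) |>.2

theorem norm_snd_le_phase (z : Phase d) : ‖z.snd‖ ≤ ‖z‖ :=
  abs_le_of_sq_le_sq' (by rw [norm_sq_phase]; nlinarith [sq_nonneg ‖z.fst‖]) (norm_nonneg _) |>.2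

/-- The anisotropic dilation `(x, v) ↦ (R³ x, R v)`. -/
def delta (R : ℝ) (hR : 0 < R) : Phase d ≃L[ℝ] Phase d :=
  phaseEquiv
    (ContinuousLinearMap.prod
      (R ^ 3 • ContinuousLinearMap.fst ℝ (Space d) (Space d))
      (R • ContinuousLinearMap.snd ℝ (Space d) (Space d)))
    (ContinuousLinearMap.prod
      ((R⁻¹) ^ 3 • ContinuousLinearMap.fst ℝ (Space d) (Space d))
      (R⁻¹ • ContinuousLinearMap.snd ℝ (Space d) (Space d)))
    (fun p => by simp [smul_smul, inv_mul_cancel₀ hR.ne', inv_mul_cancel₀ (pow_pos hR 3).ne'])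
    (fun p => by simp [smul_smul, mul_inv_cancel₀ hR.ne', mul_inv_cancel₀ (pow_pos hR 3).ne'])

theorem delta_fst (R : ℝ) (hR : 0 < R) (z : Phase d) : (delta R hR z).fst = R ^ 3 • z.fst := rfl

theorem delta_snd (R : ℝ) (hR : 0 < R) (z : Phase d) : (delta R hR z).snd = R • z.snd := rfl

theorem transport_fst (t : ℝ) (z : Phase d) : (transport t z).fst = z.fst + t • z.snd := rfl

theorem transport_snd (t : ℝ) (z : Phase d) : (transport t z).snd = z.snd := rfl

theorem dilation_eq_delta (j : ℤ) : (dilation j : Phase d ≃L[ℝ] Phase d) =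
    delta ((2 : ℝ) ^ j) (by positivity) := by
  refine DFunLike.ext _ _ fun z => ?_
  refine phase_ext ?_ rfl
  rw [delta_fst, dilation_apply]
  change (2 : ℝ) ^ (3 * j) • z.fst = _
  rw [mul_comm, zpow_mul]
  rfl

theorem delta_trans (R S : ℝ) (hR : 0 < R) (hS : 0 < S) :
    (delta R hR).trans (delta S hS) = (delta (R * S) (mul_pos hR hS) : Phase d ≃L[ℝ] Phase d) := by
  refine DFunLike.ext _ _ fun z => ?_
  refine phase_ext ?_ ?_
  · simp only [ContinuousLinearEquiv.trans_apply, delta_fst, smul_smul]; ring_nf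
  · simp only [ContinuousLinearEquiv.trans_apply, delta_snd, smul_smul]; ring_nf

theorem delta_one : (delta 1 one_pos : Phase d ≃L[ℝ] Phase d) =
    ContinuousLinearEquiv.refl ℝ _ := by
  refine DFunLike.ext _ _ fun z => ?_
  refine phase_ext ?_ ?_
  · simp [delta_fst]
  · simp [delta_snd]

theorem delta_symm (R : ℝ) (hR : 0 < R) :
    (delta R hR).symm = (delta R⁻¹ (inv_pos.2 hR) : Phase d ≃L[ℝ] Phase d) := by
  refine DFunLike.ext _ _ fun z => ?_
  rw [ContinuousLinearEquiv.symm_apply_eq, ← ContinuousLinearEquiv.trans_apply, delta_trans]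
  simp only [inv_mul_cancel₀ hR.ne', delta_one, ContinuousLinearEquiv.refl_apply]

theorem transport_symm (t : ℝ) :
    (transport t).symm = (transport (-t) : Phase d ≃L[ℝ] Phase d) := by
  refine DFunLike.ext _ _ fun z => ?_
  rw [ContinuousLinearEquiv.symm_apply_eq]
  refine phase_ext ?_ rfl
  simp [transport_fst, transport_snd]

theorem transport_trans (s t : ℝ) :
    (transport s).trans (transport t) = (transport (s + t) : Phase d ≃L[ℝ] Phase d) := by
  refine DFunLike.ext _ _ fun z => ?_
  refine phase_ext ?_ rfl
  simp [transport_fst, transport_snd, add_smul, add_assoc]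

theorem transport_transport (s t : ℝ) (z : Phase d) :
    transport t (transport s z) = transport (s + t) z := by
  rw [← transport_trans]; rfl

theorem transport_zero_apply (z : Phase d) : transport 0 z = z :=
  phase_ext (by simp [transport_fst]) rfl

/-- Kinetic scaling: positions scale like R³ and velocities like R, hence times like R². -/
theorem transport_trans_delta (t R : ℝ) (hR : 0 < R) :
    (transport t).trans (delta R hR) =
      ((delta R hR).trans (transport (R ^ 2 * t)) : Phase d ≃L[ℝ] Phase d) := by
  refine DFunLike.ext _ _ fun z => ?_
  refine phase_ext ?_ rfl
  simp only [ContinuousLinearEquiv.trans_apply, delta_fst, transport_fst, delta_snd, smul_add,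
    smul_smul]
  ring_nf

theorem delta_inner (R : ℝ) (hR : 0 < R) (z w : Phase d) :
    inner ℝ (delta R hR z) w = inner ℝ z (delta R hR w) := by
  simp only [WithLp.prod_inner_apply]
  change inner ℝ (R ^ 3 • z.fst) w.fst + inner ℝ (R • z.snd) w.snd =
    inner ℝ z.fst (R ^ 3 • w.fst) + inner ℝ z.snd (R • w.snd)
  simp only [real_inner_smul_left, real_inner_smul_right]

/-- For R ≤ 1 the velocity direction contracts least, so an integration by parts is only guaranteed
to gain one power of R. -/
theorem norm_delta_le_of_le_one (R : ℝ) (hR : 0 < R) (h : R ≤ 1) :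
    ‖((delta R hR : Phase d ≃L[ℝ] Phase d) : Phase d →L[ℝ] Phase d)‖ ≤ R := by
  refine ContinuousLinearMap.opNorm_le_bound _ hR.le fun z => ?_
  refine (sq_le_sq₀ (norm_nonneg _) (by positivity)).1 ?_
  change ‖delta R hR z‖ ^ 2 ≤ _
  rw [mul_pow, norm_sq_phase, norm_sq_phase, delta_fst, delta_snd, norm_smul, norm_smul,
    Real.norm_of_nonneg hR.le, Real.norm_of_nonneg (by positivity), mul_pow, mul_pow, mul_add]
  gcongr
  exact pow_le_of_le_one hR.le h (by norm_num)

theorem norm_delta_le (R S : ℝ) (hR : 0 < R) (h : R ≤ S) :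
    ‖((delta R hR : Phase d ≃L[ℝ] Phase d) : Phase d →L[ℝ] Phase d)‖ ≤ (1 + S) ^ 3 := by
  have hS : 0 < S := hR.trans_le h
  refine ContinuousLinearMap.opNorm_le_bound _ (by positivity) fun z => ?_
  refine (sq_le_sq₀ (norm_nonneg _) (by positivity)).1 ?_
  change ‖delta R hR z‖ ^ 2 ≤ _
  rw [mul_pow, norm_sq_phase, norm_sq_phase, delta_fst, delta_snd, norm_smul, norm_smul,
    Real.norm_of_nonneg hR.le, Real.norm_of_nonneg (by positivity), mul_pow, mul_pow, mul_add]
  gcongr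
  · linarith
  · calc R ≤ 1 + S := by linarith
      _ ≤ (1 + S) ^ 3 := le_self_pow₀ (by linarith) (by norm_num)

theorem norm_transport_le (t : ℝ) : ‖((transport t : Phase d ≃L[ℝ] Phase d) : Phase d →L[ℝ] Phase d)‖ ≤ 1 + |t| := by
  refine ContinuousLinearMap.opNorm_le_bound _ (by positivity) fun z => ?_
  have h : (transport t z : Phase d) = z + WithLp.toLp 2 (t • z.snd, 0) :=
    phase_ext (by simp [transport_fst]) (by simp [transport_snd])
  change ‖transport t z‖ ≤ _
  have h2 : ‖(WithLp.toLp 2 (t • z.snd, (0 : Space d)) : Phase d)‖ = |t| * ‖z.snd‖ := by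
    rw [WithLp.prod_norm_eq_of_L2]
    simp [norm_smul]
    exact Real.sqrt_sq (by positivity)
  rw [h]
  refine (norm_add_le _ _).trans ?_
  rw [h2, add_mul, one_mul]
  gcongr
  exact norm_snd_le_phase z

/-- Conjugation with the dilation by 2 turns Γ_t into Γ_{4t} = Γ_t⁴, so a = |det Γ_t| satisfies a =
a⁴ and equals 1. -/
theorem absDet_transport (t : ℝ) : absDet (transport t : Phase d ≃L[ℝ] Phase d) = 1 := by
  have h1 := congrArg absDet (transport_trans_delta (d := d) t 2 two_pos)
  rw [absDet_trans, absDet_trans, mul_comm] at h1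
  have h2 := mul_right_cancel₀ (absDet_pos _).ne' h1
  have h3 : (transport ((2 : ℝ) ^ 2 * t) : Phase d ≃L[ℝ] Phase d) =
      ((transport t).trans (transport t)).trans ((transport t).trans (transport t)) := by
    rw [transport_trans, transport_trans]
    congr 1
    ring
  rw [h3, absDet_trans, absDet_trans] at h2
  set a := absDet (transport t : Phase d ≃L[ℝ] Phase d)
  have ha : 0 < a := absDet_pos _
  have h4 : a ^ 3 = 1 := by
    have : a * a ^ 3 = a * 1 := by linarith
    exact mul_left_cancel₀ ha.ne' this
  exact (pow_eq_one_iff_of_nonneg ha.le (by norm_num)).1 h4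

theorem absDet_delta (R : ℝ) (hR : 0 < R) :
    absDet (delta R hR : Phase d ≃L[ℝ] Phase d) = R ^ (4 * d) := by
  let e := WithLp.linearEquiv 2 ℝ (Space d × Space d)
  have h : (((delta R hR : Phase d ≃L[ℝ] Phase d) : Phase d →L[ℝ] Phase d) :
      Phase d →ₗ[ℝ] Phase d) = e.symm.toLinearMap ∘ₗ
        (LinearMap.prodMap (R ^ 3 • LinearMap.id) (R • LinearMap.id)) ∘ₗ
          e.symm.symm.toLinearMap := rfl
  unfold absDet
  rw [h, LinearMap.det_conj, LinearMap.det_prodMap, LinearMap.det_smul, LinearMap.det_smul]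
  simp only [LinearMap.det_id, mul_one, finrank_euclideanSpace, Fintype.card_fin]
  rw [abs_of_pos (by positivity), ← pow_mul, ← pow_add]
  congr 1
  ring

theorem integral_comp_transport {F : Type*} [NormedAddCommGroup F] [NormedSpace ℝ F]
    (t : ℝ) (f : Phase d → F) : ∫ z, f (transport t z) = ∫ z, f z := by
  rw [integral_comp_equiv (transport t) f, absDet_transport, one_smul]

/-! ### The weights -/

/-- The quantity `(1 + |x|²)^{1/3} + 1 + |v|²` of which the weights are powers. -/
def bracket (z : Phase d) : ℝ := (1 + ‖z.fst‖ ^ 2) ^ (1 / 3 : ℝ) + 1 + ‖z.snd‖ ^ 2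

theorem bracket_pos (z : Phase d) : 0 < bracket z := by
  unfold bracket; positivity

theorem weight_eq (κ : ℝ) (z : Phase d) : weight κ z = bracket z ^ (-(κ / 2)) := by
  change (bracket z ^ (-(1 / 2) : ℝ)) ^ κ = _
  rw [← Real.rpow_mul (bracket_pos z).le]
  congr 1
  ring

theorem weight_pos (κ : ℝ) (z : Phase d) : 0 < weight κ z := by
  rw [weight_eq]; exact Real.rpow_pos_of_pos (bracket_pos z) _

theorem continuous_weight (κ : ℝ) : Continuous (weight κ : Phase d → ℝ) := by
  have h1 : Continuous (bracket : Phase d → ℝ) := by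
    have hf : Continuous fun z : Phase d => z.fst := (WithLp.fstL 2 ℝ (Space d) (Space d)).continuous
    have hg : Continuous fun z : Phase d => z.snd := (WithLp.sndL 2 ℝ (Space d) (Space d)).continuous
    unfold bracket
    refine ((Continuous.rpow_const (continuous_const.add (hf.norm.pow 2)) fun z =>
      Or.inr (by norm_num)).add continuous_const).add (hg.norm.pow 2)
  have h2 : (weight κ : Phase d → ℝ) = fun z => bracket z ^ (-(κ / 2)) := funext (weight_eq κ)
  rw [h2]
  exact h1.rpow_const fun z => Or.inl (bracket_pos z).ne'

theorem rpow_third_le_one_add {y : ℝ} (hy : 0 ≤ y) : y ^ (1 / 3 : ℝ) ≤ 1 + y := by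
  calc y ^ (1 / 3 : ℝ) ≤ (1 + y) ^ (1 / 3 : ℝ) := by gcongr; linarith
    _ ≤ (1 + y) ^ (1 : ℝ) := Real.rpow_le_rpow_of_exponent_le (by linarith) (by norm_num)
    _ = _ := Real.rpow_one _

theorem rpow_third_le_self {y : ℝ} (hy : 1 ≤ y) : y ^ (1 / 3 : ℝ) ≤ y := by
  calc y ^ (1 / 3 : ℝ) ≤ y ^ (1 : ℝ) := Real.rpow_le_rpow_of_exponent_le hy (by norm_num)
    _ = _ := Real.rpow_one _

theorem one_add_norm_sq_le {F : Type*} [NormedAddCommGroup F] {x y : F} {H : ℝ}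
    (h : ‖x - y‖ ≤ H) : 1 + ‖x‖ ^ 2 ≤ 2 * (1 + H) ^ 2 * (1 + ‖y‖ ^ 2) := by
  have h1 := norm_add_le (x - y) y
  rw [sub_add_cancel] at h1
  have hH : 0 ≤ H := (norm_nonneg _).trans h
  have h2 : ‖x‖ ≤ H + ‖y‖ := by linarith
  have h3 : ‖x‖ ^ 2 ≤ (H + ‖y‖) ^ 2 := by gcongr
  nlinarith [sq_nonneg (H - ‖y‖), mul_nonneg hH (sq_nonneg ‖y‖), sq_nonneg (H * ‖y‖)]

theorem bracket_le (z y : Phase d) : bracket z ≤ 2 * (1 + ‖z - y‖) ^ 2 * bracket y := by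
  set P := 2 * (1 + ‖z - y‖) ^ 2 with hP
  have hP1 : 1 ≤ P := by
    rw [hP]; nlinarith [norm_nonneg (z - y)]
  have h1 := one_add_norm_sq_le (x := z.fst) (y := y.fst) (norm_fst_le_phase (z - y))
  have h2 := one_add_norm_sq_le (x := z.snd) (y := y.snd) (norm_snd_le_phase (z - y))
  have h3 : (1 + ‖z.fst‖ ^ 2) ^ (1 / 3 : ℝ) ≤ P * (1 + ‖y.fst‖ ^ 2) ^ (1 / 3 : ℝ) := by
    calc (1 + ‖z.fst‖ ^ 2) ^ (1 / 3 : ℝ) ≤ (P * (1 + ‖y.fst‖ ^ 2)) ^ (1 / 3 : ℝ) := by gcongr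
      _ = P ^ (1 / 3 : ℝ) * (1 + ‖y.fst‖ ^ 2) ^ (1 / 3 : ℝ) :=
        Real.mul_rpow (by positivity) (by positivity)
      _ ≤ _ := by gcongr; exact rpow_third_le_self hP1
  unfold bracket
  nlinarith

/-- The cube root is subadditive and (|tv|²)^{1/3} ≤ 1+|tv|², so the displacement tv is controlled
by the velocity part of the bracket. -/
theorem bracket_transport_le (t : ℝ) (z : Phase d) :
    bracket (transport t z) ≤ (2 + 2 * t ^ 2) * bracket z := by
  have h1 : 1 + ‖z.fst + t • z.snd‖ ^ 2 ≤ 2 * (1 + ‖z.fst‖ ^ 2) + 2 * t ^ 2 * ‖z.snd‖ ^ 2 := by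
    have h := norm_add_le z.fst (t • z.snd)
    rw [norm_smul, Real.norm_eq_abs] at h
    have h' : ‖z.fst + t • z.snd‖ ^ 2 ≤ (‖z.fst‖ + |t| * ‖z.snd‖) ^ 2 := by gcongr
    have e : (|t| * ‖z.snd‖) ^ 2 = t ^ 2 * ‖z.snd‖ ^ 2 := by rw [mul_pow, sq_abs]
    nlinarith [sq_nonneg (‖z.fst‖ - |t| * ‖z.snd‖)]
  have h2 : (1 + ‖z.fst + t • z.snd‖ ^ 2) ^ (1 / 3 : ℝ) ≤
      2 * (1 + ‖z.fst‖ ^ 2) ^ (1 / 3 : ℝ) + (1 + 2 * t ^ 2 * ‖z.snd‖ ^ 2) := by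
    calc (1 + ‖z.fst + t • z.snd‖ ^ 2) ^ (1 / 3 : ℝ)
        ≤ (2 * (1 + ‖z.fst‖ ^ 2) + 2 * t ^ 2 * ‖z.snd‖ ^ 2) ^ (1 / 3 : ℝ) := by gcongr
      _ ≤ (2 * (1 + ‖z.fst‖ ^ 2)) ^ (1 / 3 : ℝ) + (2 * t ^ 2 * ‖z.snd‖ ^ 2) ^ (1 / 3 : ℝ) :=
        Real.rpow_add_le_add_rpow (by positivity) (by positivity) (by norm_num) (by norm_num)
      _ ≤ _ := by
        rw [Real.mul_rpow (by norm_num) (by positivity)]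
        gcongr
        · exact rpow_third_le_self one_le_two
        · exact rpow_third_le_one_add (by positivity)
  unfold bracket
  rw [transport_fst, transport_snd]
  have h3 : 0 ≤ (1 + ‖z.fst‖ ^ 2) ^ (1 / 3 : ℝ) := by positivity
  nlinarith [mul_nonneg (sq_nonneg t) h3, sq_nonneg t, sq_nonneg ‖z.snd‖]

/-- The comparison has to be two-sided because the sign of κ decides which direction is used. -/
theorem weight_le_of_bracket_le (κ : ℝ) {z y : Phase d} {K : ℝ} (hK : 1 ≤ K)
    (h₁ : bracket z ≤ K * bracket y) (h₂ : bracket y ≤ K * bracket z) :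
    weight κ z ≤ K ^ (|κ| / 2) * weight κ y := by
  have hz := bracket_pos z
  have hy := bracket_pos y
  have hK0 : 0 < K := by linarith
  rw [weight_eq, weight_eq]
  rcases le_total 0 κ with h | h
  · rw [abs_of_nonneg h, Real.rpow_neg hz.le, Real.rpow_neg hy.le, ← div_eq_mul_inv,
      le_div_iff₀ (by positivity), inv_mul_le_iff₀ (by positivity), ← Real.mul_rpow hz.le hK0.le]
    gcongr
    linarith
  · rw [abs_of_nonpos h, ← neg_div, ← Real.mul_rpow hK0.le hy.le]
    exact Real.rpow_le_rpow hz.le h₁ (by linarith)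

/-- Moderateness of the weight: brackets differ by at most 2(1+|z-y|)², to be raised to the power
|κ|/2. Rounding |κ| up gives the integer exponent of the weighted L¹ norms. -/
theorem weight_le_mul_weight (κ : ℝ) (z y : Phase d) :
    weight κ z ≤ 2 ^ (|κ| / 2) * weight κ y * (1 + ‖z - y‖) ^ ⌈|κ|⌉₊ := by
  have h := norm_nonneg (z - y)
  have h1 : (1 : ℝ) ≤ 2 * (1 + ‖z - y‖) ^ 2 := by nlinarith
  have h2 := weight_le_of_bracket_le κ h1 (bracket_le z y)
    (by rw [norm_sub_rev]; exact bracket_le y z)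
  refine h2.trans ?_
  rw [Real.mul_rpow (by norm_num) (by positivity), ← Real.rpow_natCast, ← Real.rpow_mul
    (by positivity)]
  have h3 : (1 + ‖z - y‖) ^ ((2 : ℕ) * (|κ| / 2) : ℝ) ≤ (1 + ‖z - y‖) ^ ⌈|κ|⌉₊ := by
    rw [← Real.rpow_natCast]
    refine Real.rpow_le_rpow_of_exponent_le (by linarith) ?_
    push_cast
    linarith [Nat.le_ceil |κ|]
  have := weight_pos κ y
  calc _ ≤ (2 : ℝ) ^ (|κ| / 2) * (1 + ‖z - y‖) ^ ⌈|κ|⌉₊ * weight κ y := by gcongr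
    _ = _ := by ring

theorem exists_weight_transport_le (κ T : ℝ) :
    ∃ C : ℝ, 1 ≤ C ∧ ∀ t : ℝ, |t| ≤ T → ∀ z : Phase d,
      weight κ z ≤ C * weight κ (transport t z) := by
  have hK : (1 : ℝ) ≤ 2 + 2 * T ^ 2 := by nlinarith [sq_nonneg T]
  refine ⟨(2 + 2 * T ^ 2) ^ (|κ| / 2), Real.one_le_rpow hK (by positivity), fun t ht z => ?_⟩
  have h1 : t ^ 2 ≤ T ^ 2 := sq_le_sq' (by linarith [neg_abs_le t]) (by linarith [le_abs_self t])
  refine weight_le_of_bracket_le κ hK ?_ ?_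
  · have h := bracket_transport_le (-t) (transport t z)
    rw [transport_transport, add_neg_cancel, transport_zero_apply] at h
    refine h.trans ?_
    have := bracket_pos (transport t z)
    rw [neg_sq]
    gcongr
  · refine (bracket_transport_le t z).trans ?_
    have := bracket_pos z
    gcongr

/-! ### The kinetic kernel -/

/-- The exponent of the Gaussian is invariant under kinetic scaling, and 4d is the homogeneous
dimension. -/
theorem kinDensity_eq (s : ℝ) (hs : 0 < s) (z : Phase d) :
    kinDensity (s ^ 2) z =
      (s⁻¹) ^ (4 * d) * kinDensity 1 (delta s⁻¹ (inv_pos.2 hs) z) := by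
  have h1 : kinPhase (s ^ 2) z = kinPhase 1 (delta s⁻¹ (inv_pos.2 hs) z) := by
    unfold kinPhase
    have e : (3 : ℝ) • (delta s⁻¹ (inv_pos.2 hs) z).fst - (2 * 1 : ℝ) •
        (delta s⁻¹ (inv_pos.2 hs) z).snd =
          (s⁻¹) ^ 3 • ((3 : ℝ) • z.fst - (2 * s ^ 2) • z.snd) := by
      rw [delta_fst, delta_snd, smul_sub]
      simp only [smul_smul]
      congr 1
      · congr 1
        ring
      · congr 1
        field_simp
    rw [e, delta_fst, norm_smul, norm_smul, Real.norm_of_nonneg (by positivity)]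
    field_simp
  unfold kinDensity
  rw [h1, ← mul_assoc]
  congr 1
  have h2 : (4 * Real.pi ^ 2 * (s ^ 2) ^ 4 / 3 : ℝ) =
      s ^ 8 * (4 * Real.pi ^ 2 * 1 ^ 4 / 3) := by ring
  rw [h2, Real.mul_rpow (by positivity) (by positivity)]
  congr 1
  rw [← Real.rpow_natCast s 8, ← Real.rpow_mul hs.le, inv_pow, ← Real.rpow_natCast s (4 * d),
    ← Real.rpow_neg hs.le]
  congr 1
  push_cast
  ring

theorem kinKernel_eq_scale (t : ℝ) (ht : 0 < t) :
    (kinKernel t ht : 𝓢(Phase d, ℂ)) =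
      scale (delta (Real.sqrt t)⁻¹ (inv_pos.2 (Real.sqrt_pos.2 ht))) (kinKernel 1 one_pos) := by
  ext z
  rw [scale_apply, absDet_delta]
  change (kinDensity t z : ℂ) = _ * ((kinDensity 1 _ : ℝ) : ℂ)
  have h := kinDensity_eq (d := d) (Real.sqrt t) (Real.sqrt_pos.2 ht) z
  rw [Real.sq_sqrt ht.le] at h
  rw [h]
  push_cast
  rfl

/-! ## Littlewood-Paley kernels -/

theorem integral_comp_neg {E F : Type*} [NormedAddCommGroup E] [InnerProductSpace ℝ E]
    [FiniteDimensional ℝ E] [MeasurableSpace E] [BorelSpace E] [NormedAddCommGroup F]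
    [NormedSpace ℝ F] (f : E → F) : ∫ x, f (-x) = ∫ x, f x :=
  integral_neg_eq_self f volume

theorem dilation_fst (j : ℤ) (z : Phase d) : (dilation j z).fst = (2 : ℝ) ^ (3 * j) • z.fst := rfl

theorem dilation_snd (j : ℤ) (z : Phase d) : (dilation j z).snd = (2 : ℝ) ^ j • z.snd := rfl

theorem dilation_trans (i j : ℤ) :
    (dilation i).trans (dilation j) = (dilation (i + j) : Phase d ≃L[ℝ] Phase d) := by
  simp only [dilation_eq_delta, delta_trans]
  congr 1
  rw [zpow_add₀ two_ne_zero]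

theorem dilation_dilation (i j : ℤ) (z : Phase d) :
    dilation j (dilation i z) = dilation (i + j) z := by
  rw [← dilation_trans]; rfl

theorem dilation_zero : (dilation 0 : Phase d ≃L[ℝ] Phase d) = ContinuousLinearEquiv.refl ℝ _ := by
  rw [dilation_eq_delta, ← delta_one]
  congr 1

theorem dilation_symm (j : ℤ) : (dilation j).symm = (dilation (-j) : Phase d ≃L[ℝ] Phase d) := by
  refine DFunLike.ext _ _ fun z => ?_
  rw [ContinuousLinearEquiv.symm_apply_eq, dilation_dilation, neg_add_cancel, dilation_zero]
  rfl

theorem norm_dilation_neg_le (n : ℕ) :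
    ‖((dilation (-(n : ℤ)) : Phase d ≃L[ℝ] Phase d) : Phase d →L[ℝ] Phase d)‖ ≤ (2 ^ n)⁻¹ := by
  have h : (2 : ℝ) ^ (-(n : ℤ)) = (2 ^ n)⁻¹ := by rw [zpow_neg, zpow_natCast]
  rw [dilation_eq_delta, ← h]
  refine norm_delta_le_of_le_one _ _ ?_
  rw [h]
  exact inv_le_one_of_one_le₀ (one_le_pow₀ one_le_two)

theorem anorm_dilation (j : ℤ) (z : Phase d) : anorm (dilation j z) = (2 : ℝ) ^ j * anorm z := by
  unfold anorm
  rw [dilation_fst, dilation_snd, norm_smul, norm_smul, Real.norm_of_nonneg (by positivity),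
    Real.norm_of_nonneg (by positivity), Real.mul_rpow (by positivity) (norm_nonneg _), mul_add]
  congr 2
  rw [mul_comm 3 j, zpow_mul]
  change (((2 : ℝ) ^ j) ^ ((3 : ℕ) : ℤ)) ^ (1 / 3 : ℝ) = _
  rw [zpow_natCast, ← Real.rpow_natCast, ← Real.rpow_mul (by positivity)]
  norm_num

theorem anorm_nonneg (z : Phase d) : 0 ≤ anorm z := by unfold anorm; positivity

theorem continuous_anorm : Continuous (anorm : Phase d → ℝ) := by
  have hf : Continuous fun z : Phase d => z.fst := (WithLp.fstL 2 ℝ (Space d) (Space d)).continuous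
  have hg : Continuous fun z : Phase d => z.snd := (WithLp.sndL 2 ℝ (Space d) (Space d)).continuous
  exact (hf.norm.rpow_const fun z => Or.inr (by norm_num)).add hg.norm

theorem anorm_zero : anorm (0 : Phase d) = 0 := by
  simp [anorm]

/-- The kernel `2^{4dn} K(2^{an} ·)` of the low-frequency cut-off at scale `2^n`, where `K` is the
inverse Fourier transform of `φ_{-1}`. -/
def lowKernel (φ : DyadicCutoff d) (n : ℤ) : 𝓢(Phase d, ℂ) :=
  scale (dilation n) (𝓕⁻ (symbolSchwartz φ (-1)))

/-- The symbol of the low-frequency cut-off at scale `2^n`. -/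
def lowSymbol (φ : DyadicCutoff d) (n : ℤ) : 𝓢(Phase d, ℂ) :=
  SchwartzMap.compCLMOfContinuousLinearEquiv ℂ (dilation (-n)) (symbolSchwartz φ (-1))

theorem symbolSchwartz_apply (φ : DyadicCutoff d) (j : ℤ) (η : Phase d) :
    symbolSchwartz φ j η = symbol φ j (scale2pi η) := rfl

theorem lowSymbol_apply (φ : DyadicCutoff d) (n : ℤ) (η : Phase d) :
    lowSymbol φ n η = φ.toFun (dilation (-n) (scale2pi η)) := by
  change ((symbol φ (-1) (scale2pi (dilation (-n) η)) : ℝ) : ℂ) = _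
  rw [symbol, if_pos rfl]
  simp only [scale2pi_apply, map_smul]

theorem lowKernel_eq (φ : DyadicCutoff d) (n : ℤ) : lowKernel φ n = 𝓕⁻ (lowSymbol φ n) := by
  unfold lowSymbol lowKernel
  rw [fourierInv_comp_equiv _ (fun x y => by rw [dilation_eq_delta]; exact delta_inner _ _ _ _),
    dilation_symm, neg_neg]

theorem scale_dilation_lowKernel (φ : DyadicCutoff d) (i n : ℤ) :
    scale (dilation i) (lowKernel φ n) = lowKernel φ (i + n) := by
  unfold lowKernel
  rw [scale_scale, dilation_trans]

theorem fourier_lowKernel_apply (φ : DyadicCutoff d) (n : ℤ) (ξ : Phase d) :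
    𝓕 (lowKernel φ n) ξ = φ.toFun (dilation (-n) (scale2pi ξ)) := by
  have h : 𝓕 (𝓕⁻ (lowSymbol φ n)) = lowSymbol φ n := FourierTransform.fourier_fourierInv_eq _
  rw [lowKernel_eq, h, lowSymbol_apply]

/-- The kernel of the block with index `l - 1`. -/
def blk (φ : DyadicCutoff d) (l : ℕ) : 𝓢(Phase d, ℂ) := blockKernel φ ((l : ℤ) - 1)

theorem blk_zero (φ : DyadicCutoff d) : blk φ 0 = lowKernel φ 0 := by
  unfold blk blockKernel lowKernel
  rw [dilation_zero, scale_refl]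
  rfl

theorem blk_succ (φ : DyadicCutoff d) (l : ℕ) :
    blk φ (l + 1) = lowKernel φ (l + 1) - lowKernel φ l := by
  refine schwartz_ext_fourier fun ξ => ?_
  have h1 : 𝓕 (blk φ (l + 1)) = symbolSchwartz φ (((l + 1 : ℕ) : ℤ) - 1) :=
    FourierTransform.fourier_fourierInv_eq _
  have h2 : 𝓕 (lowKernel φ (l + 1) - lowKernel φ l) =
      𝓕 (lowKernel φ (l + 1)) - 𝓕 (lowKernel φ l) :=
    map_sub (FourierTransform.fourierCLM ℂ 𝓢(Phase d, ℂ)) _ _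
  rw [h1, h2, sub_apply, fourier_lowKernel_apply, fourier_lowKernel_apply, symbolSchwartz_apply,
    symbol, if_neg (by push_cast; omega)]
  push_cast
  simp

theorem sum_blk (φ : DyadicCutoff d) (n : ℕ) :
    ∑ l ∈ Finset.range (n + 1), blk φ l = lowKernel φ n := by
  induction n with
  | zero => simp [blk_zero]
  | succ n ih =>
    rw [Finset.sum_range_succ, ih, blk_succ]
    push_cast
    abel

theorem lowSymbol_neg (φ : DyadicCutoff d) (n : ℤ) (ξ : Phase d) :
    lowSymbol φ n (-ξ) = lowSymbol φ n ξ := by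
  rw [lowSymbol_apply, lowSymbol_apply, map_neg, map_neg, φ.symm]

theorem lowKernel_neg (φ : DyadicCutoff d) (n : ℤ) (z : Phase d) :
    lowKernel φ n (-z) = lowKernel φ n z := by
  rw [lowKernel_eq, SchwartzMap.fourierInv_coe, Real.fourierInv_eq', Real.fourierInv_eq',
    ← integral_comp_neg]
  refine integral_congr_ae (Filter.Eventually.of_forall fun y => ?_)
  simp [lowSymbol_neg]

theorem blk_neg (φ : DyadicCutoff d) (l : ℕ) (z : Phase d) : blk φ l (-z) = blk φ l z := by
  cases l with
  | zero => rw [blk_zero, lowKernel_neg]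
  | succ l => rw [blk_succ, sub_apply, sub_apply, lowKernel_neg, lowKernel_neg]

/-- A fattened block, whose symbol is `1` on the support of the symbol of the block. -/
def fat (φ : DyadicCutoff d) (l : ℕ) : 𝓢(Phase d, ℂ) :=
  if l < 2 then lowKernel φ (l + 1) else lowKernel φ (l + 1) - lowKernel φ (l - 2)

theorem fat_neg (φ : DyadicCutoff d) (l : ℕ) (z : Phase d) : fat φ l (-z) = fat φ l z := by
  unfold fat
  split_ifs
  · rw [lowKernel_neg]
  · rw [sub_apply, sub_apply, lowKernel_neg, lowKernel_neg]

/-- If the cut-off at scale 2^n does not vanish at ζ, then |ζ|_a ≤ (2/3)2^n. One dyadic step further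
this is at most 1/3 of the scale, inside the region where the cut-off is 1. -/
theorem cutoff_eq_one (φ : DyadicCutoff d) {n m : ℤ} (h : n + 1 ≤ m) {ζ : Phase d}
    (hn : φ.toFun (dilation (-n) ζ) ≠ 0) : φ.toFun (dilation (-m) ζ) = 1 := by
  have h1 : anorm (dilation (-n) ζ) ≤ 2 / 3 := by
    by_contra hlt
    exact hn (φ.eq_zero _ (not_le.1 hlt))
  refine φ.eq_one _ ?_
  have h2 : dilation (-m) ζ = dilation (n - m) (dilation (-n) ζ) := by
    rw [dilation_dilation]; congr 2; ring
  have h3 : (2 : ℝ) ^ (n - m) ≤ 2 ^ (-1 : ℤ) := zpow_le_zpow_right₀ one_le_two (by omega)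
  rw [h2, anorm_dilation]
  have h4 := anorm_nonneg (dilation (-n) ζ)
  norm_num at h3
  nlinarith

/-- The reproducing identity that leaves the blocks of the distribution and moves all smoothing onto
the fattened test function. It is checked on symbols, using that nonzero values of the cut-offs
force the value 1 at every larger scale. -/
theorem sconv_blk_fat (φ : DyadicCutoff d) (l : ℕ) : sconv (blk φ l) (fat φ l) = blk φ l := by
  refine schwartz_ext_fourier fun ξ => ?_
  rw [fourier_sconv_apply]
  set b : ℤ → ℝ := fun n => φ.toFun (dilation (-n) (scale2pi ξ)) with hb
  have hone {n m : ℤ} (h : n + 1 ≤ m) (hn : b n ≠ 0) : b m = 1 := cutoff_eq_one φ h hn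
  have hlow (n : ℤ) : 𝓕 (lowKernel φ n) ξ = (b n : ℂ) := fourier_lowKernel_apply φ n ξ
  have hsub (n m : ℤ) : 𝓕 (lowKernel φ n - lowKernel φ m) ξ = ((b n - b m : ℝ) : ℂ) := by
    have h2 : 𝓕 (lowKernel φ n - lowKernel φ m) = 𝓕 (lowKernel φ n) - 𝓕 (lowKernel φ m) :=
      map_sub (FourierTransform.fourierCLM ℂ 𝓢(Phase d, ℂ)) _ _
    rw [h2, sub_apply, hlow, hlow, Complex.ofReal_sub]
  rcases l with _ | l
  · rw [blk_zero, fat, if_pos two_pos, hlow, hlow]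
    by_cases h : b 0 = 0
    · rw [h]; simp
    · have h1 : b 1 = 1 := hone (by norm_num) h
      simp [h1]
  rw [blk_succ, hsub]
  by_cases heq : b (l + 1) = b l
  · rw [heq]; simp
  -- Where the block symbol is nonzero, `b l` or `b (l + 1)` is nonzero.
  have h2 : b (l + 2) = 1 := by
    by_cases h : b (l + 1) = 0
    · have h0 : b l ≠ 0 := fun h' => heq (h.trans h'.symm)
      exact hone (by omega) h0
    · exact hone (by omega) h
  -- Otherwise `b l` and `b (l + 1)` would both be 1 and the block symbol would vanish.
  have h3 : b (l - 1) = 0 := by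
    by_contra h
    exact heq ((hone (by omega) h).trans (hone (by omega) h).symm)
  unfold fat
  split_ifs with hl
  · rw [hlow]
    push_cast
    rw [show (l : ℤ) + 1 + 1 = l + 2 by ring, h2]
    simp
  · rw [hsub]
    push_cast
    rw [show (l : ℤ) + 1 + 1 = l + 2 by ring, show (l : ℤ) + 1 - 2 = l - 1 by ring, h2, h3]
    simp

theorem lowSymbol_hasCompactSupport (φ : DyadicCutoff d) (n : ℤ) :
    HasCompactSupport (lowSymbol φ n) :=
  (HasCompactSupport.comp_homeomorph
    (((symbol_hasCompactSupport φ (-1)).comp_homeomorph scale2pi.toHomeomorph).comp_left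
      (g := fun r : ℝ => (r : ℂ)) Complex.ofReal_zero) (dilation (-n)).toHomeomorph :)

theorem lowSymbol_eventually_one (φ : DyadicCutoff d) (n : ℤ) :
    ∀ᶠ η in nhds 0, lowSymbol φ n η = 1 := by
  have hc : Continuous fun η : Phase d => anorm (dilation (-n) (scale2pi η)) :=
    continuous_anorm.comp ((dilation (-n)).continuous.comp scale2pi.continuous)
  have h0 : anorm (dilation (-n) (scale2pi (0 : Phase d))) < 1 / 2 := by
    rw [map_zero, map_zero, anorm_zero]; norm_num
  filter_upwards [hc.continuousAt.eventually_lt continuousAt_const h0] with η hη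
  rw [lowSymbol_apply, φ.eq_one _ hη.le, Complex.ofReal_one]

theorem lowSymbol_zero (φ : DyadicCutoff d) (n : ℤ) : lowSymbol φ n 0 = 1 :=
  (lowSymbol_eventually_one φ n).self_of_nhds

theorem isAnnular_lowSymbol_sub (φ : DyadicCutoff d) (n m : ℤ) :
    IsAnnular (lowSymbol φ n - lowSymbol φ m) where
  hasCompactSupport :=
    ((lowSymbol_hasCompactSupport φ n).sub (lowSymbol_hasCompactSupport φ m) :)
  eventually_zero := by
    filter_upwards [lowSymbol_eventually_one φ n, lowSymbol_eventually_one φ m] with η h1 h2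
    rw [sub_apply, h1, h2, sub_self, Pi.zero_apply]

theorem lowKernel_sub_eq (φ : DyadicCutoff d) (n m : ℤ) :
    lowKernel φ n - lowKernel φ m = 𝓕⁻ (lowSymbol φ n - lowSymbol φ m) := by
  rw [lowKernel_eq, lowKernel_eq]
  exact (map_sub (FourierTransform.fourierInvCLM ℂ 𝓢(Phase d, ℂ)) _ _).symm

/-- A sequence of kernels that is obtained by dilating, from the index `2` on, one kernel whose
Fourier transform is supported in an annulus. -/
def IsBlockSeq (A : ℕ → 𝓢(Phase d, ℂ)) : Prop :=
  ∃ a : 𝓢(Phase d, ℂ), IsAnnular a ∧ ∀ l, 2 ≤ l → A l = scale (dilation l) (𝓕⁻ a)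

theorem isBlockSeq_blk (φ : DyadicCutoff d) : IsBlockSeq (blk φ) := by
  refine ⟨_, isAnnular_lowSymbol_sub φ 0 (-1), fun l hl => ?_⟩
  obtain ⟨k, rfl⟩ : ∃ k, l = k + 1 := ⟨l - 1, by omega⟩
  rw [← lowKernel_sub_eq, map_sub, scale_dilation_lowKernel, scale_dilation_lowKernel, blk_succ]
  push_cast
  congr 2; ring

theorem isBlockSeq_fat (φ : DyadicCutoff d) : IsBlockSeq (fat φ) := by
  refine ⟨_, isAnnular_lowSymbol_sub φ 1 (-2), fun l hl => ?_⟩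
  rw [← lowKernel_sub_eq, map_sub, scale_dilation_lowKernel, scale_dilation_lowKernel, fat,
    if_neg (by omega)]
  rfl

/-- Two fixed profiles generate all the blocks, including the low-frequency one; this serves where
cancellation of the block is not needed, only its scale. -/
theorem exists_blk_eq_scale (φ : DyadicCutoff d) (l : ℕ) :
    blk φ l = scale (dilation l) (lowKernel φ 0) ∨
      blk φ l = scale (dilation l) (lowKernel φ 0 - lowKernel φ (-1)) := by
  cases l with
  | zero => left; rw [blk_zero, scale_dilation_lowKernel]; rfl
  | succ l =>
    right
    rw [map_sub, scale_dilation_lowKernel, scale_dilation_lowKernel, blk_succ]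
    push_cast
    congr 2; ring

/-! ### Representation of distributions by their blocks -/

theorem tendsto_norm_dilation_neg : Filter.Tendsto (fun n : ℕ =>
    ‖((dilation (-(n : ℤ)) : Phase d ≃L[ℝ] Phase d) : Phase d →L[ℝ] Phase d)‖)
      Filter.atTop (nhds 0) := by
  refine squeeze_zero (fun n => norm_nonneg _) norm_dilation_neg_le ?_
  simp_rw [← inv_pow]
  exact tendsto_pow_atTop_nhds_zero_of_lt_one (by norm_num) (by norm_num)

/-- The blocks telescope to a low-pass filter whose symbol is 1 at the origin. -/
theorem tendsto_sum_sconv_blk (φ : DyadicCutoff d) (ψ : 𝓢(Phase d, ℂ)) :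
    Filter.Tendsto (fun n => ∑ l ∈ Finset.range n, sconv (blk φ l) ψ) Filter.atTop (nhds ψ) := by
  rw [← Filter.tendsto_add_atTop_iff_nat 1]
  have hs : symbolSchwartz φ (-1) (0 : Phase d) = 1 := by
    have := lowSymbol_zero φ 0
    rwa [lowSymbol, SchwartzMap.compCLMOfContinuousLinearEquiv_apply, Function.comp_apply,
      map_zero] at this
  refine (tendsto_sconv_lowPass _ ψ hs _ tendsto_norm_dilation_neg).congr fun n => ?_
  have h := sum_blk φ n
  rw [lowKernel_eq] at h
  have h2 : sconv (∑ l ∈ Finset.range (n + 1), blk φ l) ψ =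
      ∑ l ∈ Finset.range (n + 1), sconv (blk φ l) ψ := by
    unfold sconv
    rw [map_sum, sum_apply]
  rw [← h2, h]
  rfl

theorem block_eq_translate (φ : DyadicCutoff d) (l : ℕ) (g : 𝓢'(Phase d, ℂ)) (z : Phase d) :
    block φ ((l : ℤ) - 1) g z = g (translate z (blk φ l)) := by
  change g (reflectAt z (blk φ l)) = _
  congr 1
  ext y
  rw [reflectAt_apply, ← blk_neg, neg_sub]
  rfl

/-- The block of a distribution, as a function. -/
def blkFun (φ : DyadicCutoff d) (g : 𝓢'(Phase d, ℂ)) (l : ℕ) (z : Phase d) : ℂ :=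
  block φ ((l : ℤ) - 1) g z

theorem continuous_blkFun (φ : DyadicCutoff d) (g : 𝓢'(Phase d, ℂ)) (l : ℕ) :
    Continuous (blkFun φ g l) := by
  have : blkFun φ g l = fun z => g (translate z (blk φ l)) :=
    funext fun z => block_eq_translate φ l g z
  rw [this]
  exact continuous_apply_translate g _

theorem integral_blkFun_mul (φ : DyadicCutoff d) (g : 𝓢'(Phase d, ℂ)) (l : ℕ)
    (χ : 𝓢(Phase d, ℂ)) : ∫ z, blkFun φ g l z * χ z = g (sconv (blk φ l) χ) := by
  rw [sconv_comm, ← integral_mul_translate]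
  refine integral_congr_ae (Filter.Eventually.of_forall fun z => ?_)
  simp only [blkFun, block_eq_translate, mul_comm]

/-- Insert the reproducing identity into g(ψ) = Σ_l g(blk_l * ψ) and interchange `g` with the
convolution integral. Now `g` enters only through its blocks, which the norm controls. -/
theorem tendsto_sum_integral_blkFun (φ : DyadicCutoff d) (g : 𝓢'(Phase d, ℂ))
    (ψ : 𝓢(Phase d, ℂ)) :
    Filter.Tendsto (fun n => ∑ l ∈ Finset.range n, ∫ z, blkFun φ g l z * sconv (fat φ l) ψ z)
      Filter.atTop (nhds (g ψ)) := by
  refine ((g.continuous.tendsto _).comp (tendsto_sum_sconv_blk φ ψ)).congr fun n => ?_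
  have h : g (∑ l ∈ Finset.range n, sconv (blk φ l) ψ) =
      ∑ l ∈ Finset.range n, g (sconv (blk φ l) ψ) :=
    map_sum (g : 𝓢(Phase d, ℂ) →L[ℂ] ℂ) _ _
  refine h.trans ?_
  refine Finset.sum_congr rfl fun l _ => ?_
  rw [integral_blkFun_mul, ← sconv_assoc, sconv_blk_fat]

theorem sconv_reflectAt (A G : 𝓢(Phase d, ℂ)) (hA : ∀ z, A (-z) = A z) (z : Phase d) :
    sconv A (reflectAt z G) = reflectAt z (sconv A G) := by
  ext x
  rw [reflectAt_apply, sconv_apply, sconv_apply, ← integral_comp_neg]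
  refine integral_congr_ae (Filter.Eventually.of_forall fun y => ?_)
  simp only [reflectAt_apply, hA]
  congr 2
  abel

/-- The convolution of a Schwartz function and a distribution in terms of the blocks. -/
theorem tendsto_sum_conv (φ : DyadicCutoff d) (g : 𝓢'(Phase d, ℂ)) (G : 𝓢(Phase d, ℂ))
    (z : Phase d) :
    Filter.Tendsto (fun n => ∑ l ∈ Finset.range n, ∫ y, blkFun φ g l y * sconv (fat φ l) G (z - y))
      Filter.atTop (nhds (conv G g z)) := by
  refine (tendsto_sum_integral_blkFun φ g (reflectAt z G)).congr fun n => ?_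
  refine Finset.sum_congr rfl fun l _ => ?_
  rw [sconv_reflectAt _ _ (fat_neg φ l)]
  simp only [reflectAt_apply]

/-- The basic linear estimate: each block contributes, by moderateness of the weight, its size times
a weighted L¹ norm of a kernel, and the bound passes to the limit of the partial sums. -/
theorem weight_mul_norm_conv_le (φ : DyadicCutoff d) {g : 𝓢'(Phase d, ℂ)} {G : 𝓢(Phase d, ℂ)}
    {κ β M B : ℝ} (hM : 0 ≤ M)
    (hg : ∀ l z, weight κ z * ‖blkFun φ g l z‖ ≤ (2 : ℝ) ^ (β * l) * M)
    (hG : ∀ n, ∑ l ∈ Finset.range n, (2 : ℝ) ^ (β * l) *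
      weightedL1 ⌈|κ|⌉₊ (sconv (fat φ l) G) ≤ B) (z : Phase d) :
    weight κ z * ‖conv G g z‖ ≤ 2 ^ (|κ| / 2) * B * M := by
  have h1 : Filter.Tendsto (fun n => weight κ z *
      ‖∑ l ∈ Finset.range n, ∫ y, blkFun φ g l y * sconv (fat φ l) G (z - y)‖)
      Filter.atTop (nhds (weight κ z * ‖conv G g z‖)) :=
    (tendsto_sum_conv φ g G z).norm.const_mul _
  refine le_of_tendsto' h1 fun n => ?_
  calc weight κ z * ‖∑ l ∈ Finset.range n, ∫ y, blkFun φ g l y * sconv (fat φ l) G (z - y)‖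
      ≤ weight κ z *
          ∑ l ∈ Finset.range n, ‖∫ y, blkFun φ g l y * sconv (fat φ l) G (z - y)‖ := by
        have := (weight_pos κ z).le
        gcongr
        exact norm_sum_le _ _
    _ ≤ ∑ l ∈ Finset.range n, 2 ^ (|κ| / 2) * M * ((2 : ℝ) ^ (β * l) *
          weightedL1 ⌈|κ|⌉₊ (sconv (fat φ l) G)) := by
        rw [Finset.mul_sum]
        refine Finset.sum_le_sum fun l _ => ?_
        refine (weight_mul_norm_integral_le (by positivity) (fun z => (weight_pos κ z).le)
          (weight_le_mul_weight κ) (hg l) _ z).trans (le_of_eq ?_)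
        ring
    _ ≤ 2 ^ (|κ| / 2) * M * B := by
        rw [← Finset.mul_sum]
        gcongr
        exact hG n
    _ = _ := by ring

/-! ## Bounds for convolutions of kernels -/

/-- The decay factor `(1 + x)^{-2}`. -/
def decay (x : ℝ) : ℝ := ((1 + x) ^ 2)⁻¹

theorem decay_pos {x : ℝ} (hx : 0 ≤ x) : 0 < decay x := by unfold decay; positivity

theorem decay_anti {x y : ℝ} (hx : 0 ≤ x) (h : x ≤ y) : decay y ≤ decay x := by
  unfold decay; gcongr

theorem le_mul_decay {x X a : ℝ} (hx : 0 ≤ x) (h : x ≤ X) (ha : 0 ≤ a) :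
    a ≤ a * (1 + X) ^ 2 * decay x := by
  unfold decay
  rw [mul_assoc]
  refine le_mul_of_one_le_right ha ?_
  rw [← div_eq_mul_inv, one_le_div (by positivity)]
  gcongr

theorem decay_le_inv_sq {x : ℝ} (hx : 0 < x) : decay x ≤ (x ^ 2)⁻¹ := by
  unfold decay; gcongr; linarith

theorem inv_sq_le_decay {x : ℝ} (hx : 1 ≤ x) : (x ^ 2)⁻¹ ≤ 4 * decay x := by
  unfold decay
  rw [← div_eq_mul_inv, inv_eq_one_div, div_le_div_iff₀ (by positivity) (by positivity)]
  nlinarith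

theorem weightedL1_scale_delta_inv_le {s S : ℝ} (hs : 0 < s) (h : s ≤ S) (m : ℕ)
    (B : 𝓢(Phase d, ℂ)) :
    weightedL1 m (scale (delta s⁻¹ (inv_pos.2 hs)) B) ≤ ((1 + S) ^ 3) ^ m * weightedL1 m B := by
  refine (weightedL1_scale_le _ _ _).trans ?_
  have h1 : ‖(((delta s⁻¹ (inv_pos.2 hs) : Phase d ≃L[ℝ] Phase d).symm :
      Phase d ≃L[ℝ] Phase d) : Phase d →L[ℝ] Phase d)‖ ≤ (1 + S) ^ 3 := by
    rw [delta_symm]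
    exact norm_delta_le _ S _ (by rwa [inv_inv])
  have h2 : (1 : ℝ) ≤ (1 + S) ^ 3 := one_le_pow₀ (by linarith)
  have := weightedL1_nonneg m B
  gcongr
  exact max_le h2 h1

theorem weightedL1_scale_dilation_le (m l : ℕ) (G : 𝓢(Phase d, ℂ)) :
    weightedL1 m (scale (dilation (l : ℤ)) G) ≤ weightedL1 m G := by
  refine (weightedL1_scale_le _ _ _).trans ?_
  rw [dilation_symm, max_eq_left, one_pow, one_mul]
  exact (norm_dilation_neg_le l).trans (inv_le_one_of_one_le₀ (one_le_pow₀ one_le_two))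

theorem derivL1_scale_transport_le {t T : ℝ} (ht : |t| ≤ T) (m n : ℕ) (G : 𝓢(Phase d, ℂ)) :
    derivL1 m n (scale (transport t) G) ≤ (1 + T) ^ m * (1 + T) ^ n * derivL1 m n G := by
  refine (derivL1_scale_le _ _ _ _).trans ?_
  have hT : 0 ≤ T := (abs_nonneg t).trans ht
  have h1 : ‖((transport t : Phase d ≃L[ℝ] Phase d) : Phase d →L[ℝ] Phase d)‖ ≤ 1 + T :=
    (norm_transport_le t).trans (by linarith)
  have h2 : ‖(((transport t : Phase d ≃L[ℝ] Phase d).symm :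
      Phase d ≃L[ℝ] Phase d) : Phase d →L[ℝ] Phase d)‖ ≤ 1 + T := by
    rw [transport_symm]
    exact (norm_transport_le (-t)).trans (by rw [abs_neg]; linarith)
  have := derivL1_nonneg m n G
  gcongr
  exact max_le (by linarith) h2

theorem weightedL1_scale_transport_le {t T : ℝ} (ht : |t| ≤ T) (m : ℕ) (G : 𝓢(Phase d, ℂ)) :
    weightedL1 m (scale (transport t) G) ≤ (1 + T) ^ m * weightedL1 m G := by
  simpa [derivL1_zero] using derivL1_scale_transport_le ht m 0 G

theorem IsBlockSeq.exists_weightedL1_le {A : ℕ → 𝓢(Phase d, ℂ)} (hA : IsBlockSeq A) (m : ℕ) :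
    ∃ C : ℝ, 0 ≤ C ∧ ∀ l, weightedL1 m (A l) ≤ C := by
  obtain ⟨a, -, ha⟩ := hA
  have h0 := weightedL1_nonneg m (A 0)
  have h1 := weightedL1_nonneg m (A 1)
  have h2 := weightedL1_nonneg m (𝓕⁻ a)
  refine ⟨weightedL1 m (A 0) + weightedL1 m (A 1) + weightedL1 m (𝓕⁻ a), by positivity,
    fun l => ?_⟩
  rcases l with _ | _ | l
  · linarith
  · linarith
  · rw [ha _ (by omega)]
    refine (weightedL1_scale_dilation_le m _ _).trans ?_
    linarith

/-- After the rescaling by 1/s is pulled out, the block kernel is dilated by R = 2^l s. Four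
integrations by parts give R^{-4} = (4^l s²)^{-2}, the decay for large R; for bounded R the trivial
bound suffices. -/
theorem IsBlockSeq.exists_weightedL1_sconv_le {A : ℕ → 𝓢(Phase d, ℂ)} (hA : IsBlockSeq A) (m : ℕ)
    {S : ℝ} (hS : 0 < S) :
    ∃ C : ℝ, 0 ≤ C ∧ ∀ (B : 𝓢(Phase d, ℂ)) (s : ℝ) (hs : 0 < s), s ≤ S → ∀ l : ℕ,
      weightedL1 m (sconv (A l) (scale (delta s⁻¹ (inv_pos.2 hs)) B)) ≤
        C * decay (4 ^ l * s ^ 2) * (derivL1 m 0 B + derivL1 m 4 B) := by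
  obtain ⟨N, hN, hAN⟩ := hA.exists_weightedL1_le m
  obtain ⟨a, ha, hAa⟩ := hA
  obtain ⟨C, hC, hcan⟩ := ha.exists_weightedL1_sconv_le 4 m
  set K : ℝ := ((1 + S) ^ 3) ^ m
  refine ⟨N * K * (1 + (4 * S ^ 2 + 1)) ^ 2 + 4 * (K * C), by positivity,
    fun B s hs hsS l => ?_⟩
  have hx : (0 : ℝ) ≤ 4 ^ l * s ^ 2 := by positivity
  have hdec := decay_pos hx
  have hD0 := derivL1_nonneg m 0 B
  have hD4 := derivL1_nonneg m 4 B
  have htriv : weightedL1 m (sconv (A l) (scale (delta s⁻¹ (inv_pos.2 hs)) B)) ≤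
      N * K * derivL1 m 0 B := by
    rw [derivL1_zero]
    refine (weightedL1_sconv_le _ _ _).trans ?_
    rw [mul_assoc]
    gcongr
    · exact weightedL1_nonneg _ _
    · exact hAN l
    · exact weightedL1_scale_delta_inv_le hs hsS m B
  -- Above this threshold `l ≥ 2`, so `A l` really is a dilated annular kernel, and also R ≥ 1.
  by_cases hc : (4 : ℝ) ^ l * s ^ 2 ≤ 4 * S ^ 2 + 1
  · calc _ ≤ N * K * derivL1 m 0 B := htriv
      _ ≤ N * K * (1 + (4 * S ^ 2 + 1)) ^ 2 * decay (4 ^ l * s ^ 2) * derivL1 m 0 B := by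
        gcongr ?_ * _
        exact le_mul_decay hx hc (by positivity)
      _ ≤ _ := by
        gcongr
        · exact le_add_of_nonneg_right (by positivity)
        · linarith
  · push Not at hc
    have hl : 2 ≤ l := by
      by_contra hlt
      have : (4 : ℝ) ^ l ≤ 4 ^ 1 := pow_le_pow_right₀ (by norm_num) (by omega)
      nlinarith [mul_le_mul this (pow_le_pow_left₀ hs.le hsS 2) (by positivity) (by norm_num)]
    have hR1 : 1 ≤ s⁻¹⁻¹ * 2 ^ (l : ℤ) := by
      rw [inv_inv, zpow_natCast]
      by_contra hlt
      push Not at hlt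
      have h1 : (s * 2 ^ l) ^ 2 < 1 := by
        rw [sq_lt_one_iff_abs_lt_one, abs_of_pos (by positivity)]
        exact hlt
      rw [mul_pow, ← pow_mul, mul_comm l 2, pow_mul] at h1
      norm_num at h1
      nlinarith [sq_nonneg S]
    set R : ℝ := s⁻¹⁻¹ * 2 ^ (l : ℤ) with hR
    have hR0 : 0 < R := by linarith
    have hRx : R ^ 2 = 4 ^ l * s ^ 2 := by
      rw [hR, inv_inv, zpow_natCast, mul_pow, ← pow_mul, mul_comm l 2, pow_mul]
      norm_num
      ring
    have he : sconv (A l) (scale (delta s⁻¹ (inv_pos.2 hs)) B) =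
        scale (delta s⁻¹ (inv_pos.2 hs)) (sconv (scale (delta R hR0) (𝓕⁻ a)) B) := by
      rw [scale_sconv, scale_scale, hAa l hl, dilation_eq_delta, delta_trans]
      congr 4
      rw [hR, inv_inv, ← mul_assoc, inv_mul_cancel₀ hs.ne', one_mul]
    have hnorm : ‖(((delta R hR0 : Phase d ≃L[ℝ] Phase d).symm :
        Phase d ≃L[ℝ] Phase d) : Phase d →L[ℝ] Phase d)‖ ≤ R⁻¹ := by
      rw [delta_symm]
      exact norm_delta_le_of_le_one _ _ (inv_le_one_of_one_le₀ hR1)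
    rw [he]
    calc _ ≤ K * weightedL1 m (sconv (scale (delta R hR0) (𝓕⁻ a)) B) :=
          weightedL1_scale_delta_inv_le hs hsS m _
      _ ≤ K * (C * R⁻¹ ^ 4 * derivL1 m 4 B) := by
          gcongr
          refine (hcan _ (hnorm.trans (inv_le_one_of_one_le₀ hR1)) B).trans ?_
          gcongr
      _ = K * C * ((R ^ 2) ^ 2)⁻¹ * derivL1 m 4 B := by
          rw [inv_pow, ← pow_mul]; ring
      _ ≤ K * C * (4 * decay (R ^ 2)) * derivL1 m 4 B := by
          gcongr
          exact inv_sq_le_decay (one_le_pow₀ hR1)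
      _ = 4 * (K * C) * decay (4 ^ l * s ^ 2) * derivL1 m 4 B := by rw [hRx]; ring
      _ ≤ _ := by
        gcongr
        · exact le_add_of_nonneg_left (by positivity)
        · linarith

/-! ### The heat kernel -/

theorem exists_weightedL1_kinKernel_le (m : ℕ) (T : ℝ) :
    ∃ C : ℝ, 0 ≤ C ∧ ∀ (t : ℝ) (ht : 0 < t), t ≤ T →
      weightedL1 m (kinKernel t ht : 𝓢(Phase d, ℂ)) ≤ C := by
  have := weightedL1_nonneg m (kinKernel 1 one_pos : 𝓢(Phase d, ℂ))
  refine ⟨((1 + √T) ^ 3) ^ m * weightedL1 m (kinKernel 1 one_pos : 𝓢(Phase d, ℂ)), by positivity,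
    fun t ht htT => ?_⟩
  rw [kinKernel_eq_scale t ht]
  exact weightedL1_scale_delta_inv_le (Real.sqrt_pos.2 ht) (Real.sqrt_le_sqrt htT) m _

theorem IsBlockSeq.exists_sconv_kinKernel_le {A : ℕ → 𝓢(Phase d, ℂ)} (hA : IsBlockSeq A) (m : ℕ)
    {T : ℝ} (hT : 0 < T) :
    ∃ C : ℝ, 0 ≤ C ∧ ∀ (t : ℝ) (ht : 0 < t), t ≤ T → ∀ l : ℕ,
      weightedL1 m (sconv (A l) (kinKernel t ht)) ≤ C * decay (4 ^ l * t) := by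
  obtain ⟨C, hC, h⟩ := hA.exists_weightedL1_sconv_le m (Real.sqrt_pos.2 hT)
  have h0 := derivL1_nonneg m 0 (kinKernel 1 one_pos : 𝓢(Phase d, ℂ))
  have h4 := derivL1_nonneg m 4 (kinKernel 1 one_pos : 𝓢(Phase d, ℂ))
  refine ⟨C * (derivL1 m 0 (kinKernel 1 one_pos : 𝓢(Phase d, ℂ)) +
    derivL1 m 4 (kinKernel 1 one_pos : 𝓢(Phase d, ℂ))), by positivity, fun t ht htT l => ?_⟩
  have := h (kinKernel 1 one_pos) (√t) (Real.sqrt_pos.2 ht) (Real.sqrt_le_sqrt htT) l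
  rw [Real.sq_sqrt ht.le] at this
  rw [kinKernel_eq_scale t ht]
  refine this.trans (le_of_eq ?_)
  ring

/-- The scaling of p_t turns the shear by time t into the shear by time 1, so the sheared heat
kernels are rescalings of one fixed function. -/
theorem scale_transport_kinKernel (t : ℝ) (ht : 0 < t) :
    scale (transport t) (kinKernel t ht : 𝓢(Phase d, ℂ)) =
      scale (delta (√t)⁻¹ (inv_pos.2 (Real.sqrt_pos.2 ht)))
        (scale (transport 1) (kinKernel 1 one_pos)) := by
  rw [kinKernel_eq_scale t ht, scale_scale, scale_scale, transport_trans_delta]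
  congr 3
  rw [inv_pow, Real.sq_sqrt ht.le, inv_mul_cancel₀ ht.ne']

/-- Pulling the shear out of the convolution puts the opposite shear on p_t, where it is a rescaling
of a fixed Schwartz function; the outer shear has bounded time and costs a constant. -/
theorem IsBlockSeq.exists_scale_transport_sconv_kinKernel_le {A : ℕ → 𝓢(Phase d, ℂ)}
    (hA : IsBlockSeq A) (m : ℕ) {T : ℝ} (hT : 0 < T) :
    ∃ C : ℝ, 0 ≤ C ∧ ∀ (t : ℝ) (ht : 0 < t), t ≤ T → ∀ l : ℕ,
      weightedL1 m (sconv (scale (transport (-t)) (A l)) (kinKernel t ht)) ≤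
        C * decay (4 ^ l * t) := by
  obtain ⟨C, hC, h⟩ := hA.exists_weightedL1_sconv_le m (Real.sqrt_pos.2 hT)
  set B : 𝓢(Phase d, ℂ) := scale (transport 1) (kinKernel 1 one_pos)
  have h0 := derivL1_nonneg m 0 B
  have h4 := derivL1_nonneg m 4 B
  refine ⟨(1 + T) ^ m * C * (derivL1 m 0 B + derivL1 m 4 B), by positivity, fun t ht htT l => ?_⟩
  have h1 := h B (√t) (Real.sqrt_pos.2 ht) (Real.sqrt_le_sqrt htT) l
  rw [Real.sq_sqrt ht.le, ← scale_transport_kinKernel t ht] at h1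
  have h2 : sconv (scale (transport (-t)) (A l)) (kinKernel t ht) =
      scale (transport (-t)) (sconv (A l) (scale (transport t) (kinKernel t ht))) := by
    rw [scale_sconv, scale_scale, transport_trans, neg_add_cancel]
    congr 1
    ext z
    rw [scale_apply, absDet_transport, transport_zero_apply]
    simp
  rw [h2]
  calc _ ≤ (1 + T) ^ m * weightedL1 m (sconv (A l) (scale (transport t) (kinKernel t ht))) :=
        weightedL1_scale_transport_le (by rwa [abs_neg, abs_of_pos ht]) m _
    _ ≤ (1 + T) ^ m * (C * decay (4 ^ l * t) * (derivL1 m 0 B + derivL1 m 4 B)) := by gcongr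
    _ = _ := by ring

/-- In units of the scale 2^{-k} the shear has time 4^k t ≤ 1, so the sheared kernel is a rescaling
by 2^k of a function bounded in all relevant norms. -/
theorem IsBlockSeq.exists_sconv_scale_transport_le {A : ℕ → 𝓢(Phase d, ℂ)} (hA : IsBlockSeq A)
    (b : 𝓢(Phase d, ℂ)) (m : ℕ) :
    ∃ C : ℝ, 0 ≤ C ∧ ∀ t : ℝ, 0 ≤ t → ∀ l k : ℕ, 4 ^ k * t ≤ 1 →
      weightedL1 m (sconv (A l) (scale (transport (-t)) (scale (dilation (k : ℤ)) b))) ≤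
        C * decay (4 ^ l / 4 ^ k) := by
  obtain ⟨C, hC, h⟩ := hA.exists_weightedL1_sconv_le m one_pos
  have h0 := derivL1_nonneg m 0 b
  have h4 := derivL1_nonneg m 4 b
  refine ⟨C * ((1 + 1) ^ m * (1 + 1) ^ 0 * derivL1 m 0 b + (1 + 1) ^ m * (1 + 1) ^ 4 *
    derivL1 m 4 b), by positivity, fun t ht l k hk => ?_⟩
  have hs : (0 : ℝ) < (2 ^ k)⁻¹ := by positivity
  have hB : scale (transport (-t)) (scale (dilation (k : ℤ)) b) =
      scale (delta ((2 : ℝ) ^ k)⁻¹⁻¹ (inv_pos.2 hs)) (scale (transport (-(4 ^ k * t))) b) := by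
    rw [scale_scale, scale_scale, dilation_eq_delta, transport_trans_delta]
    congr 3
    · simp
    · rw [zpow_natCast, ← pow_mul, mul_comm k 2, pow_mul]
      norm_num
  have h1 := h (scale (transport (-(4 ^ k * t))) b) ((2 : ℝ) ^ k)⁻¹ hs
    (inv_le_one_of_one_le₀ (one_le_pow₀ one_le_two)) l
  have habs : |-(4 ^ k * t)| ≤ 1 := by rwa [abs_neg, abs_of_nonneg (by positivity)]
  have e : (4 : ℝ) ^ l * (2 ^ k)⁻¹ ^ 2 = 4 ^ l / 4 ^ k := by
    rw [inv_pow, ← pow_mul, mul_comm k 2, pow_mul]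
    norm_num
    rfl
  rw [e] at h1
  rw [hB]
  have hd : 0 < decay ((4 : ℝ) ^ l / 4 ^ k) := decay_pos (by positivity)
  calc _ ≤ _ := h1
    _ ≤ C * decay (4 ^ l / 4 ^ k) * ((1 + 1) ^ m * (1 + 1) ^ 0 * derivL1 m 0 b +
          (1 + 1) ^ m * (1 + 1) ^ 4 * derivL1 m 4 b) := by
        gcongr
        · exact derivL1_scale_transport_le habs _ _ _
        · exact derivL1_scale_transport_le habs _ _ _
    _ = _ := by ring

/-- The influence of the l-th block of g on the k-th block of P_t g. The shear destroys exact
frequency localisation. What survives is smallness for 4^k t large and for l above k; for l below k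
no smallness is needed, as Σ_{l ≤ k} 2^{βl} is already of order 2^{βk}. -/
theorem exists_sconv_transport_blk_kinKernel_le (φ : DyadicCutoff d) (m : ℕ) {T : ℝ} (hT : 0 < T) :
    ∃ C : ℝ, 0 ≤ C ∧ ∀ (t : ℝ) (ht : 0 < t), t ≤ T → ∀ l k : ℕ,
      weightedL1 m (sconv (fat φ l) (sconv (scale (transport (-t)) (blk φ k)) (kinKernel t ht))) ≤
        C * decay (4 ^ k * t) * decay (4 ^ l / 4 ^ k) := by
  obtain ⟨N, hN, hfat⟩ := (isBlockSeq_fat φ).exists_weightedL1_le m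
  obtain ⟨N', hN', hblk⟩ := (isBlockSeq_blk φ).exists_weightedL1_le m
  obtain ⟨P, hP, hp⟩ := exists_weightedL1_kinKernel_le (d := d) m T
  obtain ⟨C₁, hC₁, h₁⟩ := (isBlockSeq_fat φ).exists_sconv_kinKernel_le m hT
  obtain ⟨C₂, hC₂, h₂⟩ := (isBlockSeq_blk φ).exists_scale_transport_sconv_kinKernel_le m hT
  obtain ⟨C₃, hC₃, h₃⟩ := (isBlockSeq_fat φ).exists_sconv_scale_transport_le (lowKernel φ 0) m
  obtain ⟨C₄, hC₄, h₄⟩ := (isBlockSeq_fat φ).exists_sconv_scale_transport_le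
    (lowKernel φ 0 - lowKernel φ (-1)) m
  refine ⟨4 * ((C₃ + C₄) * P) + 4 * (N * C₂) + 4 * (4 * (4 * (C₁ * ((1 + T) ^ m * N')))),
    by positivity, fun t ht htT l k => ?_⟩
  have hx : (0 : ℝ) < 4 ^ k * t := by positivity
  have hy : (0 : ℝ) < 4 ^ l / 4 ^ k := by positivity
  have hdx := decay_pos hx.le
  have hdy := decay_pos hy.le
  rw [mul_assoc, add_mul, add_mul]
  have hprod : 0 < decay (4 ^ k * t) * decay (4 ^ l / 4 ^ k) := by positivity
  -- Small times: the factor `decay (4 ^ k * t)` is at least 1/4, and the sheared block is localised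
  -- well enough at scale 2^k.
  rcases le_total ((4 : ℝ) ^ k * t) 1 with hk | hk
  · have h5 : weightedL1 m (sconv (fat φ l) (scale (transport (-t)) (blk φ k))) ≤
        (C₃ + C₄) * decay (4 ^ l / 4 ^ k) := by
      rcases exists_blk_eq_scale φ k with h | h
      · rw [h]
        refine (h₃ t ht.le l k hk).trans ?_
        gcongr
        linarith
      · rw [h]
        refine (h₄ t ht.le l k hk).trans ?_
        gcongr
        linarith
    have h6 : (1 : ℝ) ≤ 4 * decay (4 ^ k * t) := by
      refine (le_mul_decay hx.le hk zero_le_one).trans (le_of_eq ?_); norm_num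
    calc _ ≤ weightedL1 m (sconv (fat φ l) (scale (transport (-t)) (blk φ k))) *
          weightedL1 m (kinKernel t ht) := by
          rw [← sconv_assoc]; exact weightedL1_sconv_le _ _ _
      _ ≤ ((C₃ + C₄) * decay (4 ^ l / 4 ^ k)) * P := by
          gcongr
          · exact weightedL1_nonneg _ _
          · exact hp t ht htT
      _ ≤ ((C₃ + C₄) * decay (4 ^ l / 4 ^ k)) * P * (4 * decay (4 ^ k * t)) :=
          le_mul_of_one_le_right (by positivity) h6
      _ = 4 * ((C₃ + C₄) * P) * (decay (4 ^ k * t) * decay (4 ^ l / 4 ^ k)) := by ring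
      _ ≤ _ := by
          rw [add_assoc]
          exact le_add_of_nonneg_right (by positivity)
  -- For l ≤ k the factor in l/k is at least 1/4, and the sheared block against p_t provides the
  -- other one.
  rcases le_total l k with hlk | hlk
  · have hy1 : (4 : ℝ) ^ l / 4 ^ k ≤ 1 :=
      (div_le_one (by positivity)).2 (pow_le_pow_right₀ (by norm_num) hlk)
    have h6 : (1 : ℝ) ≤ 4 * decay (4 ^ l / 4 ^ k) := by
      refine (le_mul_decay hy.le hy1 zero_le_one).trans (le_of_eq ?_); norm_num
    calc _ ≤ weightedL1 m (fat φ l) *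
          weightedL1 m (sconv (scale (transport (-t)) (blk φ k)) (kinKernel t ht)) :=
          weightedL1_sconv_le _ _ _
      _ ≤ N * (C₂ * decay (4 ^ k * t)) := by
          gcongr
          · exact weightedL1_nonneg _ _
          · exact hfat l
          · exact h₂ t ht htT k
      _ ≤ N * (C₂ * decay (4 ^ k * t)) * (4 * decay (4 ^ l / 4 ^ k)) :=
          le_mul_of_one_le_right (by positivity) h6
      _ = 4 * (N * C₂) * (decay (4 ^ k * t) * decay (4 ^ l / 4 ^ k)) := by ring
      _ ≤ _ := by
          have : 0 ≤ 4 * ((C₃ + C₄) * P) * (decay (4 ^ k * t) * decay (4 ^ l / 4 ^ k)) := by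
            positivity
          have : 0 ≤ 4 * (4 * (4 * (C₁ * ((1 + T) ^ m * N')))) *
            (decay (4 ^ k * t) * decay (4 ^ l / 4 ^ k)) := by positivity
          linarith
  -- For l ≥ k and 4^k t ≥ 1 the fattened block acts on p_t, and (4^l t)^{-2} factors into (4^k
  -- t)^{-2} and (4^l/4^k)^{-2}.
  · have hy1 : 1 ≤ (4 : ℝ) ^ l / 4 ^ k :=
      (one_le_div (by positivity)).2 (pow_le_pow_right₀ (by norm_num) hlk)
    have e : (4 : ℝ) ^ l * t = (4 ^ k * t) * (4 ^ l / 4 ^ k) := by field_simp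
    have h6 : decay ((4 : ℝ) ^ l * t) ≤
        4 * (4 * (decay (4 ^ k * t) * decay (4 ^ l / 4 ^ k))) := by
      refine (decay_le_inv_sq (by positivity)).trans ?_
      rw [e, mul_pow, mul_inv]
      refine (mul_le_mul (inv_sq_le_decay hk) (inv_sq_le_decay hy1) (by positivity)
        (by positivity)).trans (le_of_eq ?_)
      ring
    have h7 : sconv (fat φ l) (sconv (scale (transport (-t)) (blk φ k)) (kinKernel t ht)) =
        sconv (sconv (fat φ l) (kinKernel t ht)) (scale (transport (-t)) (blk φ k)) := by
      rw [sconv_comm (scale (transport (-t)) (blk φ k)), sconv_assoc]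
    rw [h7]
    calc _ ≤ weightedL1 m (sconv (fat φ l) (kinKernel t ht)) *
          weightedL1 m (scale (transport (-t)) (blk φ k)) := weightedL1_sconv_le _ _ _
      _ ≤ (C₁ * decay (4 ^ l * t)) * ((1 + T) ^ m * N') := by
          refine mul_le_mul (h₁ t ht htT l) ?_ (weightedL1_nonneg _ _) ?_
          rotate_left
          · exact (weightedL1_nonneg _ _).trans (h₁ t ht htT l)
          · refine (weightedL1_scale_transport_le (T := T)
              (by rwa [abs_neg, abs_of_pos ht]) m _).trans ?_
            gcongr
            exact hblk k
      _ ≤ (C₁ * (4 * (4 * (decay (4 ^ k * t) * decay (4 ^ l / 4 ^ k))))) *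
            ((1 + T) ^ m * N') := by gcongr
      _ = 4 * (4 * (C₁ * ((1 + T) ^ m * N'))) *
            (decay (4 ^ k * t) * decay (4 ^ l / 4 ^ k)) := by ring
      _ ≤ _ := by
          have : 0 ≤ 4 * ((C₃ + C₄) * P) * (decay (4 ^ k * t) * decay (4 ^ l / 4 ^ k)) := by
            positivity
          have : 0 ≤ 4 * (N * C₂) * (decay (4 ^ k * t) * decay (4 ^ l / 4 ^ k)) := by positivity
          have : 0 ≤ 4 * (4 * (C₁ * ((1 + T) ^ m * N'))) *
            (decay (4 ^ k * t) * decay (4 ^ l / 4 ^ k)) := by positivity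
          linarith

/-! ### Time increments of the heat kernel -/

section General

open LineDeriv

set_option linter.unusedSectionVars false

variable {E : Type*} [NormedAddCommGroup E] [InnerProductSpace ℝ E]
variable [FiniteDimensional ℝ E] [MeasurableSpace E] [BorelSpace E]

theorem norm_iteratedFDeriv_succ_le_sum (F : 𝓢(E, ℂ)) (n : ℕ) (y : E) :
    ‖iteratedFDeriv ℝ (n + 1) F y‖ ≤
      ∑ k, ‖iteratedFDeriv ℝ n (∂_{stdOrthonormalBasis ℝ E k} F : 𝓢(E, ℂ)) y‖ := by
  set e := stdOrthonormalBasis ℝ E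
  set A : Fin (Module.finrank ℝ E) → ℂ →L[ℝ] (E →L[ℝ] ℂ) := fun k =>
    ContinuousLinearMap.smulRightL ℝ E ℂ (innerSL ℝ (e k))
  have hA (k) : ‖A k‖ ≤ 1 := by
    refine ContinuousLinearMap.opNorm_le_bound _ zero_le_one fun c => ?_
    change ‖(innerSL ℝ (e k)).smulRight c‖ ≤ _
    rw [ContinuousLinearMap.norm_smulRight_apply, innerSL_apply_norm, e.orthonormal.1 k]
  have h1 : fderiv ℝ F = fun x => ∑ k, (A k ∘ (∂_{e k} F : 𝓢(E, ℂ))) x := by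
    funext x
    ext w
    rw [sum_apply]
    have hw : w = ∑ k, inner ℝ (e k) w • e k := (e.sum_repr' w).symm
    conv_lhs => rw [hw, map_sum]
    refine Finset.sum_congr rfl fun k _ => ?_
    rw [map_smul]
    change _ = inner ℝ (e k) w • (∂_{e k} F : 𝓢(E, ℂ)) x
    rw [SchwartzMap.lineDerivOp_apply_eq_fderiv]
  have hs (k) : ContDiff ℝ n (A k ∘ (∂_{e k} F : 𝓢(E, ℂ))) :=
    (A k).contDiff.comp ((∂_{e k} F : 𝓢(E, ℂ)).smooth n)
  rw [← norm_iteratedFDeriv_fderiv, h1,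
    iteratedFDeriv_fun_sum_apply (fun k _ => (hs k).contDiffAt)]
  refine (norm_sum_le _ _).trans (Finset.sum_le_sum fun k _ => ?_)
  refine ((A k).norm_iteratedFDeriv_comp_left (((∂_{e k} F : 𝓢(E, ℂ)).smooth n).contDiffAt)
    le_rfl).trans ?_
  exact mul_le_of_le_one_left (norm_nonneg _) (hA k)

theorem derivL1_succ_le_sum (m n : ℕ) (F : 𝓢(E, ℂ)) :
    derivL1 m (n + 1) F ≤ ∑ k, derivL1 m n (∂_{stdOrthonormalBasis ℝ E k} F) := by
  unfold derivL1
  rw [← integral_finsetSum _ (fun k _ => integrable_one_add_norm_pow_mul _ m n)]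
  refine integral_mono (integrable_one_add_norm_pow_mul _ m (n + 1))
    (integrable_finsetSum _ fun k _ => integrable_one_add_norm_pow_mul _ m n) fun y => ?_
  simp only [← Finset.mul_sum]
  gcongr
  exact norm_iteratedFDeriv_succ_le_sum F n y

theorem derivL1_add_le (m n : ℕ) (f g : 𝓢(E, ℂ)) :
    derivL1 m n (f + g) ≤ derivL1 m n f + derivL1 m n g := by
  unfold derivL1
  rw [← integral_add (integrable_one_add_norm_pow_mul f m n)
    (integrable_one_add_norm_pow_mul g m n)]
  refine integral_mono (integrable_one_add_norm_pow_mul _ m n)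
    ((integrable_one_add_norm_pow_mul f m n).add
      (integrable_one_add_norm_pow_mul g m n)) fun y => ?_
  simp only [← mul_add]
  gcongr
  have : ((f + g : 𝓢(E, ℂ)) : E → ℂ) = (f : E → ℂ) + g := rfl
  rw [this, iteratedFDeriv_add_apply (f.smooth n).contDiffAt (g.smooth n).contDiffAt]
  exact norm_add_le _ _

end General

open LineDeriv

theorem norm_delta_sub_le {r : ℝ} (hr : 0 < r) (h : r ≤ 1) (z : Phase d) :
    ‖delta r hr z - z‖ ≤ 3 * (1 - r) * ‖z‖ := by
  have h0 : 0 ≤ 1 - r := by linarith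
  refine (sq_le_sq₀ (norm_nonneg _) (by positivity)).1 ?_
  have h1 : (delta r hr z - z : Phase d).fst = (r ^ 3 - 1) • z.fst := by
    rw [sub_smul, one_smul]; rfl
  have h2 : (delta r hr z - z : Phase d).snd = (r - 1) • z.snd := by
    rw [sub_smul, one_smul]; rfl
  rw [mul_pow, norm_sq_phase, norm_sq_phase, h1, h2, norm_smul, norm_smul, mul_pow, mul_pow,
    mul_add, Real.norm_eq_abs, Real.norm_eq_abs, sq_abs, sq_abs]
  have h3 : r ^ 3 ≤ 1 := pow_le_one₀ hr.le h
  gcongr ?_ * _ + ?_ * _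
  · rw [← neg_sq (r ^ 3 - 1)]
    refine pow_le_pow_left₀ (by linarith) ?_ 2
    nlinarith [sq_nonneg (1 - r), sq_nonneg r]
  · nlinarith

/-- The mean value inequality for the argument and Bernoulli's inequality for the Jacobian. The
restriction r ≥ 5/6 keeps δ_r y within |y|/2 of y, where the weight at y is comparable to the weight
on the segment. -/
theorem exists_weightedL1_scale_delta_sub_le (m : ℕ) (G : 𝓢(Phase d, ℂ)) :
    ∃ C : ℝ, 0 ≤ C ∧ ∀ (r : ℝ) (hr : 0 < r), 5 / 6 ≤ r → r ≤ 1 →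
      weightedL1 m (scale (delta r hr) G - G) ≤ C * (1 - r) := by
  set D := Module.finrank ℝ (Phase d)
  -- The gradient must absorb the weight of order `m`, the factor |y| of the displacement, and `D +
  -- 1` powers for integrability in dimension `D`.
  obtain ⟨K, hK, h⟩ := exists_one_add_norm_pow_mul_iteratedFDeriv_le G (m + 1 + (D + 1)) 1
  set w : Phase d → ℝ := fun y => (1 + ‖y‖) ^ (-((D : ℝ) + 1))
  have hw : Integrable w := integrable_one_add_norm (by simp [D])
  have hw0 : 0 ≤ ∫ y, w y := integral_nonneg fun y => by positivity
  have hG := weightedL1_nonneg m G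
  set P : ℝ := 2 ^ (m + 1 + (D + 1))
  refine ⟨K * P * 3 * (∫ y, w y) + 4 * d * weightedL1 m G, by positivity, fun r hr hr1 hr2 => ?_⟩
  have h0 : 0 ≤ 1 - r := by linarith
  have hpt (y : Phase d) : (1 + ‖y‖) ^ m * ‖(scale (delta r hr) G - G) y‖ ≤
      K * P * 3 * (1 - r) * w y + 4 * d * (1 - r) * ((1 + ‖y‖) ^ m * ‖G y‖) := by
    have hLy := norm_delta_sub_le hr hr2 y
    have hy := norm_nonneg y
    have hmv : ‖G (delta r hr y) - G y‖ ≤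
        K * (P * ((1 + ‖y‖) ^ (m + 1 + (D + 1)))⁻¹) * ‖delta r hr y - y‖ := by
      refine Convex.norm_image_sub_le_of_norm_fderiv_le (𝕜 := ℝ)
        (s := Metric.closedBall y (‖y‖ / 2)) (fun x _ => G.differentiableAt) (fun x hx => ?_)
        (convex_closedBall _ _) (Metric.mem_closedBall_self (by positivity)) ?_
      · rw [mem_closedBall_iff_norm] at hx
        have h2 : 1 + ‖y‖ ≤ 2 * (1 + ‖x‖) := by
          have := norm_sub_norm_le y x
          rw [norm_sub_rev] at this
          linarith
        have h3 := h x
        rw [norm_iteratedFDeriv_one] at h3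
        have h4 : (1 + ‖y‖) ^ (m + 1 + (D + 1)) ≤ P * (1 + ‖x‖) ^ (m + 1 + (D + 1)) := by
          rw [← mul_pow]
          gcongr
        rw [← div_eq_mul_inv, mul_div_assoc', le_div_iff₀ (by positivity)]
        calc ‖fderiv ℝ G x‖ * (1 + ‖y‖) ^ (m + 1 + (D + 1))
            ≤ ‖fderiv ℝ G x‖ * (P * (1 + ‖x‖) ^ (m + 1 + (D + 1))) := by gcongr
          _ = P * ((1 + ‖x‖) ^ (m + 1 + (D + 1)) * ‖fderiv ℝ G x‖) := by ring
          _ ≤ P * K := by gcongr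
          _ = K * P := by ring
      · rw [mem_closedBall_iff_norm]
        refine hLy.trans ?_
        nlinarith
    have hdet : |r ^ (4 * d) - 1| ≤ 4 * d * (1 - r) := by
      have h1 := one_add_mul_le_pow (a := r - 1) (by linarith) (4 * d)
      have h2 : r ^ (4 * d) ≤ 1 := pow_le_one₀ hr.le hr2
      rw [abs_of_nonpos (by linarith)]
      push_cast at h1
      rw [add_sub_cancel] at h1
      nlinarith
    have hdet1 : r ^ (4 * d) ≤ 1 := pow_le_one₀ hr.le hr2
    have hsub : (scale (delta r hr) G - G) y =
        (r ^ (4 * d) : ℝ) • (G (delta r hr y) - G y) + (r ^ (4 * d) - 1 : ℝ) • G y := by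
      rw [sub_apply, scale_apply, absDet_delta]
      simp only [Complex.real_smul]
      push_cast
      ring
    have hww : (1 + ‖y‖) ^ m * (((1 + ‖y‖) ^ (m + 1 + (D + 1)))⁻¹ * ‖y‖) ≤ w y := by
      have e : w y = ((1 + ‖y‖) ^ (D + 1))⁻¹ := by
        simp only [w]
        rw [Real.rpow_neg (by positivity), ← Real.rpow_natCast]
        push_cast
        rfl
      have hp : (0 : ℝ) < 1 + ‖y‖ := by positivity
      rw [e, pow_add, pow_add, pow_one, mul_inv, mul_inv]
      calc (1 + ‖y‖) ^ m * (((1 + ‖y‖) ^ m)⁻¹ * (1 + ‖y‖)⁻¹ * ((1 + ‖y‖) ^ (D + 1))⁻¹ * ‖y‖)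
          = ((1 + ‖y‖) ^ m * ((1 + ‖y‖) ^ m)⁻¹) * ((1 + ‖y‖)⁻¹ * ‖y‖) *
            ((1 + ‖y‖) ^ (D + 1))⁻¹ := by ring
        _ ≤ 1 * 1 * ((1 + ‖y‖) ^ (D + 1))⁻¹ := by
            rw [mul_inv_cancel₀ (by positivity)]
            gcongr
            rw [inv_mul_le_iff₀ hp]
            linarith
        _ = _ := by ring
    calc (1 + ‖y‖) ^ m * ‖(scale (delta r hr) G - G) y‖
        ≤ (1 + ‖y‖) ^ m * (1 * (K * (P * ((1 + ‖y‖) ^ (m + 1 + (D + 1)))⁻¹) *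
            (3 * (1 - r) * ‖y‖)) + 4 * d * (1 - r) * ‖G y‖) := by
          rw [hsub]
          gcongr
          refine (norm_add_le _ _).trans ?_
          rw [norm_smul, norm_smul, Real.norm_of_nonneg (by positivity), Real.norm_eq_abs]
          gcongr
          exact hmv.trans (by gcongr)
      _ = K * P * 3 * (1 - r) * ((1 + ‖y‖) ^ m * (((1 + ‖y‖) ^ (m + 1 + (D + 1)))⁻¹ * ‖y‖)) +
            4 * d * (1 - r) * ((1 + ‖y‖) ^ m * ‖G y‖) := by ring
      _ ≤ _ := by gcongr
  have hGi := integrable_one_add_norm_pow_mul_norm G m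
  calc weightedL1 m (scale (delta r hr) G - G)
      ≤ ∫ y, (K * P * 3 * (1 - r) * w y + 4 * d * (1 - r) * ((1 + ‖y‖) ^ m * ‖G y‖)) :=
        integral_mono (integrable_one_add_norm_pow_mul_norm _ m)
          ((hw.const_mul _).add (hGi.const_mul _)) hpt
    _ = _ := by
        rw [integral_add (hw.const_mul _) (hGi.const_mul _), integral_const_mul,
          integral_const_mul]
        unfold weightedL1
        ring

theorem exists_derivL1_scale_delta_sub_le (m n : ℕ) (G : 𝓢(Phase d, ℂ)) :
    ∃ C : ℝ, 0 ≤ C ∧ ∀ (r : ℝ) (hr : 0 < r), 5 / 6 ≤ r → r ≤ 1 →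
      derivL1 m n (scale (delta r hr) G - G) ≤ C * (1 - r) := by
  induction n generalizing G with
  | zero =>
    simp only [derivL1_zero]
    exact exists_weightedL1_scale_delta_sub_le m G
  | succ n ih =>
    set e := stdOrthonormalBasis ℝ (Phase d)
    choose C hC h using fun k => ih (∂_{e k} G)
    set K : ℝ := ((1 + 6 / 5) ^ 3) ^ m
    have hD := derivL1_nonneg m (n + 1) G
    have hsum : 0 ≤ ∑ k, (C k + K * (3 * derivL1 m (n + 1) G)) :=
      Finset.sum_nonneg fun k _ => by have := hC k; positivity
    refine ⟨_, hsum, fun r hr hr1 hr2 => ?_⟩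
    rw [Finset.sum_mul]
    refine (derivL1_succ_le_sum _ _ _).trans (Finset.sum_le_sum fun k _ => ?_)
    -- Differentiation does not commute with the dilation; the commutator is a derivative along δ_r
    -- e_k - e_k, whose length is at most 3(1-r).
    have hdec : (∂_{e k} (scale (delta r hr) G - G) : 𝓢(Phase d, ℂ)) =
        (scale (delta r hr) (∂_{e k} G) - ∂_{e k} G) +
          scale (delta r hr) (∂_{delta r hr (e k) - e k} G) := by
      have h1 : (∂_{delta r hr (e k) - e k} G : 𝓢(Phase d, ℂ)) =
          ∂_{delta r hr (e k)} G - ∂_{e k} G := by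
        rw [sub_eq_add_neg, lineDerivOp_left_add, LineDeriv.lineDerivOp_left_neg, sub_eq_add_neg]
      have h2 : (∂_{e k} (scale (delta r hr) G - G) : 𝓢(Phase d, ℂ)) =
          ∂_{e k} (scale (delta r hr) G) - ∂_{e k} G :=
        map_sub (lineDerivOpCLM ℂ 𝓢(Phase d, ℂ) (e k)) _ _
      rw [h2, lineDeriv_scale, h1, map_sub]
      abel
    have hn1 : ‖((delta r hr : Phase d ≃L[ℝ] Phase d) : Phase d →L[ℝ] Phase d)‖ ≤ 1 :=
      (norm_delta_le_of_le_one r hr hr2).trans hr2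
    have hn2 : ‖(((delta r hr : Phase d ≃L[ℝ] Phase d).symm :
        Phase d ≃L[ℝ] Phase d) : Phase d →L[ℝ] Phase d)‖ ≤ (1 + 6 / 5) ^ 3 := by
      rw [delta_symm]
      refine norm_delta_le _ _ _ ?_
      rw [inv_le_comm₀ hr (by norm_num)]
      linarith
    have hv : ‖delta r hr (e k) - e k‖ ≤ 3 * (1 - r) := by
      have := norm_delta_sub_le hr hr2 (e k)
      rwa [e.orthonormal.1 k, mul_one] at this
    rw [hdec]
    calc _ ≤ derivL1 m n (scale (delta r hr) (∂_{e k} G) - ∂_{e k} G) +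
          derivL1 m n (scale (delta r hr) (∂_{delta r hr (e k) - e k} G)) := derivL1_add_le _ _ _ _
      _ ≤ C k * (1 - r) + K * 1 ^ n * (3 * (1 - r) * derivL1 m (n + 1) G) := by
          refine add_le_add (h k r hr hr1 hr2) ?_
          refine (derivL1_scale_le _ _ _ _).trans ?_
          have hd0 := derivL1_nonneg m n (∂_{delta r hr (e k) - e k} G)
          refine mul_le_mul (mul_le_mul ?_ ?_ (by positivity) (by positivity)) ?_ hd0
            (by positivity)
          · exact pow_le_pow_left₀ (by positivity) (max_le (by norm_num) hn2) m
          · exact pow_le_pow_left₀ (norm_nonneg _) hn1 n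
          · exact (derivL1_lineDeriv_le _ _ _ _).trans (by gcongr)
      _ = _ := by rw [one_pow]; ring

/-- With r = √(t/s), the difference p_s - p_t is a rescaling of δ_r p_1 - p_1, which is of order 1-r
together with its derivatives; the annular cancellation applies to it as before. -/
theorem IsBlockSeq.exists_sconv_kinKernel_sub_le {A : ℕ → 𝓢(Phase d, ℂ)} (hA : IsBlockSeq A)
    (m : ℕ) {T : ℝ} (hT : 0 < T) :
    ∃ C : ℝ, 0 ≤ C ∧ ∀ (t s : ℝ) (ht : 0 < t) (hs : 0 < s), t ≤ s → s ≤ T → ∀ l : ℕ,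
      weightedL1 m (sconv (A l) (kinKernel s hs - kinKernel t ht)) ≤
        C * min 1 ((s - t) / t) * decay (4 ^ l * t) := by
  obtain ⟨C₁, hC₁, h₁⟩ := hA.exists_sconv_kinKernel_le m hT
  obtain ⟨C₂, hC₂, h₂⟩ := hA.exists_weightedL1_sconv_le m (Real.sqrt_pos.2 hT)
  obtain ⟨C₃, hC₃, h₃⟩ := exists_derivL1_scale_delta_sub_le m 0 (kinKernel 1 one_pos : 𝓢(Phase d, ℂ))
  obtain ⟨C₄, hC₄, h₄⟩ := exists_derivL1_scale_delta_sub_le m 4 (kinKernel 1 one_pos : 𝓢(Phase d, ℂ))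
  refine ⟨10 * C₁ + C₂ * (C₃ + C₄), by positivity, fun t s ht hs hts hsT l => ?_⟩
  have hdt : 0 < decay (4 ^ l * t) := decay_pos (by positivity)
  have hx : 0 ≤ (s - t) / t := div_nonneg (by linarith) ht.le
  set r : ℝ := √t * (√s)⁻¹ with hr
  have hst := Real.sqrt_pos.2 ht
  have hss := Real.sqrt_pos.2 hs
  have hr0 : 0 < r := by positivity
  have hr1 : r ≤ 1 := by
    rw [hr, ← div_eq_mul_inv, div_le_one hss]
    exact Real.sqrt_le_sqrt hts
  -- If r < 5/6, then (s-t)/t is bounded below and the triangle inequality is enough.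
  by_cases hc : r < 5 / 6
  · have hx1 : (1 : ℝ) ≤ 5 * ((s - t) / t) := by
      have h5 : √t < 5 / 6 * √s := by
        rwa [hr, ← div_eq_mul_inv, div_lt_iff₀ hss] at hc
      have h6 : t < (5 / 6) ^ 2 * s := by
        have := pow_lt_pow_left₀ h5 hst.le two_ne_zero
        rwa [mul_pow, Real.sq_sqrt ht.le, Real.sq_sqrt hs.le] at this
      rw [mul_div_assoc', le_div_iff₀ ht]
      linarith
    have hmin : (1 : ℝ) ≤ 5 * min 1 ((s - t) / t) := by
      rcases min_cases 1 ((s - t) / t) with h | h <;> rw [h.1] <;> linarith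
    have hsub : sconv (A l) (kinKernel s hs - kinKernel t ht) =
        sconv (A l) (kinKernel s hs) - sconv (A l) (kinKernel t ht) := by
      unfold sconv; rw [map_sub]
    rw [hsub]
    calc _ ≤ weightedL1 m (sconv (A l) (kinKernel s hs)) +
          weightedL1 m (sconv (A l) (kinKernel t ht)) := weightedL1_sub_le _ _ _
      _ ≤ C₁ * decay (4 ^ l * t) + C₁ * decay (4 ^ l * t) := by
          refine add_le_add ((h₁ s hs hsT l).trans ?_) (h₁ t ht (hts.trans hsT) l)
          gcongr
          exact decay_anti (by positivity) (by gcongr)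
      _ = 2 * C₁ * decay (4 ^ l * t) * 1 := by ring
      _ ≤ 2 * C₁ * decay (4 ^ l * t) * (5 * min 1 ((s - t) / t)) := by gcongr
      _ = 10 * C₁ * min 1 ((s - t) / t) * decay (4 ^ l * t) := by ring
      _ ≤ _ := by
          have : 0 ≤ min 1 ((s - t) / t) := le_min zero_le_one hx
          gcongr
          exact le_add_of_nonneg_right (by positivity)
  · push Not at hc
    have he : (kinKernel s hs - kinKernel t ht : 𝓢(Phase d, ℂ)) =
        scale (delta (√t)⁻¹ (inv_pos.2 hst))
          (scale (delta r hr0) (kinKernel 1 one_pos) - kinKernel 1 one_pos) := by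
      rw [map_sub, scale_scale, ← kinKernel_eq_scale t ht, kinKernel_eq_scale s hs, delta_trans]
      congr 4
      rw [hr, ← mul_assoc, inv_mul_cancel₀ hst.ne', one_mul]
    -- Since r²s = t and r² ≤ r, one has s-t = (1-r²)s ≥ (1-r)s ≥ (1-r)t.
    have h1r : 1 - r ≤ min 1 ((s - t) / t) := by
      refine le_min (by linarith) ?_
      rw [le_div_iff₀ ht]
      have hr2 : r ^ 2 * s = t := by
        rw [hr, mul_pow, inv_pow, Real.sq_sqrt ht.le, Real.sq_sqrt hs.le]
        field_simp
      have h7 : r ^ 2 ≤ r := by nlinarith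
      have h8 : (1 - r) * t ≤ (1 - r) * s := by gcongr
      nlinarith
    have h5 := h₂ (scale (delta r hr0) (kinKernel 1 one_pos) - kinKernel 1 one_pos) (√t) hst
      (Real.sqrt_le_sqrt (hts.trans hsT)) l
    rw [Real.sq_sqrt ht.le] at h5
    rw [he]
    calc _ ≤ _ := h5
      _ ≤ C₂ * decay (4 ^ l * t) * (C₃ * (1 - r) + C₄ * (1 - r)) := by
          gcongr
          · exact h₃ r hr0 hc hr1
          · exact h₄ r hr0 hc hr1
      _ = C₂ * (C₃ + C₄) * (1 - r) * decay (4 ^ l * t) := by ring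
      _ ≤ C₂ * (C₃ + C₄) * min 1 ((s - t) / t) * decay (4 ^ l * t) := by gcongr
      _ ≤ _ := by
          have : 0 ≤ min 1 ((s - t) / t) := le_min zero_le_one hx
          gcongr
          exact le_add_of_nonneg_left (by positivity)

/-! ## Bounds for the kinetic semigroup -/

theorem integral_comp_sub_left {E F : Type*} [NormedAddCommGroup E] [InnerProductSpace ℝ E]
    [FiniteDimensional ℝ E] [MeasurableSpace E] [BorelSpace E] [NormedAddCommGroup F]
    [NormedSpace ℝ F] (f : E → F) (z : E) : ∫ x, f (z - x) = ∫ x, f x :=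
  integral_sub_left_eq_self f volume z

/-! ### Dyadic sums. -/

theorem summable_rpow_natAbs {ε : ℝ} (hε : 0 < ε) :
    Summable fun k : ℤ => (2 : ℝ) ^ ε * ((2 : ℝ) ^ (-ε)) ^ k.natAbs := by
  refine Summable.mul_left _ ?_
  have h : Summable fun n : ℕ => ((2 : ℝ) ^ (-ε)) ^ n :=
    summable_geometric_of_lt_one (by positivity)
      (Real.rpow_lt_one_of_one_lt_of_neg one_lt_two (by linarith))
  refine Summable.of_nat_of_neg ?_ ?_
  · simpa using h
  · simpa using h

/-- A two-sided geometric series centred at the dyadic scale of 1/y. The factor 2^ε pays for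
replacing `y` by a power of 2, which makes the bound independent of `y`. -/
theorem exists_sum_min_rpow_le {ε : ℝ} (hε : 0 < ε) :
    ∃ C : ℝ, 0 ≤ C ∧ ∀ (y : ℝ), 0 < y → ∀ n : ℕ,
      ∑ l ∈ Finset.range n, min ((2 ^ l * y) ^ ε) ((2 ^ l * y) ^ (-ε)) ≤ C := by
  set a : ℤ → ℝ := fun k => (2 : ℝ) ^ ε * ((2 : ℝ) ^ (-ε)) ^ k.natAbs
  have ha : Summable a := summable_rpow_natAbs hε
  have ha0 (k) : 0 ≤ a k := by positivity
  refine ⟨∑' k, a k, tsum_nonneg ha0, fun y hy n => ?_⟩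
  obtain ⟨N, hN1, hN2⟩ := exists_mem_Ico_zpow hy one_lt_two
  have hinj : Function.Injective fun l : ℕ => (l : ℤ) + N := fun i j h => by
    simpa using h
  refine le_trans (Finset.sum_le_sum (g := fun l : ℕ => a ((l : ℤ) + N)) fun l _ => ?_) ?_
  · have h1 : (2 : ℝ) ^ ((l : ℤ) + N) ≤ 2 ^ l * y := by
      rw [zpow_add₀ two_ne_zero, zpow_natCast]
      gcongr
    have h2 : 2 ^ l * y ≤ (2 : ℝ) ^ ((l : ℤ) + N + 1) := by
      rw [add_assoc, zpow_add₀ two_ne_zero, zpow_natCast]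
      gcongr
    rcases le_total 0 ((l : ℤ) + N) with hk | hk
    · refine (min_le_right _ _).trans ?_
      obtain ⟨k, hk'⟩ := Int.eq_ofNat_of_zero_le hk
      rw [hk', zpow_natCast] at h1
      simp only [a, hk', Int.natAbs_natCast]
      calc (2 ^ l * y) ^ (-ε) ≤ ((2 : ℝ) ^ k) ^ (-ε) :=
            Real.rpow_le_rpow_of_nonpos (by positivity) h1 (by linarith)
        _ = ((2 : ℝ) ^ (-ε)) ^ k := by
            rw [← Real.rpow_natCast, ← Real.rpow_natCast, ← Real.rpow_mul (by norm_num),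
              ← Real.rpow_mul (by norm_num), mul_comm]
        _ ≤ _ := le_mul_of_one_le_left (by positivity) (Real.one_le_rpow one_le_two hε.le)
    · refine (min_le_left _ _).trans ?_
      obtain ⟨k, hk'⟩ := Int.eq_ofNat_of_zero_le (neg_nonneg.2 hk)
      have hk'' : (l : ℤ) + N = -k := by omega
      rw [hk''] at h2
      simp only [a, hk'', Int.natAbs_neg, Int.natAbs_natCast]
      calc (2 ^ l * y) ^ ε ≤ ((2 : ℝ) ^ (-(k : ℤ) + 1)) ^ ε :=
            Real.rpow_le_rpow (by positivity) h2 hε.le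
        _ = _ := by
            rw [zpow_add₀ two_ne_zero, zpow_one, Real.mul_rpow (by positivity) (by norm_num),
              zpow_neg, zpow_natCast, mul_comm, Real.inv_rpow (by positivity),
              Real.rpow_neg (by norm_num), inv_pow, ← Real.rpow_natCast, ← Real.rpow_natCast,
              ← Real.rpow_mul (by norm_num), ← Real.rpow_mul (by norm_num), mul_comm ε]
  · have h3 : Summable fun l : ℕ => a ((l : ℤ) + N) := ha.comp_injective hinj
    exact (h3.sum_le_tsum _ fun l _ => ha0 _).trans
      (tsum_comp_le_tsum_of_inj ha ha0 hinj)

/-- With x = 2^l√t a summand is t^{-β/2} times x^β(1+x²)^{-2}: low frequencies are summable since β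
> 0, high ones since β < 4. -/
theorem exists_sum_mul_decay_le {β : ℝ} (h0 : 0 < β) (h4 : β < 4) :
    ∃ C : ℝ, 0 ≤ C ∧ ∀ (t : ℝ), 0 < t → ∀ n : ℕ,
      ∑ l ∈ Finset.range n, (2 : ℝ) ^ (β * l) * decay (4 ^ l * t) ≤ C * t ^ (-(β / 2)) := by
  obtain ⟨C, hC, h⟩ := exists_sum_min_rpow_le (lt_min h0 (sub_pos.2 h4))
  set ε := min β (4 - β)
  refine ⟨C, hC, fun t ht n => ?_⟩
  have hs := Real.sqrt_pos.2 ht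
  have hst : t ^ (-(β / 2)) = (√t) ^ (-β) := by
    rw [Real.sqrt_eq_rpow, ← Real.rpow_mul ht.le]
    congr 1
    ring
  rw [hst]
  refine le_trans (Finset.sum_le_sum fun l _ => ?_)
    ((Finset.sum_mul _ _ _).symm.le.trans (mul_le_mul_of_nonneg_right (h (√t) hs n) (by positivity)))
  set x : ℝ := 2 ^ l * √t with hx
  have hx0 : 0 < x := by positivity
  have e1 : (4 : ℝ) ^ l * t = x ^ 2 := by
    rw [hx, mul_pow, Real.sq_sqrt ht.le, ← pow_mul, mul_comm l 2, pow_mul]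
    norm_num
  have e2 : (2 : ℝ) ^ (β * l) = x ^ β * (√t) ^ (-β) := by
    rw [hx, Real.mul_rpow (by positivity) hs.le, mul_assoc, ← Real.rpow_add hs, add_neg_cancel,
      Real.rpow_zero, mul_one, mul_comm β, Real.rpow_mul (by norm_num), Real.rpow_natCast]
  rw [e1, e2, mul_right_comm]
  gcongr
  have hd1 : decay (x ^ 2) ≤ 1 := by
    unfold decay
    exact inv_le_one_of_one_le₀ (one_le_pow₀ (by nlinarith))
  have hd2 : decay (x ^ 2) ≤ x ^ (-4 : ℝ) := by
    refine (decay_le_inv_sq (by positivity)).trans (le_of_eq ?_)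
    rw [← pow_mul, Real.rpow_neg hx0.le]
    norm_num
  have hd0 : 0 < decay (x ^ 2) := decay_pos (by positivity)
  have h5 : x ^ β * decay (x ^ 2) ≤ x ^ β := mul_le_of_le_one_right (by positivity) hd1
  have h6 : x ^ β * decay (x ^ 2) ≤ x ^ (-(4 - β)) := by
    calc x ^ β * decay (x ^ 2) ≤ x ^ β * x ^ (-4 : ℝ) := by gcongr
      _ = _ := by rw [← Real.rpow_add hx0]; congr 1; ring
  have hε1 : ε ≤ β := min_le_left _ _
  have hε2 : ε ≤ 4 - β := min_le_right _ _
  have hε0 : 0 < ε := lt_min h0 (sub_pos.2 h4)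
  rcases le_total x 1 with h1 | h1
  · have h7 : x ^ β ≤ x ^ ε := Real.rpow_le_rpow_of_exponent_ge hx0 h1 hε1
    have h8 : x ^ ε ≤ x ^ (-ε) := Real.rpow_le_rpow_of_exponent_ge hx0 h1 (by linarith)
    exact le_min (h5.trans h7) ((h5.trans h7).trans h8)
  · have h7 : x ^ (-(4 - β)) ≤ x ^ (-ε) := Real.rpow_le_rpow_of_exponent_le h1 (by linarith)
    have h8 : x ^ (-ε) ≤ x ^ ε := Real.rpow_le_rpow_of_exponent_le h1 (by linarith)
    exact le_min ((h6.trans h7).trans h8) (h6.trans h7)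

/-- The blocks of `g` are bounded by `2^{β l} M` in the weighted `L^∞` norm. -/
def BlkBound (φ : DyadicCutoff d) (κ β M : ℝ) (g : 𝓢'(Phase d, ℂ)) : Prop :=
  0 ≤ M ∧ ∀ l z, weight κ z * ‖blkFun φ g l z‖ ≤ (2 : ℝ) ^ (β * l) * M

theorem exists_conv_kinKernel_le (φ : DyadicCutoff d) (κ : ℝ) {β T : ℝ} (h0 : 0 < β) (h4 : β < 4)
    (hT : 0 < T) : ∃ C : ℝ, 0 ≤ C ∧ ∀ (g : 𝓢'(Phase d, ℂ)) (M : ℝ), BlkBound φ κ β M g →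
      ∀ (t : ℝ) (ht : 0 < t), t ≤ T → ∀ z,
        weight κ z * ‖conv (kinKernel t ht) g z‖ ≤ C * t ^ (-(β / 2)) * M := by
  obtain ⟨C₁, hC₁, h₁⟩ := (isBlockSeq_fat φ).exists_sconv_kinKernel_le ⌈|κ|⌉₊ hT
  obtain ⟨C₂, hC₂, h₂⟩ := exists_sum_mul_decay_le h0 h4
  refine ⟨2 ^ (|κ| / 2) * (C₁ * C₂), by positivity, fun g M hg t ht htT z => ?_⟩
  refine (weight_mul_norm_conv_le φ (B := C₁ * (C₂ * t ^ (-(β / 2)))) hg.1 hg.2 (fun n => ?_)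
    z).trans (le_of_eq (by ring))
  calc _ ≤ ∑ l ∈ Finset.range n, C₁ * ((2 : ℝ) ^ (β * l) * decay (4 ^ l * t)) := by
        refine Finset.sum_le_sum fun l _ => ?_
        rw [mul_left_comm]
        gcongr
        exact h₁ t ht htT l
    _ ≤ _ := by
        rw [← Finset.mul_sum]
        gcongr
        exact h₂ t ht n

theorem exists_conv_kinKernel_sub_le (φ : DyadicCutoff d) (κ : ℝ) {β T : ℝ} (h0 : 0 < β)
    (h4 : β < 4) (hT : 0 < T) :
    ∃ C : ℝ, 0 ≤ C ∧ ∀ (g : 𝓢'(Phase d, ℂ)) (M : ℝ), BlkBound φ κ β M g →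
      ∀ (t s : ℝ) (ht : 0 < t) (hs : 0 < s), t ≤ s → s ≤ T → ∀ z,
        weight κ z * ‖conv (kinKernel s hs) g z - conv (kinKernel t ht) g z‖ ≤
          C * (min 1 ((s - t) / t) * t ^ (-(β / 2))) * M := by
  obtain ⟨C₁, hC₁, h₁⟩ := (isBlockSeq_fat φ).exists_sconv_kinKernel_sub_le ⌈|κ|⌉₊ hT
  obtain ⟨C₂, hC₂, h₂⟩ := exists_sum_mul_decay_le h0 h4
  refine ⟨2 ^ (|κ| / 2) * (C₁ * C₂), by positivity, fun g M hg t s ht hs hts hsT z => ?_⟩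
  have hmin : 0 ≤ min 1 ((s - t) / t) := le_min zero_le_one (div_nonneg (by linarith) ht.le)
  have hsub : conv (kinKernel s hs) g z - conv (kinKernel t ht) g z =
      conv (kinKernel s hs - kinKernel t ht) g z := by
    unfold conv reflectAt
    rw [map_sub, map_sub]
    exact (map_sub (g : 𝓢(Phase d, ℂ) →L[ℂ] ℂ) _ _).symm
  rw [hsub]
  refine (weight_mul_norm_conv_le φ (B := C₁ * min 1 ((s - t) / t) * (C₂ * t ^ (-(β / 2))))
    hg.1 hg.2 (fun n => ?_) z).trans (le_of_eq (by ring))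
  calc _ ≤ ∑ l ∈ Finset.range n, C₁ * min 1 ((s - t) / t) *
        ((2 : ℝ) ^ (β * l) * decay (4 ^ l * t)) := by
        refine Finset.sum_le_sum fun l _ => ?_
        rw [mul_left_comm]
        gcongr
        exact h₁ t s ht hs hts hsT l
    _ ≤ _ := by
        rw [← Finset.mul_sum]
        gcongr
        exact h₂ t ht n

/-- Associativity of convolution with a distribution, again by interchanging `g` with the integral
over w. -/
theorem integral_conv_mul_reflect (P G : 𝓢(Phase d, ℂ)) (g : 𝓢'(Phase d, ℂ)) (z : Phase d) :
    ∫ w, conv P g w * G (z - w) = conv (sconv G P) g z := by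
  set Q : 𝓢(Phase d, ℂ) := reflectAt 0 P
  have h1 (w : Phase d) : reflectAt w P = translate w Q := by
    ext y
    rw [reflectAt_apply]
    change _ = Q (y - w)
    rw [reflectAt_apply, zero_sub, neg_sub]
  have h2 := integral_mul_translate g (reflectAt z G) Q
  have h3 : sconv (reflectAt z G) Q = reflectAt z (sconv G P) := by
    ext x
    rw [reflectAt_apply, sconv_apply, sconv_apply, ← integral_comp_sub_left _ z]
    refine integral_congr_ae (Filter.Eventually.of_forall fun y => ?_)
    simp only [Q, reflectAt_apply]
    congr 2 <;> abel
  unfold conv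
  rw [← h3, h2.symm]
  refine integral_congr_ae (Filter.Eventually.of_forall fun w => ?_)
  simp only [h1, reflectAt_apply]
  exact mul_comm _ _

theorem kinSemigroup_of_pos {t : ℝ} (ht : 0 < t) (g : 𝓢'(Phase d, ℂ)) (z : Phase d) :
    kinSemigroup t g z = conv (kinKernel t ht) g (transport t z) := dif_pos ht

/-- The change of variables w = Γ_t y, which preserves volume, shears the test kernel by Γ_{-t} and
moves the evaluation point to Γ_t z. -/
theorem integral_kinSemigroup_mul {t : ℝ} (ht : 0 < t) (g : 𝓢'(Phase d, ℂ)) (K : 𝓢(Phase d, ℂ))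
    (z : Phase d) : ∫ y, kinSemigroup t g y * K (z - y) =
      conv (sconv (scale (transport (-t)) K) (kinKernel t ht)) g (transport t z) := by
  rw [← integral_conv_mul_reflect, ← integral_comp_transport t
    (fun w => conv (kinKernel t ht) g w * scale (transport (-t)) K (transport t z - w))]
  refine integral_congr_ae (Filter.Eventually.of_forall fun w => ?_)
  simp only [kinSemigroup_of_pos ht, scale_apply, absDet_transport, map_sub, transport_transport]
  simp [transport_zero_apply]

theorem exists_kinSemigroup_le (φ : DyadicCutoff d) (κ : ℝ) {β T : ℝ} (h0 : 0 < β) (h4 : β < 4)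
    (hT : 0 < T) : ∃ C : ℝ, 0 ≤ C ∧ ∀ (g : 𝓢'(Phase d, ℂ)) (M : ℝ), BlkBound φ κ β M g →
      ∀ t : ℝ, 0 < t → t ≤ T → ∀ z,
        weight κ z * ‖kinSemigroup t g z‖ ≤ C * t ^ (-(β / 2)) * M := by
  obtain ⟨C₁, hC₁, h₁⟩ := exists_conv_kinKernel_le φ κ h0 h4 hT
  obtain ⟨C₂, hC₂, h₂⟩ := exists_weight_transport_le (d := d) κ T
  refine ⟨C₂ * C₁, by positivity, fun g M hg t ht htT z => ?_⟩
  rw [kinSemigroup_of_pos ht]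
  calc _ ≤ C₂ * weight κ (transport t z) * ‖conv (kinKernel t ht) g (transport t z)‖ := by
        gcongr
        exact h₂ t (by rwa [abs_of_pos ht]) z
    _ = C₂ * (weight κ (transport t z) * ‖conv (kinKernel t ht) g (transport t z)‖) := by ring
    _ ≤ C₂ * (C₁ * t ^ (-(β / 2)) * M) :=
        mul_le_mul_of_nonneg_left (h₁ g M hg t ht htT _) (by positivity)
    _ = _ := by ring

theorem exists_integral_kinSemigroup_blk_le (φ : DyadicCutoff d) (κ : ℝ) {β T : ℝ} (h0 : 0 < β)
    (h4 : β < 4) (hT : 0 < T) :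
    ∃ C : ℝ, 0 ≤ C ∧ ∀ (g : 𝓢'(Phase d, ℂ)) (M : ℝ), BlkBound φ κ β M g →
      ∀ t : ℝ, 0 < t → t ≤ T → ∀ (k : ℕ) z,
        weight κ z * ‖∫ y, kinSemigroup t g y * blk φ k (z - y)‖ ≤
          C * (2 ^ (β * k) * decay (4 ^ k * t)) * M := by
  obtain ⟨C₁, hC₁, h₁⟩ := exists_sconv_transport_blk_kinKernel_le φ ⌈|κ|⌉₊ hT
  obtain ⟨C₂, hC₂, h₂⟩ := exists_sum_mul_decay_le h0 h4
  obtain ⟨C₃, hC₃, h₃⟩ := exists_weight_transport_le (d := d) κ T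
  refine ⟨C₃ * (2 ^ (|κ| / 2) * (C₁ * C₂)), by positivity, fun g M hg t ht htT k z => ?_⟩
  rw [integral_kinSemigroup_mul ht]
  have hd : 0 < decay ((4 : ℝ) ^ k * t) := decay_pos (by positivity)
  have h5 := weight_mul_norm_conv_le φ (B := C₁ * decay (4 ^ k * t) * (C₂ * 2 ^ (β * k)))
    (G := sconv (scale (transport (-t)) (blk φ k)) (kinKernel t ht))
    hg.1 hg.2 (fun n => ?_) (transport t z)
  · set X := conv (sconv (scale (transport (-t)) (blk φ k)) (kinKernel t ht)) g (transport t z)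
    calc _ ≤ C₃ * weight κ (transport t z) * ‖X‖ := by
          gcongr
          exact h₃ t (by rwa [abs_of_pos ht]) z
      _ = C₃ * (weight κ (transport t z) * ‖X‖) := by ring
      _ ≤ C₃ * (2 ^ (|κ| / 2) * (C₁ * decay (4 ^ k * t) * (C₂ * 2 ^ (β * k))) * M) := by gcongr
      _ = _ := by ring
  -- Since 4^l/4^k = 4^l · 4^{-k}, the dyadic sum is the one for the time 4^{-k}, and its value
  -- (4^{-k})^{-β/2} is 2^{βk}.
  · have e : ((4 : ℝ) ^ k)⁻¹ ^ (-(β / 2)) = 2 ^ (β * k) := by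
      rw [Real.inv_rpow (by positivity), Real.rpow_neg (by positivity), inv_inv,
        show (4 : ℝ) = 2 ^ 2 by norm_num, ← pow_mul, ← Real.rpow_natCast,
        ← Real.rpow_mul (by norm_num)]
      congr 1
      push_cast
      ring
    calc _ ≤ ∑ l ∈ Finset.range n, C₁ * decay (4 ^ k * t) *
          ((2 : ℝ) ^ (β * l) * decay (4 ^ l * ((4 : ℝ) ^ k)⁻¹)) := by
          refine Finset.sum_le_sum fun l _ => ?_
          rw [mul_left_comm]
          gcongr
          exact h₁ t ht htT l k
      _ ≤ _ := by
          rw [← Finset.mul_sum, ← e]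
          gcongr
          exact h₂ _ (by positivity) n

/-! ## Singular integrals in time -/

/-- L ≤ λ+1 costs the factor e^T, and e^{-Lτ} beats every power of Lτ. Using L instead of λ keeps
the bound meaningful at λ = 0. -/
theorem exists_exp_neg_mul_le {γ T : ℝ} (hγ : 0 ≤ γ) :
    ∃ C : ℝ, 0 ≤ C ∧ ∀ lam τ : ℝ, 0 ≤ lam → 0 < τ → τ ≤ T →
      Real.exp (-lam * τ) ≤ C * (max lam 1 * τ) ^ (-γ) * min 1 ((max lam 1)⁻¹ / τ) := by
  set N : ℕ := ⌈γ⌉₊ + 1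
  refine ⟨Real.exp T * (N.factorial * Real.exp 1), by positivity, fun lam τ hl hτ hτT => ?_⟩
  set L := max lam 1
  have hL1 : 1 ≤ L := le_max_right _ _
  have hL : 0 < L := by linarith
  set x := L * τ with hx
  have hx0 : 0 < x := by positivity
  have e1 : L⁻¹ / τ = x⁻¹ := by rw [hx, mul_inv, div_eq_mul_inv]
  have h1 : Real.exp (-lam * τ) ≤ Real.exp T * Real.exp (-x) := by
    rw [← Real.exp_add]
    refine Real.exp_le_exp.2 ?_
    have h2 : L ≤ lam + 1 := max_le (by linarith) (by linarith)
    nlinarith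
  have h2 : x ^ γ * max 1 x ≤ (1 + x) ^ N := by
    rw [pow_succ]
    gcongr
    · calc x ^ γ ≤ (1 + x) ^ γ := by gcongr; linarith
        _ ≤ (1 + x) ^ (⌈γ⌉₊ : ℝ) :=
          Real.rpow_le_rpow_of_exponent_le (by linarith) (Nat.le_ceil _)
        _ = _ := Real.rpow_natCast _ _
    · exact max_le (by linarith) (by linarith)
  have h3 := Real.pow_div_factorial_le_exp (1 + x) (by positivity) N
  rw [div_le_iff₀ (by positivity), Real.exp_add] at h3
  have h4 : Real.exp (-x) * (x ^ γ * max 1 x) ≤ N.factorial * Real.exp 1 := by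
    calc Real.exp (-x) * (x ^ γ * max 1 x)
        ≤ Real.exp (-x) * (Real.exp 1 * Real.exp x * N.factorial) := by
          exact mul_le_mul_of_nonneg_left (h2.trans h3) (Real.exp_pos _).le
      _ = (Real.exp (-x) * Real.exp x) * (N.factorial * Real.exp 1) := by ring
      _ = _ := by rw [← Real.exp_add]; simp
  have h5 : x ^ (-γ) * min 1 x⁻¹ = (x ^ γ * max 1 x)⁻¹ := by
    rw [mul_inv (x ^ γ), Real.rpow_neg hx0.le]
    congr 1
    rcases le_total 1 x with h | h
    · rw [max_eq_right h, min_eq_right (inv_le_one_of_one_le₀ h)]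
    · rw [max_eq_left h, min_eq_left ((one_le_inv₀ hx0).2 h), inv_one]
  have h6 : 0 < x ^ γ * max 1 x := by positivity
  rw [e1, mul_assoc, h5, mul_assoc]
  refine h1.trans ?_
  gcongr
  rwa [← div_eq_mul_inv, le_div_iff₀ h6]

theorem lintegral_Ioc_rpow_le {a c : ℝ} (ha : 0 < a) (hc : 0 < c) :
    ∫⁻ τ in Ioc 0 a, ENNReal.ofReal (τ ^ (c - 1)) = ENNReal.ofReal (a ^ c / c) := by
  have hi : IntegrableOn (fun τ : ℝ => τ ^ (c - 1)) (Ioc 0 a) :=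
    (intervalIntegrable_iff_integrableOn_Ioc_of_le ha.le).1
      (intervalIntegral.intervalIntegrable_rpow' (by linarith))
  rw [← ofReal_integral_eq_lintegral_ofReal hi]
  · rw [← intervalIntegral.integral_of_le ha.le, integral_rpow (Or.inl (by linarith)),
      sub_add_cancel, Real.zero_rpow hc.ne', sub_zero]
  · filter_upwards [ae_restrict_mem measurableSet_Ioc] with τ hτ
    exact Real.rpow_nonneg hτ.1.le _

theorem lintegral_Ioi_rpow_le {a c : ℝ} (ha : 0 < a) (hc : 0 < c) :
    ∫⁻ τ in Ioi a, ENNReal.ofReal (τ ^ (-c - 1)) = ENNReal.ofReal (a ^ (-c) / c) := by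
  have hi : IntegrableOn (fun τ : ℝ => τ ^ (-c - 1)) (Ioi a) :=
    integrableOn_Ioi_rpow_of_lt (by linarith) ha
  rw [← ofReal_integral_eq_lintegral_ofReal hi]
  · rw [integral_Ioi_rpow_of_lt (by linarith) ha, sub_add_cancel, neg_div_neg_eq]
  · filter_upwards [ae_restrict_mem measurableSet_Ioi] with τ hτ
    exact Real.rpow_nonneg (ha.trans hτ).le _

/-- The function `τ^{b - ρ} min(1, (a/τ)^k)`. -/
def timeKernel (b ρ a : ℝ) (k : ℕ) (τ : ℝ) : ℝ := τ ^ (b - ρ) * min 1 ((a / τ) ^ k)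

theorem timeKernel_nonneg {b ρ a τ : ℝ} (k : ℕ) (ha : 0 ≤ a) (hτ : 0 ≤ τ) :
    0 ≤ timeKernel b ρ a k τ :=
  mul_nonneg (Real.rpow_nonneg hτ _) (le_min zero_le_one (by positivity))

theorem measurable_timeKernel (b ρ a : ℝ) (k : ℕ) : Measurable (timeKernel b ρ a k) := by
  unfold timeKernel
  fun_prop

/-- Splitting at τ = a: b > 0 gives integrability at zero, b < k at infinity. The exponent b - 1/p
makes both pieces scale like a^{bp}. -/
theorem lintegral_timeKernel_rpow_le {b p a : ℝ} {k : ℕ} (hp : 1 ≤ p) (hb : 0 < b) (hbk : b < k)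
    (ha : 0 < a) :
    ∫⁻ τ in Ioi 0, ENNReal.ofReal (timeKernel b p⁻¹ a k τ) ^ p ≤
      ENNReal.ofReal (((b * p)⁻¹ + ((k - b) * p)⁻¹) * a ^ (b * p)) := by
  have hp0 : 0 < p := by linarith
  have hk : 0 < (k : ℝ) - b := by linarith
  have e : Ioi (0 : ℝ) = Ioc 0 a ∪ Ioi a := (Ioc_union_Ioi_eq_Ioi ha.le).symm
  have hpow {τ x : ℝ} (hτ : 0 ≤ τ) (hx : timeKernel b p⁻¹ a k τ ≤ x) :
      ENNReal.ofReal (timeKernel b p⁻¹ a k τ) ^ p ≤ ENNReal.ofReal (x ^ p) := by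
    have h0 := timeKernel_nonneg (b := b) (ρ := p⁻¹) k ha.le hτ
    rw [ENNReal.ofReal_rpow_of_nonneg h0 hp0.le]
    gcongr
  have h1 : ∫⁻ τ in Ioc 0 a, ENNReal.ofReal (timeKernel b p⁻¹ a k τ) ^ p ≤
      ENNReal.ofReal (a ^ (b * p) / (b * p)) := by
    rw [← lintegral_Ioc_rpow_le ha (mul_pos hb hp0)]
    refine setLIntegral_mono' measurableSet_Ioc fun τ hτ => ?_
    refine (hpow hτ.1.le (x := τ ^ (b - p⁻¹)) ?_).trans (le_of_eq ?_)
    · exact mul_le_of_le_one_right (Real.rpow_nonneg hτ.1.le _) (min_le_left _ _)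
    · rw [← Real.rpow_mul hτ.1.le, sub_mul, inv_mul_cancel₀ hp0.ne']
  have h2 : ∫⁻ τ in Ioi a, ENNReal.ofReal (timeKernel b p⁻¹ a k τ) ^ p ≤
      ENNReal.ofReal (a ^ (k * p)) * ENNReal.ofReal (a ^ (-((k - b) * p)) / ((k - b) * p)) := by
    rw [← lintegral_Ioi_rpow_le ha (mul_pos hk hp0), ← lintegral_const_mul' _ _ ENNReal.ofReal_ne_top]
    refine setLIntegral_mono' measurableSet_Ioi fun τ hτ => ?_
    have hτ0 : 0 < τ := ha.trans hτ
    refine (hpow hτ0.le (x := τ ^ (b - p⁻¹) * (a / τ) ^ k) ?_).trans (le_of_eq ?_)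
    · unfold timeKernel
      gcongr
      exact min_le_right _ _
    · rw [← ENNReal.ofReal_mul (by positivity)]
      congr 1
      rw [Real.mul_rpow (by positivity) (by positivity), ← Real.rpow_mul hτ0.le,
        ← Real.rpow_natCast, ← Real.rpow_mul (by positivity), Real.div_rpow ha.le hτ0.le,
        sub_mul, inv_mul_cancel₀ hp0.ne', div_eq_mul_inv, ← Real.rpow_neg hτ0.le, mul_left_comm,
        ← Real.rpow_add hτ0]
      congr 2
      ring
  rw [e]
  refine (lintegral_union_le _ _ _).trans ((add_le_add h1 h2).trans (le_of_eq ?_))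
  rw [← ENNReal.ofReal_mul (by positivity), ← ENNReal.ofReal_add (by positivity) (by positivity)]
  congr 1
  rw [mul_div_assoc', ← Real.rpow_add ha]
  have : (k : ℝ) * p + -((k - b) * p) = b * p := by ring
  rw [this]
  field_simp

/-- Hölder's inequality with the exponent p conjugate to q, after reflecting s ↦ t - s and enlarging
to the half-line; q > 1 makes p finite, and q = ∞ gives p = 1. -/
theorem exists_lintegral_timeKernel_le {q : ℝ≥0∞} (hq : 1 < q) {b : ℝ} {k : ℕ} (hb : 0 < b)
    (hbk : b < k) :
    ∃ C : ℝ, 0 ≤ C ∧ ∀ (a t T : ℝ) (n : ℝ → ℝ), 0 < a → t ≤ T → Measurable n →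
      ∫⁻ s in Ioc 0 t, ENNReal.ofReal (timeKernel b (1 - (1 / q).toReal) a k (t - s)) * ‖n s‖ₑ ≤
        ENNReal.ofReal (C * a ^ b) * eLpNorm n q (volume.restrict (Icc 0 T)) := by
  set P := q.conjExponent with hP
  have hconj : q.HolderConjugate P := ENNReal.HolderConjugate.conjExponent hq.le
  have hconj' : P.HolderConjugate q := inferInstance
  have hsum : P⁻¹ + q⁻¹ = 1 := ENNReal.HolderConjugate.inv_add_inv_eq_one P q
  have hq0 : q ≠ 0 := (zero_lt_one.trans hq).ne'
  have hP1 : 1 ≤ P := by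
    rw [← ENNReal.inv_le_one, ← hsum]; exact le_self_add
  have hPtop : P ≠ ⊤ := by
    intro h
    rw [h, ENNReal.inv_top, zero_add, ENNReal.inv_eq_one] at hsum
    exact hq.ne' hsum
  set p := P.toReal with hp
  have hp1 : 1 ≤ p := by
    rw [hp, ← ENNReal.toReal_one]
    exact ENNReal.toReal_mono hPtop hP1
  have hp0 : 0 < p := by linarith
  have hpinv : 1 - (1 / q).toReal = p⁻¹ := by
    rw [hp, ← ENNReal.toReal_inv, one_div, sub_eq_iff_eq_add, ← ENNReal.toReal_add, hsum,
      ENNReal.toReal_one]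
    · exact ENNReal.inv_ne_top.2 (zero_lt_one.trans_le hP1).ne'
    · exact ENNReal.inv_ne_top.2 hq0
  rw [hpinv]
  have hk : 0 < (k : ℝ) - b := by linarith
  set D : ℝ := (b * p)⁻¹ + ((k - b) * p)⁻¹ with hD
  have hD0 : 0 < D := by positivity
  refine ⟨D ^ p⁻¹, by positivity, fun a t T n ha ht hn => ?_⟩
  set μ := volume.restrict (Ioc 0 t)
  -- The truncation at 0 matches the truncation in `ENNReal.ofReal`, so no sign has to be known for
  -- `s > t`.
  set K : ℝ → ℝ := fun s => max 0 (timeKernel b p⁻¹ a k (t - s))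
  have hKm : Measurable K :=
    measurable_const.max ((measurable_timeKernel _ _ _ _).comp (measurable_const.sub measurable_id))
  have h1 : ∫⁻ s in Ioc 0 t, ENNReal.ofReal (timeKernel b p⁻¹ a k (t - s)) * ‖n s‖ₑ =
      eLpNorm (K • n) 1 μ := by
    rw [eLpNorm_one_eq_lintegral_enorm]
    refine lintegral_congr fun s => ?_
    rw [Pi.smul_apply', smul_eq_mul, enorm_mul, Real.enorm_of_nonneg (le_max_left _ _),
      ENNReal.ofReal_max, ENNReal.ofReal_zero, max_eq_right (zero_le)]
  rw [h1]
  refine (eLpNorm_smul_le_mul_eLpNorm (p := P) (q := q) hn.aestronglyMeasurable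
    hKm.aestronglyMeasurable).trans ?_
  gcongr
  · rw [eLpNorm_eq_lintegral_rpow_enorm_toReal (zero_lt_one.trans_le hP1).ne' hPtop, ← hp]
    have h2 : ∫⁻ s, ‖K s‖ₑ ^ p ∂μ ≤ ENNReal.ofReal (D * a ^ (b * p)) := by
      refine le_trans ?_ (lintegral_timeKernel_rpow_le hp1 hb hbk ha)
      calc ∫⁻ s, ‖K s‖ₑ ^ p ∂μ
          = ∫⁻ s, (Ioc 0 t).indicator
              (fun s => ENNReal.ofReal (timeKernel b p⁻¹ a k (t - s)) ^ p) s := by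
            rw [lintegral_indicator measurableSet_Ioc]
            refine lintegral_congr fun s => ?_
            rw [Real.enorm_of_nonneg (le_max_left _ _), ENNReal.ofReal_max, ENNReal.ofReal_zero,
              max_eq_right zero_le]
        _ ≤ ∫⁻ s, (Ici 0).indicator
              (fun s => ENNReal.ofReal (timeKernel b p⁻¹ a k s) ^ p) (t - s) := by
            refine lintegral_mono fun s => ?_
            by_cases hs : s ∈ Ioc 0 t
            · rw [indicator_of_mem hs, indicator_of_mem (show t - s ∈ Ici 0 from sub_nonneg.2 hs.2)]
            · rw [indicator_of_notMem hs]; exact zero_le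
        _ = ∫⁻ s, (Ici 0).indicator
              (fun s => ENNReal.ofReal (timeKernel b p⁻¹ a k s) ^ p) s :=
            lintegral_sub_left_eq_self _ t
        _ = ∫⁻ s in Ioi 0, ENNReal.ofReal (timeKernel b p⁻¹ a k s) ^ p := by
            rw [lintegral_indicator measurableSet_Ici, Measure.restrict_congr_set Ioi_ae_eq_Ici]
    calc _ ≤ ENNReal.ofReal (D * a ^ (b * p)) ^ (1 / p) := by gcongr
      _ = _ := by
          rw [ENNReal.ofReal_rpow_of_nonneg (by positivity) (by positivity), one_div,
            Real.mul_rpow hD0.le (by positivity), ← Real.rpow_mul ha.le, mul_assoc,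
            mul_inv_cancel₀ hp0.ne', mul_one]
  · refine Measure.restrict_mono ?_ le_rfl
    exact fun s hs => ⟨hs.1.le, hs.2.trans ht⟩

/-! ## Measurability in time -/

/-- For a continuous function the essential supremum is a true bound, since nonempty open sets have
positive measure. -/
theorem enorm_le_eLpNorm_top {g : Phase d → ℂ} (hg : Continuous g) (z : Phase d) :
    ‖g z‖ₑ ≤ eLpNorm g ⊤ volume := by
  by_contra hlt
  push Not at hlt
  have hU : IsOpen {y | eLpNorm g ⊤ volume < ‖g y‖ₑ} := isOpen_lt continuous_const hg.enorm
  have h0 : volume {y | eLpNorm g ⊤ volume < ‖g y‖ₑ} = 0 := by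
    rw [eLpNorm_exponent_top]
    have := ae_le_eLpNormEssSup (f := g) (μ := (volume : Measure (Phase d)))
    rw [ae_iff] at this
    simpa using this
  have := (hU.measure_eq_zero_iff volume).1 h0
  exact notMem_empty z (this ▸ hlt)

theorem ae_lt_top_of_eLpNorm_lt_top {α : Type*} [MeasurableSpace α] {μ : Measure α} {q : ℝ≥0∞}
    (hq : q ≠ 0) {N : α → ℝ≥0∞} (hN : Measurable N) (h : eLpNorm N q μ < ⊤) :
    ∀ᵐ s ∂μ, N s < ⊤ := by
  by_cases hq' : q = ⊤
  · rw [hq', eLpNorm_exponent_top] at h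
    filter_upwards [ae_le_eLpNormEssSup (f := N) (μ := μ)] with s hs
    exact (show N s ≤ _ from hs).trans_lt h
  · have h1 := lintegral_rpow_enorm_lt_top_of_eLpNorm_lt_top hq hq' h
    have h2 : Measurable fun s => ‖N s‖ₑ ^ q.toReal := hN.enorm.pow_const _
    filter_upwards [ae_lt_top h2 h1.ne] with s hs
    exact (ENNReal.rpow_lt_top_iff_of_pos (ENNReal.toReal_pos hq hq')).1 hs

theorem blkFun_zero (φ : DyadicCutoff d) (l : ℕ) (z : Phase d) : blkFun φ 0 l z = 0 := rfl

theorem ofReal_mul_enorm_le_normC (φ : DyadicCutoff d) (κ s : ℝ) (g : 𝓢'(Phase d, ℂ)) (l : ℕ)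
    (z : Phase d) :
    ENNReal.ofReal (2 ^ (s * (((l : ℤ) - 1 : ℤ) : ℝ))) * ‖(weight κ z : ℂ) * blkFun φ g l z‖ₑ ≤
      normC φ (weight κ) s g := by
  refine le_trans ?_ (le_iSup₂_of_le ((l : ℤ) - 1) (by omega) le_rfl)
  gcongr
  exact enorm_le_eLpNorm_top (((Complex.continuous_ofReal.comp (continuous_weight κ))).mul
    (continuous_blkFun φ g l)) z

/-- A function in `L^q([0,T]; C^{-β}_a(ρ))` has a modification whose blocks are measurable in
time and whose norm is finite at every time. -/
theorem MemLqC.exists_modification {φ : DyadicCutoff d} {κ β T : ℝ} (hβ : 0 ≤ β) {q : ℝ≥0∞}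
    (hq : q ≠ 0) {f : ℝ → 𝓢'(Phase d, ℂ)} (hf : MemLqC φ (weight κ) (-β) q T f) :
    ∃ (g : ℝ → 𝓢'(Phase d, ℂ)) (n : ℝ → ℝ), (∀ᵐ s ∂volume.restrict (Icc 0 T), g s = f s) ∧
      (∀ l z, Measurable fun s => blkFun φ (g s) l z) ∧ Measurable n ∧
      (∀ s, BlkBound φ κ β (n s) (g s)) ∧
      eLpNorm n q (volume.restrict (Icc 0 T)) ≤ normLqC φ (weight κ) (-β) q T f := by
  classical
  set μ := volume.restrict (Icc 0 T)
  -- Blocks are continuous in z, so a countable dense set determines their weighted suprema; a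
  -- countable supremum of measurable functions is measurable even though the norm of `f s` need not
  -- be.
  set D := TopologicalSpace.denseSeq (Phase d)
  have hae (l i : ℕ) : AEMeasurable (fun s => blkFun φ (f s) l (D i)) μ :=
    (hf.aestronglyMeasurable (reflectAt (D i) (blockKernel φ ((l : ℤ) - 1)))).aemeasurable
  set G : ℕ → ℕ → ℝ → ℂ := fun l i => (hae l i).mk _
  have hG (l i : ℕ) : Measurable (G l i) := (hae l i).measurable_mk
  have hGeq : ∀ᵐ s ∂μ, ∀ l i, blkFun φ (f s) l (D i) = G l i s :=
    ae_all_iff.2 fun l => ae_all_iff.2 fun i => (hae l i).ae_eq_mk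
  set N : ℝ → ℝ≥0∞ := fun s => ⨆ (l : ℕ) (i : ℕ),
    ENNReal.ofReal (2 ^ (-β * (((l : ℤ) - 1 : ℤ) : ℝ))) * ‖(weight κ (D i) : ℂ) * G l i s‖ₑ
  have hN : Measurable N :=
    Measurable.iSup fun l => Measurable.iSup fun i =>
      ((measurable_const.mul (hG l i)).enorm.const_mul _)
  have hNle : ∀ᵐ s ∂μ, N s ≤ normC φ (weight κ) (-β) (f s) := by
    filter_upwards [hGeq] with s hs
    refine iSup₂_le fun l i => ?_
    rw [← hs]
    exact ofReal_mul_enorm_le_normC φ κ (-β) (f s) l (D i)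
  have hNq : eLpNorm N q μ ≤ normLqC φ (weight κ) (-β) q T f := eLpNorm_mono_enorm_ae hNle
  have hNtop := ae_lt_top_of_eLpNorm_lt_top hq hN (hNq.trans_lt hf.norm_lt_top)
  obtain ⟨A, hA, hAm, hAp⟩ := (hGeq.and hNtop).exists_measurable_mem
  -- On the conull set `A` the measurable versions of all sampled blocks are exact and the norm is
  -- finite; off `A` the family is set to zero.
  set g : ℝ → 𝓢'(Phase d, ℂ) := fun s => if s ∈ A then f s else 0
  have hblk (l i : ℕ) (s : ℝ) : blkFun φ (g s) l (D i) = A.indicator (G l i) s := by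
    by_cases hs : s ∈ A
    · simp only [g, if_pos hs, indicator_of_mem hs]
      exact (hAp s hs).1 l i
    · simp only [g, if_neg hs, indicator_of_notMem hs]
      exact blkFun_zero φ l _
  refine ⟨g, A.indicator fun s => (N s).toReal, ?_, fun l z => ?_, hN.ennreal_toReal.indicator hAm,
    fun s => ⟨indicator_nonneg (fun _ _ => ENNReal.toReal_nonneg) s, fun l z => ?_⟩, ?_⟩
  · filter_upwards [hA] with s hs
    simp only [g, if_pos hs]
  · obtain ⟨x, hx, hxz⟩ := mem_closure_iff_seq_limit.1
      ((TopologicalSpace.denseRange_denseSeq (Phase d)) z)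
    choose i hi using hx
    refine measurable_of_tendsto_metrizable (f := fun k s => blkFun φ (g s) l (x k)) (fun k => ?_)
      (tendsto_pi_nhds.2 fun s => ((continuous_blkFun φ (g s) l).tendsto z).comp hxz)
    have : (fun s => blkFun φ (g s) l (x k)) = A.indicator (G l (i k)) :=
      funext fun s => by rw [← hblk, ← hi]
    rw [this]
    exact (hG l (i k)).indicator hAm
  · refine (TopologicalSpace.denseRange_denseSeq (Phase d)).induction_on
      (p := fun z => weight κ z * ‖blkFun φ (g s) l z‖ ≤ _) z ?_ fun i => ?_
    · exact isClosed_le ((continuous_weight κ).mul (continuous_blkFun φ (g s) l).norm)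
        continuous_const
    change weight κ (D i) * ‖blkFun φ (g s) l (D i)‖ ≤ _
    rw [hblk]
    by_cases hs : s ∈ A
    · rw [indicator_of_mem hs, indicator_of_mem hs]
      have h1 : ENNReal.ofReal (2 ^ (-β * (((l : ℤ) - 1 : ℤ) : ℝ))) *
          ‖(weight κ (D i) : ℂ) * G l i s‖ₑ ≤ N s :=
        le_iSup₂_of_le (f := fun (l : ℕ) (i : ℕ) =>
          ENNReal.ofReal (2 ^ (-β * (((l : ℤ) - 1 : ℤ) : ℝ))) *
            ‖(weight κ (D i) : ℂ) * G l i s‖ₑ) l i le_rfl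
      have h2 := ENNReal.toReal_mono (hAp s hs).2.ne h1
      rw [ENNReal.toReal_mul, ENNReal.toReal_ofReal (by positivity), toReal_enorm, norm_mul,
        Complex.norm_real, Real.norm_of_nonneg (weight_pos κ _).le] at h2
      -- The l-th kernel is the block of index l-1; replacing 2^{β(l-1)} by 2^{βl} only loosens the
      -- bound, as β ≥ 0.
      have h3 : (2 : ℝ) ^ (-(β * l)) ≤ 2 ^ (-β * (((l : ℤ) - 1 : ℤ) : ℝ)) := by
        refine Real.rpow_le_rpow_of_exponent_le one_le_two ?_
        push_cast
        linarith
      have h4 : 0 ≤ weight κ (D i) * ‖G l i s‖ :=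
        mul_nonneg (weight_pos κ _).le (norm_nonneg _)
      have h5 := (mul_le_mul_of_nonneg_right h3 h4).trans h2
      rwa [Real.rpow_neg (by norm_num), inv_mul_le_iff₀ (by positivity)] at h5
    · rw [indicator_of_notMem hs, indicator_of_notMem hs]
      simp
  · refine le_trans (eLpNorm_mono_enorm_ae ?_) hNq
    filter_upwards [hA] with s hs
    rw [indicator_of_mem hs, Real.enorm_of_nonneg ENNReal.toReal_nonneg,
      ENNReal.ofReal_toReal (hAp s hs).2.ne]
    exact le_rfl

theorem continuous_phase_fst : Continuous fun z : Phase d => z.fst :=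
  (WithLp.fstL 2 ℝ (Space d) (Space d)).continuous

theorem continuous_phase_snd : Continuous fun z : Phase d => z.snd :=
  (WithLp.sndL 2 ℝ (Space d) (Space d)).continuous

theorem measurable_kinDensity :
    Measurable fun p : ℝ × Phase d => kinDensity p.1 p.2 := by
  have h1 : Measurable fun p : ℝ × Phase d => p.2.fst :=
    continuous_phase_fst.measurable.comp measurable_snd
  have h2 : Measurable fun p : ℝ × Phase d => p.2.snd :=
    continuous_phase_snd.measurable.comp measurable_snd
  unfold kinDensity kinPhase
  fun_prop

theorem measurable_transport_sub (t : ℝ) :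
    Measurable fun p : ℝ × Phase d => (transport (t - p.1) p.2 : Phase d) := by
  have h1 : Continuous fun p : ℝ × Phase d => p.2.fst := continuous_phase_fst.comp continuous_snd
  have h2 : Continuous fun p : ℝ × Phase d => p.2.snd := continuous_phase_snd.comp continuous_snd
  have : Continuous fun p : ℝ × Phase d => (transport (t - p.1) p.2 : Phase d) := by
    simp only [transport_apply]
    exact (WithLp.prod_continuous_toLp 2 (Space d) (Space d)).comp
      ((h1.add ((continuous_const.sub continuous_fst).smul h2)).prodMk h2)
  exact this.measurable

/-- The convolution of a fattened block with the heat kernel, for arbitrary times. -/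
def heatFat (φ : DyadicCutoff d) (l : ℕ) (p : ℝ × Phase d) : ℂ :=
  ∫ y, fat φ l y * (kinDensity p.1 (p.2 - y) : ℂ)

theorem measurable_heatFat (φ : DyadicCutoff d) (l : ℕ) : Measurable (heatFat φ l) := by
  have h1 : Measurable fun x : (ℝ × Phase d) × Phase d => (x.1.1, x.1.2 - x.2) :=
    (measurable_fst.comp measurable_fst).prodMk
      ((measurable_snd.comp measurable_fst).sub measurable_snd)
  have h2 : StronglyMeasurable fun x : (ℝ × Phase d) × Phase d =>
      fat φ l x.2 * (kinDensity x.1.1 (x.1.2 - x.2) : ℂ) :=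
    (((fat φ l).continuous.measurable.comp measurable_snd).mul
      (Complex.measurable_ofReal.comp (measurable_kinDensity.comp h1))).stronglyMeasurable
  exact h2.integral_prod_right'.measurable

theorem sconv_fat_kinKernel_apply (φ : DyadicCutoff d) (l : ℕ) {t : ℝ} (ht : 0 < t)
    (z : Phase d) : sconv (fat φ l) (kinKernel t ht) z = heatFat φ l (t, z) := sconv_apply _ _ _

/-- A Carathéodory function, continuous in z and measurable in s, is jointly measurable. -/
theorem measurable_blkFun_uncurry (φ : DyadicCutoff d) {f : ℝ → 𝓢'(Phase d, ℂ)}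
    (hf : ∀ l z, Measurable fun s => blkFun φ (f s) l z) (l : ℕ) :
    Measurable fun p : ℝ × Phase d => blkFun φ (f p.1) l p.2 :=
  (stronglyMeasurable_uncurry_of_continuous_of_stronglyMeasurable
    (u := fun (z : Phase d) (s : ℝ) => blkFun φ (f s) l z)
    (fun s => continuous_blkFun φ (f s) l)
    fun z => (hf l z).stronglyMeasurable).measurable.comp measurable_swap

/-- The contribution of one block of `f s` to the convolution with the heat kernel `p_{t-s}`. -/
def heatBlk (φ : DyadicCutoff d) (f : ℝ → 𝓢'(Phase d, ℂ)) (t : ℝ) (l : ℕ) (p : ℝ × Phase d) : ℂ :=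
  ∫ y, blkFun φ (f p.1) l y * heatFat φ l (t - p.1, p.2 - y)

theorem stronglyMeasurable_heatBlk (φ : DyadicCutoff d) {f : ℝ → 𝓢'(Phase d, ℂ)}
    (hf : ∀ l z, Measurable fun s => blkFun φ (f s) l z) (t : ℝ) (l : ℕ) :
    StronglyMeasurable (heatBlk φ f t l) := by
  have h1 : Measurable fun x : (ℝ × Phase d) × Phase d => blkFun φ (f x.1.1) l x.2 :=
    (measurable_blkFun_uncurry φ hf l).comp
      ((measurable_fst.comp measurable_fst).prodMk measurable_snd)
  have h2 : Measurable fun x : (ℝ × Phase d) × Phase d => (t - x.1.1, x.1.2 - x.2) :=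
    (measurable_const.sub (measurable_fst.comp measurable_fst)).prodMk
      ((measurable_snd.comp measurable_fst).sub measurable_snd)
  have h3 : StronglyMeasurable fun x : (ℝ × Phase d) × Phase d => blkFun φ (f x.1.1) l x.2 *
      heatFat φ l (t - x.1.1, x.1.2 - x.2) :=
    (h1.mul ((measurable_heatFat φ l).comp h2)).stronglyMeasurable
  exact h3.integral_prod_right'

theorem tendsto_sum_heatBlk (φ : DyadicCutoff d) (f : ℝ → 𝓢'(Phase d, ℂ)) {s t : ℝ}
    (h : 0 < t - s) (z : Phase d) :
    Filter.Tendsto (fun n => ∑ l ∈ Finset.range n, heatBlk φ f t l (s, transport (t - s) z))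
      Filter.atTop (nhds (kinSemigroup (t - s) (f s) z)) := by
  have h1 := tendsto_sum_conv φ (f s) (kinKernel (t - s) h) (transport (t - s) z)
  rw [← kinSemigroup_of_pos h] at h1
  simp only [sconv_fat_kinKernel_apply] at h1
  exact h1

/-- The semigroup is a pointwise limit of finite sums over blocks, each an integral of jointly
measurable functions; this is what Fubini's theorem needs. The indicator accounts for its default
value 0 at nonpositive times. -/
theorem stronglyMeasurable_kinSemigroup (φ : DyadicCutoff d) {f : ℝ → 𝓢'(Phase d, ℂ)}
    (hf : ∀ l z, Measurable fun s => blkFun φ (f s) l z) (t : ℝ) :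
    StronglyMeasurable fun p : ℝ × Phase d => kinSemigroup (t - p.1) (f p.1) p.2 := by
  have hS : MeasurableSet {p : ℝ × Phase d | 0 < t - p.1} :=
    measurableSet_lt measurable_const (measurable_const.sub measurable_fst)
  have htr : Measurable fun p : ℝ × Phase d => (p.1, (transport (t - p.1) p.2 : Phase d)) :=
    measurable_fst.prodMk (measurable_transport_sub t)
  have hJ (n : ℕ) : StronglyMeasurable ({p : ℝ × Phase d | 0 < t - p.1}.indicator fun p =>
      ∑ l ∈ Finset.range n, heatBlk φ f t l (p.1, transport (t - p.1) p.2)) :=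
    StronglyMeasurable.indicator (Finset.stronglyMeasurable_fun_sum _ fun l _ =>
      (stronglyMeasurable_heatBlk φ hf t l).comp_measurable htr) hS
  refine stronglyMeasurable_of_tendsto Filter.atTop hJ (tendsto_pi_nhds.2 fun p => ?_)
  by_cases hp : 0 < t - p.1
  · refine (tendsto_sum_heatBlk φ f hp p.2).congr fun n => ?_
    rw [indicator_of_mem (show p ∈ {p : ℝ × Phase d | 0 < t - p.1} from hp)]
  · have h1 : kinSemigroup (t - p.1) (f p.1) p.2 = 0 := dif_neg hp
    rw [h1]
    refine tendsto_const_nhds.congr fun n => ?_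
    rw [indicator_of_notMem (show p ∉ {p : ℝ × Phase d | 0 < t - p.1} from hp)]

/-! ## Bounds for the Duhamel integral -/

theorem enorm_le_ofReal_mul_enorm {F : Type*} [SeminormedAddCommGroup F] {x : F} {A m : ℝ}
    (hA : 0 ≤ A) (h : ‖x‖ ≤ A * m) : ‖x‖ₑ ≤ ENNReal.ofReal A * ‖m‖ₑ := by
  rw [← ofReal_norm]
  refine (ENNReal.ofReal_le_ofReal h).trans ?_
  rw [ENNReal.ofReal_mul hA]
  gcongr
  rw [← ofReal_norm]
  exact ENNReal.ofReal_le_ofReal (le_abs_self m)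

/-- The exponent `1 - 1/q - θ/2` of the gain in `λ`. -/
def gainExp (θ : ℝ) (q : ℝ≥0∞) : ℝ := 1 - (1 / q).toReal - θ / 2

theorem exists_setLIntegral_le {q : ℝ≥0∞} (hq : 1 < q) {b : ℝ} {k : ℕ} (hb : 0 < b)
    (hbk : b < k) :
    ∃ C : ℝ, 0 ≤ C ∧ ∀ (a t T K : ℝ) (n : ℝ → ℝ) (X : ℝ → ℝ≥0∞), 0 < a → t ≤ T → 0 ≤ K →
      Measurable n → (∀ s, 0 < s → s < t →
        X s ≤ ENNReal.ofReal (K * timeKernel b (1 - (1 / q).toReal) a k (t - s)) * ‖n s‖ₑ) →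
      ∫⁻ s in Ioc 0 t, X s ≤
        ENNReal.ofReal (C * K * a ^ b) * eLpNorm n q (volume.restrict (Icc 0 T)) := by
  obtain ⟨C, hC, h⟩ := exists_lintegral_timeKernel_le hq hb hbk
  refine ⟨C, hC, fun a t T K n X ha ht hK hn hX => ?_⟩
  calc ∫⁻ s in Ioc 0 t, X s
      = ∫⁻ s in Ioo 0 t, X s := by rw [Measure.restrict_congr_set Ioo_ae_eq_Ioc]
    _ ≤ ∫⁻ s in Ioo 0 t, ENNReal.ofReal K *
          (ENNReal.ofReal (timeKernel b (1 - (1 / q).toReal) a k (t - s)) * ‖n s‖ₑ) := by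
        refine setLIntegral_mono' measurableSet_Ioo fun s hs => ?_
        rw [← mul_assoc, ← ENNReal.ofReal_mul hK]
        exact hX s hs.1 hs.2
    _ = ENNReal.ofReal K * ∫⁻ s in Ioc 0 t,
          ENNReal.ofReal (timeKernel b (1 - (1 / q).toReal) a k (t - s)) * ‖n s‖ₑ := by
        rw [lintegral_const_mul' _ _ ENNReal.ofReal_ne_top,
          Measure.restrict_congr_set Ioo_ae_eq_Ioc]
    _ ≤ ENNReal.ofReal K * (ENNReal.ofReal (C * a ^ b) *
          eLpNorm n q (volume.restrict (Icc 0 T))) := by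
        gcongr
        exact h a t T n ha ht hn
    _ = _ := by
        rw [← mul_assoc, ← ENNReal.ofReal_mul hK]
        congr 2
        ring

/-- A family of distributions with measurable blocks and an `L^q` bound for their norms. -/
structure IsRegular (φ : DyadicCutoff d) (κ β : ℝ) (g : ℝ → 𝓢'(Phase d, ℂ)) (n : ℝ → ℝ) :
    Prop where
  measurable_blkFun : ∀ l z, Measurable fun s => blkFun φ (g s) l z
  measurable : Measurable n
  blkBound : ∀ s, BlkBound φ κ β (n s) (g s)

/-- The exponent balance -γ - β/2 = (θ-β)/2 - (1 - 1/q) behind the choice of γ. -/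
theorem rpow_mul_rpow_mul_min_eq {β θ : ℝ} {q : ℝ≥0∞} {a τ : ℝ} (hτ : 0 < τ) :
    τ ^ (-gainExp θ q) * (τ ^ (-(β / 2)) * min 1 (a / τ)) =
      timeKernel ((θ - β) / 2) (1 - (1 / q).toReal) a 1 τ := by
  unfold timeKernel gainExp
  rw [← mul_assoc, ← Real.rpow_add hτ, pow_one]
  congr 2
  ring

theorem exists_exp_le {θ : ℝ} {q : ℝ≥0∞} (hγ : 0 ≤ gainExp θ q) (T : ℝ) :
    ∃ C : ℝ, 0 ≤ C ∧ ∀ lam τ : ℝ, 0 ≤ lam → 0 < τ → τ ≤ T →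
      Real.exp (-lam * τ) ≤
        C * max lam 1 ^ (-gainExp θ q) * (τ ^ (-gainExp θ q) * min 1 ((max lam 1)⁻¹ / τ)) := by
  obtain ⟨C, hC, h⟩ := exists_exp_neg_mul_le (T := T) hγ
  refine ⟨C, hC, fun lam τ hl hτ hτT => (h lam τ hl hτ hτT).trans (le_of_eq ?_)⟩
  rw [Real.mul_rpow (by positivity) hτ.le]
  ring

theorem exists_exp_le' {θ : ℝ} {q : ℝ≥0∞} (hγ : 0 ≤ gainExp θ q) (T : ℝ) :
    ∃ C : ℝ, 0 ≤ C ∧ ∀ lam τ : ℝ, 0 ≤ lam → 0 < τ → τ ≤ T →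
      Real.exp (-lam * τ) ≤ C * max lam 1 ^ (-gainExp θ q) * τ ^ (-gainExp θ q) := by
  obtain ⟨C, hC, h⟩ := exists_exp_le hγ T
  refine ⟨C, hC, fun lam τ hl hτ hτT => (h lam τ hl hτ hτT).trans ?_⟩
  gcongr
  exact mul_le_of_le_one_right (by positivity) (min_le_left _ _)

section Bounds

variable (φ : DyadicCutoff d) (κ : ℝ) {β θ T : ℝ} {q : ℝ≥0∞}

theorem norm_weight_mul_exp_mul (κ x : ℝ) (z : Phase d) (c : ℂ) :
    ‖(weight κ z : ℂ) * ((Real.exp x : ℂ) * c)‖ = Real.exp x * (weight κ z * ‖c‖) := by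
  rw [norm_mul, norm_mul, Complex.norm_real, Complex.norm_real,
    Real.norm_of_nonneg (weight_pos κ z).le, Real.norm_of_nonneg (Real.exp_pos _).le]
  ring

/-- The time kernel with a = 1/L. The surplus L^{-(θ-β)/2} is not needed for the sup norm but for
the term (e^{-λh} - 1)u(s) of the increments. -/
theorem exists_lintegral_kinSemigroup_le (hβ : 0 < β) (hβ2 : β < 2) (hθ : β < θ) (hθ2 : θ ≤ 2)
    (hT : 0 < T) (hq : 1 < q) (hγ : 0 ≤ gainExp θ q) :
    ∃ C : ℝ, 0 ≤ C ∧ ∀ g n, IsRegular φ κ β g n → ∀ lam t : ℝ, 0 ≤ lam → t ≤ T → ∀ z,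
      ∫⁻ s in Ioc 0 t, ‖(weight κ z : ℂ) * ((Real.exp (-lam * (t - s)) : ℂ) *
        kinSemigroup (t - s) (g s) z)‖ₑ ≤
          ENNReal.ofReal (C * max lam 1 ^ (-gainExp θ q) * (max lam 1)⁻¹ ^ ((θ - β) / 2)) *
            eLpNorm n q (volume.restrict (Icc 0 T)) := by
  obtain ⟨C₁, hC₁, h₁⟩ := exists_kinSemigroup_le φ κ hβ (by linarith : β < 4) hT
  obtain ⟨C₂, hC₂, h₂⟩ := exists_exp_le hγ T
  obtain ⟨C₃, hC₃, h₃⟩ := exists_setLIntegral_le hq (b := (θ - β) / 2) (k := 1) (by linarith)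
    (by push_cast; linarith)
  refine ⟨C₃ * (C₂ * C₁), by positivity, fun g n hg lam t hl ht z => ?_⟩
  have hL : 0 < max lam 1 := lt_max_of_lt_right one_pos
  refine (h₃ (max lam 1)⁻¹ t T (C₂ * max lam 1 ^ (-gainExp θ q) * C₁) n _ (by positivity) ht
    (by positivity) hg.measurable fun s hs hst => ?_).trans (le_of_eq ?_)
  · have hτ : 0 < t - s := by linarith
    refine enorm_le_ofReal_mul_enorm ?_ ?_
    · exact mul_nonneg (by positivity) (timeKernel_nonneg _ (by positivity) hτ.le)
    rw [norm_weight_mul_exp_mul, ← rpow_mul_rpow_mul_min_eq hτ]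
    have hM := (hg.blkBound s).1
    have := weight_pos κ z
    calc _ ≤ (C₂ * max lam 1 ^ (-gainExp θ q) * ((t - s) ^ (-gainExp θ q) *
          min 1 ((max lam 1)⁻¹ / (t - s)))) * (C₁ * (t - s) ^ (-(β / 2)) * n s) := by
          exact mul_le_mul (h₂ lam _ hl hτ (by linarith))
            (h₁ (g s) (n s) (hg.blkBound s) _ hτ (by linarith) z) (by positivity) (by positivity)
      _ = _ := by ring
  · congr 2
    ring

theorem exists_lintegral_kinSemigroup_Ioc_le (hβ : 0 < β) (hβ2 : β < 2) (hθ : β < θ)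
    (hθ2 : θ ≤ 2) (hT : 0 < T) (hq : 1 < q) (hγ : 0 ≤ gainExp θ q) :
    ∃ C : ℝ, 0 ≤ C ∧ ∀ g n, IsRegular φ κ β g n → ∀ lam r t : ℝ, 0 ≤ lam → 0 ≤ r → r < t →
      t ≤ T → ∀ z, ∫⁻ s in Ioc r t, ‖(weight κ z : ℂ) * ((Real.exp (-lam * (t - s)) : ℂ) *
        kinSemigroup (t - s) (g s) z)‖ₑ ≤
          ENNReal.ofReal (C * max lam 1 ^ (-gainExp θ q) * (t - r) ^ ((θ - β) / 2)) *
            eLpNorm n q (volume.restrict (Icc 0 T)) := by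
  obtain ⟨C₁, hC₁, h₁⟩ := exists_kinSemigroup_le φ κ hβ (by linarith : β < 4) hT
  obtain ⟨C₂, hC₂, h₂⟩ := exists_exp_le' hγ T
  obtain ⟨C₃, hC₃, h₃⟩ := exists_setLIntegral_le hq (b := (θ - β) / 2) (k := 1) (by linarith)
    (by push_cast; linarith)
  refine ⟨C₃ * (C₂ * C₁), by positivity, fun g n hg lam r t hl hr hrt ht z => ?_⟩
  have hL : 0 < max lam 1 := lt_max_of_lt_right one_pos
  have hh : 0 < t - r := by linarith
  set X : ℝ → ℝ≥0∞ := fun s => ‖(weight κ z : ℂ) * ((Real.exp (-lam * (t - s)) : ℂ) *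
        kinSemigroup (t - s) (g s) z)‖ₑ
  have hX : ∫⁻ s in Ioc r t, X s = ∫⁻ s in Ioc 0 t, (Ioc r t).indicator X s := by
    rw [lintegral_indicator measurableSet_Ioc, Measure.restrict_restrict measurableSet_Ioc,
      inter_eq_left.2 (Ioc_subset_Ioc_left hr)]
  rw [hX]
  refine (h₃ (t - r) t T (C₂ * max lam 1 ^ (-gainExp θ q) * C₁) n _ hh ht
    (by positivity) hg.measurable fun s hs hst => ?_).trans (le_of_eq ?_)
  · have hτ : 0 < t - s := by linarith
    by_cases hrs : s ∈ Ioc r t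
    swap
    · rw [indicator_of_notMem hrs]; exact zero_le
    rw [indicator_of_mem hrs]
    refine enorm_le_ofReal_mul_enorm ?_ ?_
    · exact mul_nonneg (by positivity) (timeKernel_nonneg _ (by positivity) hτ.le)
    rw [norm_weight_mul_exp_mul, ← rpow_mul_rpow_mul_min_eq hτ]
    have hM := (hg.blkBound s).1
    have := weight_pos κ z
    -- On the interval (r, t) the truncation of the time kernel at a = t - r is inactive, so it may
    -- be inserted freely.
    have h1 : min 1 ((t - r) / (t - s)) = 1 :=
      min_eq_left ((one_le_div hτ).2 (by linarith [hrs.1]))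
    rw [h1, mul_one]
    calc _ ≤ (C₂ * max lam 1 ^ (-gainExp θ q) * (t - s) ^ (-gainExp θ q)) *
          (C₁ * (t - s) ^ (-(β / 2)) * n s) := by
          exact mul_le_mul (h₂ lam _ hl hτ (by linarith))
            (h₁ (g s) (n s) (hg.blkBound s) _ hτ (by linarith) z) (by positivity) (by positivity)
      _ = _ := by ring
  · congr 2
    ring

/-- Both terms evaluate a convolution at the same point Γ_t z, since Γ_sΓ_{t-s} = Γ_t; the transport
disappears and only the increment of the heat kernel remains. -/
theorem exists_kinSemigroup_sub_le (hβ : 0 < β) (hβ4 : β < 4) (hT : 0 < T) :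
    ∃ C : ℝ, 0 ≤ C ∧ ∀ (g : 𝓢'(Phase d, ℂ)) (M : ℝ), BlkBound φ κ β M g →
      ∀ s t : ℝ, 0 < s → s ≤ t → t ≤ T → ∀ z,
        weight κ z * ‖kinSemigroup t g z - kinSemigroup s g (transport (t - s) z)‖ ≤
          C * (min 1 ((t - s) / s) * s ^ (-(β / 2))) * M := by
  obtain ⟨C₁, hC₁, h₁⟩ := exists_conv_kinKernel_sub_le φ κ hβ hβ4 hT
  obtain ⟨C₂, hC₂, h₂⟩ := exists_weight_transport_le (d := d) κ T
  refine ⟨C₂ * C₁, by positivity, fun g M hg s t hs hst htT z => ?_⟩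
  have ht : 0 < t := hs.trans_le hst
  rw [kinSemigroup_of_pos ht, kinSemigroup_of_pos hs, transport_transport, sub_add_cancel]
  set X := conv (kinKernel t ht) g (transport t z) - conv (kinKernel s hs) g (transport t z)
  calc _ ≤ C₂ * weight κ (transport t z) * ‖X‖ := by
        gcongr
        exact h₂ t (by rwa [abs_of_pos ht]) z
    _ = C₂ * (weight κ (transport t z) * ‖X‖) := by ring
    _ ≤ C₂ * (C₁ * (min 1 ((t - s) / s) * s ^ (-(β / 2))) * M) :=
        mul_le_mul_of_nonneg_left (h₁ g M hg s t hs ht hst htT _) (by positivity)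
    _ = _ := by ring

/-- Here the truncation min(1, (t-s)/(s-r)) comes from the increment of the heat kernel, so a = t -
s; the exponential contributes only its power. -/
theorem exists_lintegral_kinSemigroup_sub_le (hβ : 0 < β) (hβ2 : β < 2) (hθ : β < θ)
    (hθ2 : θ ≤ 2) (hT : 0 < T) (hq : 1 < q) (hγ : 0 ≤ gainExp θ q) :
    ∃ C : ℝ, 0 ≤ C ∧ ∀ g n, IsRegular φ κ β g n → ∀ lam s t : ℝ, 0 ≤ lam → s < t →
      t ≤ T → ∀ z, ∫⁻ r in Ioc 0 s, ‖(weight κ z : ℂ) * ((Real.exp (-lam * (t - r)) : ℂ) *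
        (kinSemigroup (t - r) (g r) z - kinSemigroup (s - r) (g r) (transport (t - s) z)))‖ₑ ≤
          ENNReal.ofReal (C * max lam 1 ^ (-gainExp θ q) * (t - s) ^ ((θ - β) / 2)) *
            eLpNorm n q (volume.restrict (Icc 0 T)) := by
  obtain ⟨C₁, hC₁, h₁⟩ := exists_kinSemigroup_sub_le φ κ hβ (by linarith : β < 4) hT
  obtain ⟨C₂, hC₂, h₂⟩ := exists_exp_le' hγ T
  obtain ⟨C₃, hC₃, h₃⟩ := exists_setLIntegral_le hq (b := (θ - β) / 2) (k := 1) (by linarith)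
    (by push_cast; linarith)
  refine ⟨C₃ * (C₂ * C₁), by positivity, fun g n hg lam s t hl hst ht z => ?_⟩
  have hL : 0 < max lam 1 := lt_max_of_lt_right one_pos
  have hh : 0 < t - s := by linarith
  refine (h₃ (t - s) s T (C₂ * max lam 1 ^ (-gainExp θ q) * C₁) n _ hh (by linarith)
    (by positivity) hg.measurable fun r hr hrs => ?_).trans (le_of_eq ?_)
  · have hτ : 0 < s - r := by linarith
    refine enorm_le_ofReal_mul_enorm ?_ ?_
    · exact mul_nonneg (by positivity) (timeKernel_nonneg _ (by positivity) hτ.le)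
    rw [norm_weight_mul_exp_mul, ← rpow_mul_rpow_mul_min_eq hτ]
    have hM := (hg.blkBound r).1
    have := weight_pos κ z
    have h4 := h₁ (g r) (n r) (hg.blkBound r) (s - r) (t - r) hτ (by linarith) (by linarith) z
    rw [sub_sub_sub_cancel_right] at h4
    have h5 : Real.exp (-lam * (t - r)) ≤ Real.exp (-lam * (s - r)) := by
      refine Real.exp_le_exp.2 ?_
      nlinarith
    calc _ ≤ (C₂ * max lam 1 ^ (-gainExp θ q) * (s - r) ^ (-gainExp θ q)) *
          (C₁ * (min 1 ((t - s) / (s - r)) * (s - r) ^ (-(β / 2))) * n r) := by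
          refine mul_le_mul (h5.trans (h₂ lam _ hl hτ (by linarith))) h4 (by positivity)
            (by positivity)
      _ = _ := by ring
  · congr 2
    ring

/-- The truncation is the decay in 4^k(t-s), with a = 4^{-k} and b = θ/2, so 2^{βk}a^b =
2^{-(θ-β)k}. As θ = 2 gives b = 1, first-order decay would not suffice; the exponent 2 does. -/
theorem exists_lintegral_blk_le (hβ : 0 < β) (hβ2 : β < 2) (hθ : 0 < θ)
    (hθ2 : θ ≤ 2) (hT : 0 < T) (hq : 1 < q) (hγ : 0 ≤ gainExp θ q) :
    ∃ C : ℝ, 0 ≤ C ∧ ∀ g n, IsRegular φ κ β g n → ∀ lam t : ℝ, 0 ≤ lam → t ≤ T →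
      ∀ (k : ℕ) z, ∫⁻ s in Ioc 0 t, ‖(weight κ z : ℂ) * ((Real.exp (-lam * (t - s)) : ℂ) *
        ∫ y, kinSemigroup (t - s) (g s) y * blk φ k (z - y))‖ₑ ≤
          ENNReal.ofReal (C * max lam 1 ^ (-gainExp θ q) * 2 ^ (-(θ - β) * k)) *
            eLpNorm n q (volume.restrict (Icc 0 T)) := by
  obtain ⟨C₁, hC₁, h₁⟩ := exists_integral_kinSemigroup_blk_le φ κ hβ (by linarith : β < 4) hT
  obtain ⟨C₂, hC₂, h₂⟩ := exists_exp_le' hγ T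
  obtain ⟨C₃, hC₃, h₃⟩ := exists_setLIntegral_le hq (b := θ / 2) (k := 2) (by linarith)
    (by push_cast; linarith)
  refine ⟨C₃ * (C₂ * C₁), by positivity, fun g n hg lam t hl ht k z => ?_⟩
  have hL : 0 < max lam 1 := lt_max_of_lt_right one_pos
  refine (h₃ ((4 : ℝ) ^ k)⁻¹ t T (C₂ * max lam 1 ^ (-gainExp θ q) * (C₁ * 2 ^ (β * k))) n _
    (by positivity) ht (by positivity) hg.measurable fun s hs hst => ?_).trans (le_of_eq ?_)
  · have hτ : 0 < t - s := by linarith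
    refine enorm_le_ofReal_mul_enorm ?_ ?_
    · exact mul_nonneg (by positivity) (timeKernel_nonneg _ (by positivity) hτ.le)
    rw [norm_weight_mul_exp_mul]
    have hM := (hg.blkBound s).1
    have := weight_pos κ z
    have h4 : decay (4 ^ k * (t - s)) ≤ min 1 ((((4 : ℝ) ^ k)⁻¹ / (t - s)) ^ 2) := by
      refine le_min ?_ ?_
      · unfold decay
        exact inv_le_one_of_one_le₀ (one_le_pow₀ (by
          have : 0 < (4 : ℝ) ^ k * (t - s) := by positivity
          linarith))
      · refine (decay_le_inv_sq (by positivity)).trans (le_of_eq ?_)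
        rw [← inv_pow, mul_inv, div_eq_mul_inv]
    have h5 : timeKernel (θ / 2) (1 - (1 / q).toReal) ((4 : ℝ) ^ k)⁻¹ 2 (t - s) =
        (t - s) ^ (-gainExp θ q) * min 1 ((((4 : ℝ) ^ k)⁻¹ / (t - s)) ^ 2) := by
      unfold timeKernel gainExp
      congr 2
      ring
    rw [h5]
    calc _ ≤ (C₂ * max lam 1 ^ (-gainExp θ q) * (t - s) ^ (-gainExp θ q)) *
          (C₁ * (2 ^ (β * k) * decay (4 ^ k * (t - s))) * n s) := by
          refine mul_le_mul (h₂ lam _ hl hτ (by linarith))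
            (h₁ (g s) (n s) (hg.blkBound s) _ hτ (by linarith) k z) (by positivity)
            (by positivity)
      _ ≤ (C₂ * max lam 1 ^ (-gainExp θ q) * (t - s) ^ (-gainExp θ q)) *
          (C₁ * (2 ^ (β * k) * min 1 ((((4 : ℝ) ^ k)⁻¹ / (t - s)) ^ 2)) * n s) := by gcongr
      _ = _ := by ring
  · congr 2
    have h6 : ((4 : ℝ) ^ k)⁻¹ ^ (θ / 2) = 2 ^ (-(θ * k)) := by
      rw [Real.inv_rpow (by positivity), ← Real.rpow_neg (by positivity),
        show (4 : ℝ) = 2 ^ 2 by norm_num, ← pow_mul, ← Real.rpow_natCast,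
        ← Real.rpow_mul (by norm_num)]
      congr 1
      push_cast
      ring
    have h7 : (2 : ℝ) ^ (-(θ - β) * k) = 2 ^ (β * k) * 2 ^ (-(θ * k)) := by
      rw [← Real.rpow_add two_pos]
      congr 1
      ring
    rw [h6, h7]
    ring

end Bounds

/-! ## Functions as tempered distributions -/

theorem exists_weight_inv_le (κ : ℝ) :
    ∃ C : ℝ, 0 ≤ C ∧ ∀ z : Phase d, (weight κ z)⁻¹ ≤ C * (1 + ‖z‖) ^ ⌈|κ|⌉₊ := by
  have h0 := weight_pos κ (0 : Phase d)
  refine ⟨2 ^ (|κ| / 2) / weight κ (0 : Phase d), by positivity, fun z => ?_⟩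
  have h := weight_le_mul_weight κ 0 z
  rw [zero_sub, norm_neg] at h
  have hz := weight_pos κ z
  rw [inv_le_iff_one_le_mul₀ hz, div_mul_eq_mul_div, div_mul_eq_mul_div, one_le_div h0]
  refine h.trans (le_of_eq ?_)
  ring

theorem integrable_weight_inv_mul (κ : ℝ) (ψ : 𝓢(Phase d, ℂ)) :
    Integrable fun z => ((weight κ z)⁻¹ : ℂ) * ψ z := by
  obtain ⟨C, hC, h⟩ := exists_weight_inv_le (d := d) κ
  refine ((integrable_one_add_norm_pow_mul_norm ψ ⌈|κ|⌉₊).const_mul C).mono' ?_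
    (Filter.Eventually.of_forall fun z => ?_)
  · refine Continuous.aestronglyMeasurable (Continuous.mul ?_ ψ.continuous)
    exact (Complex.continuous_ofReal.comp (continuous_weight κ)).inv₀ fun z =>
      Complex.ofReal_ne_zero.2 (weight_pos κ z).ne'
  · rw [norm_mul, norm_inv, Complex.norm_real, Real.norm_of_nonneg (weight_pos κ z).le, ← mul_assoc]
    gcongr
    exact h z

theorem integrable_mul_of_weight_bound {κ B : ℝ} {h : Phase d → ℂ} (hm : AEStronglyMeasurable h)
    (hB : ∀ z, weight κ z * ‖h z‖ ≤ B) (ψ : 𝓢(Phase d, ℂ)) : Integrable fun z => h z * ψ z := by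
  refine ((integrable_weight_inv_mul κ ψ).norm.const_mul B).mono'
    (hm.mul ψ.continuous.aestronglyMeasurable) (Filter.Eventually.of_forall fun z => ?_)
  have hz := weight_pos κ z
  rw [norm_mul, norm_mul, norm_inv, Complex.norm_real, Real.norm_of_nonneg hz.le]
  calc ‖h z‖ * ‖ψ z‖ = (weight κ z * ‖h z‖) * ((weight κ z)⁻¹ * ‖ψ z‖) := by field_simp
    _ ≤ _ := by gcongr; exact hB z

/-- Dividing `h` by a smooth power of 1+|z|² makes it bounded, hence a tempered distribution;
multiplication by that power, which has temperate growth, restores it. -/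
theorem exists_isFun {κ B : ℝ} {h : Phase d → ℂ} (hm : AEStronglyMeasurable h)
    (hB : ∀ z, weight κ z * ‖h z‖ ≤ B) : ∃ g : 𝓢'(Phase d, ℂ), IsFun g h := by
  obtain ⟨C, hC, hw⟩ := exists_weight_inv_le (d := d) κ
  set m := ⌈|κ|⌉₊
  set G : Phase d → ℂ := fun z => ((1 + ‖z‖ ^ 2 : ℝ) : ℂ) ^ m with hG
  have hGt : G.HasTemperateGrowth := by
    have h1 : (fun z : Phase d => ((1 + ‖z‖ ^ 2 : ℝ) : ℂ)).HasTemperateGrowth := by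
      have h2 : (fun z : Phase d => (1 + ‖z‖ ^ 2 : ℝ)).HasTemperateGrowth :=
        (Function.HasTemperateGrowth.const (1 : ℝ)).add (Function.hasTemperateGrowth_norm_sq (H := Phase d))
      exact (Complex.ofRealCLM.hasTemperateGrowth).comp h2
    exact h1.pow m
  have hpos (z : Phase d) : 0 < 1 + ‖z‖ ^ 2 := by positivity
  have hG0 (z : Phase d) : G z ≠ 0 :=
    pow_ne_zero _ (Complex.ofReal_ne_zero.2 (hpos z).ne')
  have hGn (z : Phase d) : ‖G z‖ = (1 + ‖z‖ ^ 2) ^ m := by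
    rw [hG, norm_pow, Complex.norm_real, Real.norm_of_nonneg (hpos z).le]
  have hGc : Continuous G := by fun_prop
  have hbd (z : Phase d) : ‖h z * (G z)⁻¹‖ ≤ |B| * C * 2 ^ m := by
    have hz := weight_pos κ z
    have h1 : 1 + ‖z‖ ≤ 2 * (1 + ‖z‖ ^ 2) := by nlinarith [sq_nonneg (‖z‖ - 1)]
    rw [norm_mul, norm_inv, hGn, ← div_eq_mul_inv, div_le_iff₀ (pow_pos (hpos z) m)]
    calc ‖h z‖ = (weight κ z * ‖h z‖) * (weight κ z)⁻¹ := by field_simp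
      _ ≤ |B| * (C * (1 + ‖z‖) ^ m) := by
          gcongr
          · exact (hB z).trans (le_abs_self B)
          · exact hw z
      _ ≤ |B| * (C * (2 * (1 + ‖z‖ ^ 2)) ^ m) := by gcongr
      _ = _ := by rw [mul_pow]; ring
  have hmem : MemLp (fun z => h z * (G z)⁻¹) ⊤ (volume : Measure (Phase d)) :=
    memLp_top_of_bound (hm.mul (hGc.inv₀ hG0).aestronglyMeasurable) _
      (Filter.Eventually.of_forall hbd)
  have : Fact ((1 : ℝ≥0∞) ≤ ⊤) := ⟨le_top⟩
  refine ⟨PointwiseConvergenceCLM.precomp ℂ (SchwartzMap.smulLeftCLM ℂ G)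
    (Lp.toTemperedDistribution hmem.toLp), hm, integrable_mul_of_weight_bound hm hB,
    fun ψ => ?_⟩
  change (Lp.toTemperedDistribution hmem.toLp) (SchwartzMap.smulLeftCLM ℂ G ψ) = _
  rw [Lp.toTemperedDistribution_apply]
  refine integral_congr_ae ?_
  filter_upwards [hmem.coeFn_toLp] with z hz
  rw [hz, SchwartzMap.smulLeftCLM_apply_apply hGt, smul_eq_mul, smul_eq_mul]
  have := hG0 z
  field_simp

theorem IsFun.sub {g₁ g₂ : 𝓢'(Phase d, ℂ)} {h₁ h₂ : Phase d → ℂ} (H₁ : IsFun g₁ h₁)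
    (H₂ : IsFun g₂ h₂) : IsFun (g₁ - g₂) fun z => h₁ z - h₂ z where
  aestronglyMeasurable := H₁.aestronglyMeasurable.sub H₂.aestronglyMeasurable
  integrable ψ := by
    simp only [sub_mul]
    exact (H₁.integrable ψ).sub (H₂.integrable ψ)
  eq_integral ψ := by
    simp only [sub_mul]
    rw [integral_sub (H₁.integrable ψ) (H₂.integrable ψ), ← H₁.eq_integral, ← H₂.eq_integral]
    rfl

theorem measurePreserving_transport (t : ℝ) :
    MeasurePreserving (transport t : Phase d → Phase d) volume volume := by
  refine ⟨(transport t).continuous.measurable, ?_⟩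
  refine (map_volume_equiv (transport t)).trans ?_
  rw [absDet_transport, inv_one, ENNReal.ofReal_one, one_smul]

theorem IsFun.transportDist {g : 𝓢'(Phase d, ℂ)} {h : Phase d → ℂ} (H : IsFun g h) (t : ℝ) :
    IsFun (transportDist t g) fun z => h (transport t z) := by
  have e (ψ : 𝓢(Phase d, ℂ)) : (fun z => h (transport t z) * ψ z) = fun z =>
      (fun w => h w * SchwartzMap.compCLMOfContinuousLinearEquiv ℂ (transport (-t)) ψ w)
        (transport t z) := by
    funext z
    change _ = h (transport t z) * ψ (transport (-t) (transport t z))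
    rw [transport_transport, add_neg_cancel, transport_zero_apply]
  refine ⟨H.aestronglyMeasurable.comp_measurePreserving (measurePreserving_transport t),
    fun ψ => ?_, fun ψ => ?_⟩
  · rw [e]
    exact integrable_comp_equiv (transport t) (H.integrable _)
  · rw [e, integral_comp_transport t
      (fun w => h w * SchwartzMap.compCLMOfContinuousLinearEquiv ℂ (transport (-t)) ψ w),
      ← H.eq_integral]
    rfl

theorem normLinfFun_le {ρ : Phase d → ℝ} {h : Phase d → ℂ} {c : ℝ≥0∞}
    (hc : ∀ z, ‖(ρ z : ℂ) * h z‖ₑ ≤ c) : normLinfFun ρ h ≤ c := by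
  unfold normLinfFun
  rw [eLpNorm_exponent_top]
  exact eLpNormEssSup_le_of_ae_enorm_bound (Filter.Eventually.of_forall hc)

theorem IsFun.normLinf_le {ρ : Phase d → ℝ} {g : 𝓢'(Phase d, ℂ)} {h : Phase d → ℂ}
    (H : IsFun g h) {c : ℝ≥0∞} (hc : ∀ z, ‖(ρ z : ℂ) * h z‖ₑ ≤ c) : normLinf ρ g ≤ c :=
  (iInf₂_le h H).trans (normLinfFun_le hc)

/-! ## The Duhamel integral -/

/-- No norm of `g` is assumed: any tempered distribution tested with translates grows at most
polynomially. Hence the spatial pairings converge at every time, even where the norm of f is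
infinite. -/
theorem integrable_kinSemigroup_mul (t : ℝ) (g : 𝓢'(Phase d, ℂ)) (ψ : 𝓢(Phase d, ℂ)) :
    Integrable fun z => kinSemigroup t g z * ψ z := by
  by_cases ht : 0 < t
  swap
  · have : (fun z => kinSemigroup t g z * ψ z) = fun _ => 0 := by
      funext z
      rw [kinSemigroup, dif_neg ht, zero_mul]
    rw [this]
    exact integrable_zero _ _ _
  set Q : 𝓢(Phase d, ℂ) := reflectAt 0 (kinKernel t ht)
  have h1 (w : Phase d) : reflectAt w (kinKernel t ht) = translate w Q := by
    ext y
    rw [reflectAt_apply]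
    change _ = Q (y - w)
    rw [reflectAt_apply, zero_sub, neg_sub]
  have h2 : (fun z => kinSemigroup t g z) = fun z => g (translate (transport t z) Q) := by
    funext z
    rw [kinSemigroup_of_pos ht, conv, h1]
  obtain ⟨C, k, hC, hb⟩ := exists_norm_apply_translate_le g Q
  have hc : Continuous fun z => kinSemigroup t g z := by
    rw [h2]
    exact (continuous_apply_translate g Q).comp (transport t).continuous
  have hN := (norm_nonneg ((transport t : Phase d ≃L[ℝ] Phase d) : Phase d →L[ℝ] Phase d))
  set N := ‖((transport t : Phase d ≃L[ℝ] Phase d) : Phase d →L[ℝ] Phase d)‖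
  refine ((integrable_one_add_norm_pow_mul_norm ψ k).const_mul (C * (1 + N) ^ k)).mono'
    (hc.mul ψ.continuous).aestronglyMeasurable (Filter.Eventually.of_forall fun z => ?_)
  rw [norm_mul, congrFun h2 z]
  have h3 : ‖transport t z‖ ≤ N * ‖z‖ :=
    ((transport t : Phase d ≃L[ℝ] Phase d) : Phase d →L[ℝ] Phase d).le_opNorm z
  calc _ ≤ (C * (1 + ‖transport t z‖) ^ k) * ‖ψ z‖ := by gcongr; exact hb _
    _ ≤ (C * ((1 + N) * (1 + ‖z‖)) ^ k) * ‖ψ z‖ := by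
        gcongr
        nlinarith [norm_nonneg z]
    _ = _ := by rw [mul_pow]; ring

/-- The Duhamel integral as a function. -/
def duhamelFun (lam t : ℝ) (g : ℝ → 𝓢'(Phase d, ℂ)) (z : Phase d) : ℂ :=
  ∫ s in Ioc 0 t, (Real.exp (-lam * (t - s)) : ℂ) * kinSemigroup (t - s) (g s) z

section Duhamel

variable {φ : DyadicCutoff d} {κ β : ℝ} {g : ℝ → 𝓢'(Phase d, ℂ)} {n : ℝ → ℝ}

theorem IsRegular.stronglyMeasurable_integrand (hg : IsRegular φ κ β g n) (lam t : ℝ) :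
    StronglyMeasurable fun p : ℝ × Phase d =>
      (Real.exp (-lam * (t - p.1)) : ℂ) * kinSemigroup (t - p.1) (g p.1) p.2 := by
  have h1 : Measurable fun p : ℝ × Phase d => (Real.exp (-lam * (t - p.1)) : ℂ) := by fun_prop
  exact h1.stronglyMeasurable.mul (stronglyMeasurable_kinSemigroup φ hg.measurable_blkFun t)

theorem IsRegular.stronglyMeasurable_integrand_left (hg : IsRegular φ κ β g n) (lam t : ℝ)
    (z : Phase d) : StronglyMeasurable fun s : ℝ =>
      (Real.exp (-lam * (t - s)) : ℂ) * kinSemigroup (t - s) (g s) z := by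
  have h : Measurable fun s : ℝ => (s, z) := measurable_id.prodMk measurable_const
  exact (hg.stronglyMeasurable_integrand lam t).comp_measurable h

theorem IsRegular.stronglyMeasurable_duhamelFun (hg : IsRegular φ κ β g n) (lam t : ℝ) :
    StronglyMeasurable (duhamelFun lam t g) :=
  (hg.stronglyMeasurable_integrand lam t).integral_prod_left'

variable {lam t : ℝ} {c : ℝ≥0∞}

theorem IsRegular.integrableOn_integrand (hg : IsRegular φ κ β g n) (hc : c ≠ ⊤) {z : Phase d}
    (h : ∫⁻ s in Ioc 0 t, ‖(weight κ z : ℂ) * ((Real.exp (-lam * (t - s)) : ℂ) *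
      kinSemigroup (t - s) (g s) z)‖ₑ ≤ c) :
    IntegrableOn (fun s => (Real.exp (-lam * (t - s)) : ℂ) * kinSemigroup (t - s) (g s) z)
      (Ioc 0 t) := by
  have h1 : IntegrableOn (fun s => (weight κ z : ℂ) * ((Real.exp (-lam * (t - s)) : ℂ) *
      kinSemigroup (t - s) (g s) z)) (Ioc 0 t) :=
    ⟨((hg.stronglyMeasurable_integrand_left lam t z).const_mul _).aestronglyMeasurable,
      h.trans_lt hc.lt_top⟩
  refine (integrable_const_mul_iff (IsUnit.mk0 _ ?_) _).1 h1
  exact Complex.ofReal_ne_zero.2 (weight_pos κ z).ne'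

theorem enorm_weight_mul_duhamelFun_le {z : Phase d}
    (h : ∫⁻ s in Ioc 0 t, ‖(weight κ z : ℂ) * ((Real.exp (-lam * (t - s)) : ℂ) *
      kinSemigroup (t - s) (g s) z)‖ₑ ≤ c) :
    ‖(weight κ z : ℂ) * duhamelFun lam t g z‖ₑ ≤ c := by
  unfold duhamelFun
  rw [← integral_const_mul]
  exact (enorm_integral_le_lintegral_enorm _).trans h

/-- Tonelli's theorem, with the bound for the time integral weighted by ρ uniform in z and ψ/ρ
integrable. -/
theorem IsRegular.integrable_prod (hg : IsRegular φ κ β g n) (hc : c ≠ ⊤)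
    (h : ∀ z, ∫⁻ s in Ioc 0 t, ‖(weight κ z : ℂ) * ((Real.exp (-lam * (t - s)) : ℂ) *
      kinSemigroup (t - s) (g s) z)‖ₑ ≤ c) (ψ : 𝓢(Phase d, ℂ)) :
    Integrable (fun p : ℝ × Phase d => (Real.exp (-lam * (t - p.1)) : ℂ) *
      kinSemigroup (t - p.1) (g p.1) p.2 * ψ p.2)
      ((volume.restrict (Ioc 0 t)).prod volume) := by
  have hm : StronglyMeasurable fun p : ℝ × Phase d => (Real.exp (-lam * (t - p.1)) : ℂ) *
      kinSemigroup (t - p.1) (g p.1) p.2 * ψ p.2 :=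
    (hg.stronglyMeasurable_integrand lam t).mul
      (ψ.continuous.measurable.comp measurable_snd).stronglyMeasurable
  refine ⟨hm.aestronglyMeasurable, ?_⟩
  have hψ := (integrable_weight_inv_mul κ ψ).hasFiniteIntegral
  unfold HasFiniteIntegral at hψ ⊢
  rw [lintegral_prod_symm _ hm.enorm.aemeasurable]
  have hin (z : Phase d) : ∫⁻ s in Ioc 0 t, ‖(Real.exp (-lam * (t - s)) : ℂ) *
      kinSemigroup (t - s) (g s) z * ψ z‖ₑ ≤ c * ‖((weight κ z)⁻¹ : ℂ) * ψ z‖ₑ := by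
    calc _ = ∫⁻ s in Ioc 0 t, ‖(weight κ z : ℂ) * ((Real.exp (-lam * (t - s)) : ℂ) *
          kinSemigroup (t - s) (g s) z)‖ₑ * ‖((weight κ z)⁻¹ : ℂ) * ψ z‖ₑ := by
          refine lintegral_congr fun s => ?_
          rw [← enorm_mul]
          congr 1
          have : (weight κ z : ℂ) ≠ 0 := Complex.ofReal_ne_zero.2 (weight_pos κ z).ne'
          field_simp
      _ = (∫⁻ s in Ioc 0 t, ‖(weight κ z : ℂ) * ((Real.exp (-lam * (t - s)) : ℂ) *
          kinSemigroup (t - s) (g s) z)‖ₑ) * ‖((weight κ z)⁻¹ : ℂ) * ψ z‖ₑ :=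
          lintegral_mul_const' _ _ enorm_ne_top
      _ ≤ _ := by gcongr; exact h z
  refine (lintegral_mono hin).trans_lt ?_
  rw [lintegral_const_mul' _ _ hc]
  exact ENNReal.mul_lt_top hc.lt_top hψ

theorem IsRegular.integrableOn_pairing (hg : IsRegular φ κ β g n) (hc : c ≠ ⊤)
    (h : ∀ z, ∫⁻ s in Ioc 0 t, ‖(weight κ z : ℂ) * ((Real.exp (-lam * (t - s)) : ℂ) *
      kinSemigroup (t - s) (g s) z)‖ₑ ≤ c) (ψ : 𝓢(Phase d, ℂ)) :
    IntegrableOn (fun s => (Real.exp (-lam * (t - s)) : ℂ) *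
      ∫ z, kinSemigroup (t - s) (g s) z * ψ z) (Ioc 0 t) := by
  have h1 := (hg.integrable_prod hc h ψ).integral_prod_left
  refine h1.congr (Filter.Eventually.of_forall fun s => ?_)
  simp only [mul_assoc]
  exact integral_const_mul _ _

theorem IsRegular.integral_duhamelFun_mul (hg : IsRegular φ κ β g n) (hc : c ≠ ⊤)
    (h : ∀ z, ∫⁻ s in Ioc 0 t, ‖(weight κ z : ℂ) * ((Real.exp (-lam * (t - s)) : ℂ) *
      kinSemigroup (t - s) (g s) z)‖ₑ ≤ c) (ψ : 𝓢(Phase d, ℂ)) :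
    ∫ z, duhamelFun lam t g z * ψ z = ∫ s in Ioc 0 t, (Real.exp (-lam * (t - s)) : ℂ) *
      ∫ z, kinSemigroup (t - s) (g s) z * ψ z := by
  have h1 := integral_integral_swap (f := fun (s : ℝ) (z : Phase d) =>
    (Real.exp (-lam * (t - s)) : ℂ) * kinSemigroup (t - s) (g s) z * ψ z)
    (hg.integrable_prod hc h ψ)
  calc _ = ∫ z, ∫ s in Ioc 0 t, (Real.exp (-lam * (t - s)) : ℂ) *
        kinSemigroup (t - s) (g s) z * ψ z :=
        integral_congr_ae (Filter.Eventually.of_forall fun z => (integral_mul_const _ _).symm)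
    _ = _ := h1.symm
    _ = _ := by
        refine integral_congr_ae (Filter.Eventually.of_forall fun s => ?_)
        simp only [mul_assoc]
        exact integral_const_mul _ _

end Duhamel

/-! ## The Schauder estimates -/

section Schauder

variable (φ : DyadicCutoff d) (κ : ℝ) {β θ T : ℝ} {q : ℝ≥0∞}

theorem one_sub_exp_neg_le {b x : ℝ} (hb : 0 ≤ b) (hb1 : b ≤ 1) (hx : 0 ≤ x) :
    1 - Real.exp (-x) ≤ x ^ b := by
  rcases le_total x 1 with h | h
  · have h1 := Real.add_one_le_exp (-x)
    have h2 := Real.rpow_le_rpow_of_exponent_ge' hx h hb hb1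
    rw [Real.rpow_one] at h2
    linarith
  · have h1 := Real.exp_pos (-x)
    have h2 := Real.one_le_rpow h hb
    linarith

theorem enorm_weight_mul_exp_sub_one_le {K lam h b : ℝ} {z w : Phase d} (hK : 0 ≤ K)
    (hw : weight κ z ≤ K * weight κ w) (hl : 0 ≤ lam) (hh : 0 ≤ h) (hb : 0 ≤ b) (hb1 : b ≤ 1)
    (X : ℂ) :
    ‖(weight κ z : ℂ) * (((Real.exp (-lam * h) : ℂ) - 1) * X)‖ₑ ≤
      ENNReal.ofReal (K * (max lam 1 * h) ^ b) * ‖(weight κ w : ℂ) * X‖ₑ := by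
  refine (enorm_le_ofReal_mul_enorm (A := K * (max lam 1 * h) ^ b) (m := ‖(weight κ w : ℂ) * X‖)
    (by positivity) ?_).trans_eq (by rw [enorm_norm])
  have hz := (weight_pos κ z).le
  have hw0 := (weight_pos κ w).le
  have hle : Real.exp (-lam * h) ≤ 1 := Real.exp_le_one_iff.2 (by nlinarith)
  have h1 : ‖((Real.exp (-lam * h) : ℂ) - 1)‖ ≤ (max lam 1 * h) ^ b := by
    rw [← Complex.ofReal_one, ← Complex.ofReal_sub, Complex.norm_real, Real.norm_eq_abs, abs_sub_comm,
      abs_of_nonneg (by linarith), neg_mul]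
    refine (one_sub_exp_neg_le hb hb1 (by positivity)).trans ?_
    gcongr
    exact le_max_left _ _
  rw [norm_mul, norm_mul, norm_mul, Complex.norm_real, Complex.norm_real,
    Real.norm_of_nonneg hz, Real.norm_of_nonneg hw0]
  calc _ ≤ (K * weight κ w) * ((max lam 1 * h) ^ b * ‖X‖) := by gcongr
    _ = _ := by ring

/-- The splitting of an increment, from e^{-λ(t-r)} = e^{-λ(t-s)}e^{-λ(s-r)}. -/
theorem duhamelFun_sub_eq {g : ℝ → 𝓢'(Phase d, ℂ)} {lam s t : ℝ} (hs : 0 ≤ s) (hst : s ≤ t) {z w : Phase d}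
    (ht : IntegrableOn (fun r => (Real.exp (-lam * (t - r)) : ℂ) * kinSemigroup (t - r) (g r) z)
      (Ioc 0 t))
    (hs' : IntegrableOn (fun r => (Real.exp (-lam * (s - r)) : ℂ) * kinSemigroup (s - r) (g r) w)
      (Ioc 0 s)) :
    duhamelFun lam t g z - duhamelFun lam s g w =
      (∫ r in Ioc 0 s, (Real.exp (-lam * (t - r)) : ℂ) *
        (kinSemigroup (t - r) (g r) z - kinSemigroup (s - r) (g r) w)) +
      (∫ r in Ioc s t, (Real.exp (-lam * (t - r)) : ℂ) * kinSemigroup (t - r) (g r) z) +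
      ((Real.exp (-lam * (t - s)) : ℂ) - 1) * duhamelFun lam s g w := by
  have h1 : IntegrableOn (fun r => (Real.exp (-lam * (t - r)) : ℂ) *
      kinSemigroup (t - r) (g r) z) (Ioc 0 s) := ht.mono_set (Ioc_subset_Ioc_right hst)
  have h2 : IntegrableOn (fun r => (Real.exp (-lam * (t - r)) : ℂ) *
      kinSemigroup (t - r) (g r) z) (Ioc s t) := ht.mono_set (Ioc_subset_Ioc_left hs)
  have h3 : duhamelFun lam t g z =
      (∫ r in Ioc 0 s, (Real.exp (-lam * (t - r)) : ℂ) * kinSemigroup (t - r) (g r) z) +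
        ∫ r in Ioc s t, (Real.exp (-lam * (t - r)) : ℂ) * kinSemigroup (t - r) (g r) z := by
    unfold duhamelFun
    rw [← Ioc_union_Ioc_eq_Ioc hs hst, setIntegral_union (Ioc_disjoint_Ioc_of_le le_rfl)
      measurableSet_Ioc h1 h2]
  have h4 (r : ℝ) : (Real.exp (-lam * (t - r)) : ℂ) *
      (kinSemigroup (t - r) (g r) z - kinSemigroup (s - r) (g r) w) =
      (Real.exp (-lam * (t - r)) : ℂ) * kinSemigroup (t - r) (g r) z -
      (Real.exp (-lam * (t - s)) : ℂ) *
        ((Real.exp (-lam * (s - r)) : ℂ) * kinSemigroup (s - r) (g r) w) := by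
    rw [mul_sub, ← mul_assoc, ← Complex.ofReal_mul, ← Real.exp_add,
      show -lam * (t - s) + -lam * (s - r) = -lam * (t - r) by ring]
  simp only [h4]
  rw [integral_sub h1 (hs'.const_mul _), integral_const_mul, h3]
  change _ - duhamelFun lam s g w = _ - _ * duhamelFun lam s g w + _ + _
  ring

theorem exists_duhamelFun_sub_le_of_lt (hβ : 0 < β) (hβ2 : β < 2) (hθ : β < θ) (hθ2 : θ ≤ 2)
    (hT : 0 < T) (hq : 1 < q) (hγ : 0 ≤ gainExp θ q) :
    ∃ C : ℝ, 0 ≤ C ∧ ∀ g n, IsRegular φ κ β g n → eLpNorm n q (volume.restrict (Icc 0 T)) ≠ ⊤ →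
      ∀ lam s t : ℝ, 0 ≤ lam → 0 ≤ s → s < t → t ≤ T → ∀ z,
        ‖(weight κ z : ℂ) * (duhamelFun lam t g z - duhamelFun lam s g (transport (t - s) z))‖ₑ ≤
          ENNReal.ofReal (C * max lam 1 ^ (-gainExp θ q) * (t - s) ^ ((θ - β) / 2)) *
            eLpNorm n q (volume.restrict (Icc 0 T)) := by
  obtain ⟨A, hA, a⟩ := exists_lintegral_kinSemigroup_le φ κ hβ hβ2 hθ hθ2 hT hq hγ
  obtain ⟨B, hB, b⟩ := exists_lintegral_kinSemigroup_Ioc_le φ κ hβ hβ2 hθ hθ2 hT hq hγ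
  obtain ⟨D, hD, e⟩ := exists_lintegral_kinSemigroup_sub_le φ κ hβ hβ2 hθ hθ2 hT hq hγ
  obtain ⟨K, hK, k⟩ := exists_weight_transport_le (d := d) κ T
  have hK0 : 0 ≤ K := zero_le_one.trans hK
  refine ⟨D + B + K * A, by positivity, fun g n hg hn lam s t hl hs hst ht z => ?_⟩
  have hL : 0 < max lam 1 := lt_max_of_lt_right one_pos
  have hh : 0 < t - s := by linarith
  set w := transport (t - s) z
  set L := max lam 1
  set E := eLpNorm n q (volume.restrict (Icc 0 T))
  have hc (x : ℝ) : ENNReal.ofReal x * E ≠ ⊤ := ENNReal.mul_ne_top ENNReal.ofReal_ne_top hn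
  have at' := a g n hg lam t hl ht z
  have as' := a g n hg lam s hl (hst.le.trans ht) w
  rw [duhamelFun_sub_eq hs hst.le
    (hg.integrableOn_integrand (hc _) at') (hg.integrableOn_integrand (hc _) as')]
  rw [mul_add, mul_add, ← integral_const_mul, ← integral_const_mul]
  -- From 1 - e^{-λh} ≤ (Lh)^b; the factor L^b is cancelled by the L^{-b} in the bound for the
  -- Duhamel integral at time s.
  have h3 := (enorm_weight_mul_exp_sub_one_le κ hK0
    (k (t - s) (by rw [abs_of_pos hh]; linarith) z) hl hh.le (b := (θ - β) / 2)
    (by linarith) (by linarith) (duhamelFun lam s g w)).trans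
    (mul_le_mul_right (enorm_weight_mul_duhamelFun_le as') _)
  refine (enorm_add_le _ _).trans ((add_le_add ((enorm_add_le _ _).trans (add_le_add
    ((enorm_integral_le_lintegral_enorm _).trans (e g n hg lam s t hl hst ht z))
    ((enorm_integral_le_lintegral_enorm _).trans (b g n hg lam s t hl hs hst ht z)))) h3).trans
      (le_of_eq ?_))
  rw [← mul_assoc, ← ENNReal.ofReal_mul (by positivity), ← add_mul, ← add_mul,
    ← ENNReal.ofReal_add (by positivity) (by positivity),
    ← ENNReal.ofReal_add (by positivity) (by positivity)]
  congr 2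
  rw [Real.mul_rpow hL.le hh.le, Real.inv_rpow hL.le]
  have : L ^ ((θ - β) / 2) ≠ 0 := (Real.rpow_pos_of_pos hL _).ne'
  field_simp
  ring

theorem exists_duhamelFun_sub_le (hβ : 0 < β) (hβ2 : β < 2) (hθ : β < θ) (hθ2 : θ ≤ 2)
    (hT : 0 < T) (hq : 1 < q) (hγ : 0 ≤ gainExp θ q) :
    ∃ C : ℝ, 0 ≤ C ∧ ∀ g n, IsRegular φ κ β g n → eLpNorm n q (volume.restrict (Icc 0 T)) ≠ ⊤ →
      ∀ lam : ℝ, 0 ≤ lam → ∀ s ∈ Icc 0 T, ∀ t ∈ Icc 0 T, s ≠ t → ∀ z,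
        ‖(weight κ z : ℂ) * (duhamelFun lam t g z - duhamelFun lam s g (transport (t - s) z))‖ₑ ≤
          ENNReal.ofReal (C * max lam 1 ^ (-gainExp θ q) * |t - s| ^ ((θ - β) / 2)) *
            eLpNorm n q (volume.restrict (Icc 0 T)) := by
  obtain ⟨A, hA, a⟩ := exists_duhamelFun_sub_le_of_lt φ κ hβ hβ2 hθ hθ2 hT hq hγ
  obtain ⟨K, hK, k⟩ := exists_weight_transport_le (d := d) κ T
  have hK0 : 0 ≤ K := zero_le_one.trans hK
  have hL (lam : ℝ) : 0 < max lam 1 := lt_max_of_lt_right one_pos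
  refine ⟨K * A, by positivity, fun g n hg hn lam hl s hs t ht hst z => ?_⟩
  have hL := hL lam
  rcases hst.lt_or_gt with h | h
  · rw [abs_of_pos (sub_pos.2 h)]
    refine (a g n hg hn lam s t hl hs.1 h ht.2 z).trans ?_
    gcongr
    exact le_mul_of_one_le_left hA hK
  -- For s > t the increment is the reversed one seen from w = Γ_{t-s}z; the weights at z and w are
  -- comparable.
  · rw [abs_sub_comm, abs_of_pos (sub_pos.2 h)]
    set w := transport (t - s) z with hw
    have hz : transport (s - t) w = z := by
      rw [hw, transport_transport, show t - s + (s - t) = 0 by ring, transport_zero_apply]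
    have h1 := a g n hg hn lam t s hl ht.1 h hs.2 w
    rw [hz] at h1
    have h2 : ‖(weight κ z : ℂ) * (duhamelFun lam t g z - duhamelFun lam s g w)‖ₑ ≤
        ENNReal.ofReal K * ‖(weight κ w : ℂ) * (duhamelFun lam s g w - duhamelFun lam t g z)‖ₑ := by
      refine (enorm_le_ofReal_mul_enorm (m := ‖(weight κ w : ℂ) *
        (duhamelFun lam s g w - duhamelFun lam t g z)‖) hK0 ?_).trans_eq (by rw [enorm_norm])
      rw [norm_mul, norm_mul, norm_sub_rev, Complex.norm_real, Complex.norm_real,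
        Real.norm_of_nonneg (weight_pos κ z).le, Real.norm_of_nonneg (weight_pos κ w).le,
        ← mul_assoc]
      gcongr
      exact k (t - s) (by rw [abs_sub_comm, abs_of_pos (sub_pos.2 h)]; linarith [ht.1, hs.2]) z
    refine h2.trans ((mul_le_mul_right h1 _).trans (le_of_eq ?_))
    rw [← mul_assoc, ← ENNReal.ofReal_mul hK0, mul_assoc K, mul_assoc K]

/-- The index shift j = k - 1 between blocks and their kernels costs 2^{-s}, at most 2^{|s|}. -/
theorem normC_le {c : ℝ≥0∞} {s : ℝ} {ρ : Phase d → ℝ} {g : 𝓢'(Phase d, ℂ)}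
    (h : ∀ (k : ℕ) z, ‖(ρ z : ℂ) * blkFun φ g k z‖ₑ ≤ ENNReal.ofReal (2 ^ (-s * k)) * c) :
    normC φ ρ s g ≤ ENNReal.ofReal (2 ^ |s|) * c := by
  refine iSup₂_le fun j hj => ?_
  obtain ⟨k, rfl⟩ : ∃ k : ℕ, j = (k : ℤ) - 1 := ⟨(j + 1).toNat, by omega⟩
  refine (mul_le_mul_right (normLinfFun_le (h k)) _).trans ?_
  rw [← mul_assoc, ← ENNReal.ofReal_mul (by positivity), ← Real.rpow_add two_pos]
  gcongr
  · norm_num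
  · push_cast
    linarith [neg_le_abs s]

theorem blkFun_eq_integral {g : 𝓢'(Phase d, ℂ)} {h : Phase d → ℂ} (H : IsFun g h) (k : ℕ)
    (z : Phase d) : blkFun φ g k z = ∫ y, h y * reflectAt z (blk φ k) y :=
  H.eq_integral _

/-- For θ < 2 the condition is 1/q ≤ 1 - θ/2, and θ > 0 makes the lower bound for q exceed 1; for θ
= 2 the convention 2/0 = ∞ leaves only q = ∞ and γ = 0. -/
theorem one_lt_of_exponent_le (hθ : 0 < θ) (hθ2 : θ ≤ 2) (hq : 2 / ENNReal.ofReal (2 - θ) ≤ q) :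
    1 < q ∧ 0 ≤ gainExp θ q := by
  rcases hθ2.eq_or_lt with rfl | h
  · rw [sub_self, ENNReal.ofReal_zero, ENNReal.div_zero two_ne_zero, top_le_iff] at hq
    subst hq
    simp [gainExp]
  · have h2 : 0 < 2 - θ := by linarith
    have e : 2 / ENNReal.ofReal (2 - θ) = ENNReal.ofReal (2 / (2 - θ)) := by
      rw [ENNReal.ofReal_div_of_pos h2, ENNReal.ofReal_ofNat]
    rw [e] at hq
    refine ⟨lt_of_lt_of_le ?_ hq, ?_⟩
    · rw [← ENNReal.ofReal_one]
      refine (ENNReal.ofReal_lt_ofReal_iff (by positivity)).2 ?_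
      rw [one_lt_div h2]
      linarith
    · have h3 : 1 / q ≤ ENNReal.ofReal ((2 - θ) / 2) := by
        rw [one_div, show (2 - θ) / 2 = (2 / (2 - θ))⁻¹ by rw [inv_div],
          ENNReal.ofReal_inv_of_pos (by positivity)]
        exact ENNReal.inv_le_inv.2 hq
      have h4 := ENNReal.toReal_mono ENNReal.ofReal_ne_top h3
      rw [ENNReal.toReal_ofReal (by linarith)] at h4
      unfold gainExp
      linarith

/-- The Duhamel integral as a family of distributions. -/
theorem exists_isFun_duhamelFun (hβ : 0 < β) (hβ2 : β < 2) (hθ : β < θ) (hθ2 : θ ≤ 2)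
    (hT : 0 < T) (hq : 1 < q) (hγ : 0 ≤ gainExp θ q) {g : ℝ → 𝓢'(Phase d, ℂ)} {n : ℝ → ℝ}
    (hg : IsRegular φ κ β g n) (hn : eLpNorm n q (volume.restrict (Icc 0 T)) ≠ ⊤) {lam : ℝ}
    (hl : 0 ≤ lam) :
    ∃ u : ℝ → 𝓢'(Phase d, ℂ), ∀ t ≤ T, IsFun (u t) (duhamelFun lam t g) := by
  obtain ⟨A, hA, a⟩ := exists_lintegral_kinSemigroup_le φ κ hβ hβ2 hθ hθ2 hT hq hγ
  have h (t : ℝ) (ht : t ≤ T) : ∃ u : 𝓢'(Phase d, ℂ), IsFun u (duhamelFun lam t g) := by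
    set c := ENNReal.ofReal (A * max lam 1 ^ (-gainExp θ q) * (max lam 1)⁻¹ ^ ((θ - β) / 2)) *
      eLpNorm n q (volume.restrict (Icc 0 T))
    have hc : c ≠ ⊤ := ENNReal.mul_ne_top ENNReal.ofReal_ne_top hn
    refine exists_isFun (κ := κ) (B := c.toReal) (hg.stronglyMeasurable_duhamelFun lam t).aestronglyMeasurable
      fun z => ?_
    have h1 := ENNReal.toReal_mono hc (enorm_weight_mul_duhamelFun_le (a g n hg lam t hl ht z))
    rwa [toReal_enorm, norm_mul, Complex.norm_real, Real.norm_of_nonneg (weight_pos κ z).le] at h1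
  choose! u hu using h
  exact ⟨u, hu⟩

/-- A block of u is u tested with a reflected block kernel, so Fubini's theorem turns it into the
time integral of the blocks of the semigroup. -/
theorem exists_normC_le (hβ : 0 < β) (hβ2 : β < 2) (hθ : β < θ) (hθ2 : θ ≤ 2)
    (hT : 0 < T) (hq : 1 < q) (hγ : 0 ≤ gainExp θ q) :
    ∃ C : ℝ, 0 ≤ C ∧ ∀ g n, IsRegular φ κ β g n → eLpNorm n q (volume.restrict (Icc 0 T)) ≠ ⊤ →
      ∀ lam t : ℝ, 0 ≤ lam → t ≤ T → ∀ u, IsFun u (duhamelFun lam t g) →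
        normC φ (weight κ) (θ - β) u ≤ ENNReal.ofReal (C * max lam 1 ^ (-gainExp θ q)) *
          eLpNorm n q (volume.restrict (Icc 0 T)) := by
  obtain ⟨A, hA, a⟩ := exists_lintegral_kinSemigroup_le φ κ hβ hβ2 hθ hθ2 hT hq hγ
  obtain ⟨B, hB, b⟩ := exists_lintegral_blk_le φ κ hβ hβ2 (hβ.trans hθ) hθ2 hT hq hγ
  refine ⟨2 ^ |θ - β| * B, by positivity, fun g n hg hn lam t hl ht u hu => ?_⟩
  rw [mul_assoc, ENNReal.ofReal_mul (by positivity), mul_assoc]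
  refine normC_le φ fun k z => ?_
  rw [blkFun_eq_integral φ hu, hg.integral_duhamelFun_mul
    (ENNReal.mul_ne_top ENNReal.ofReal_ne_top hn) (a g n hg lam t hl ht), ← integral_const_mul]
  refine (enorm_integral_le_lintegral_enorm _).trans ?_
  simp only [reflectAt_apply]
  refine (b g n hg lam t hl ht k z).trans (le_of_eq ?_)
  rw [← mul_assoc, ← ENNReal.ofReal_mul (by positivity), mul_comm (B * _)]

theorem exists_normS_le (hβ : 0 < β) (hβ2 : β < 2) (hθ : β < θ) (hθ2 : θ ≤ 2)
    (hT : 0 < T) (hq : 1 < q) (hγ : 0 ≤ gainExp θ q) :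
    ∃ C : ℝ, 0 ≤ C ∧ ∀ g n, IsRegular φ κ β g n → eLpNorm n q (volume.restrict (Icc 0 T)) ≠ ⊤ →
      ∀ lam : ℝ, 0 ≤ lam → ∀ u : ℝ → 𝓢'(Phase d, ℂ),
        (∀ t ≤ T, IsFun (u t) (duhamelFun lam t g)) →
        normS φ (weight κ) (θ - β) T u ≤ ENNReal.ofReal (C * max lam 1 ^ (-gainExp θ q)) *
          eLpNorm n q (volume.restrict (Icc 0 T)) := by
  obtain ⟨A, hA, a⟩ := exists_lintegral_kinSemigroup_le φ κ hβ hβ2 hθ hθ2 hT hq hγ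
  obtain ⟨B, hB, b⟩ := exists_normC_le φ κ hβ hβ2 hθ hθ2 hT hq hγ
  obtain ⟨D, hD, e⟩ := exists_duhamelFun_sub_le φ κ hβ hβ2 hθ hθ2 hT hq hγ
  refine ⟨B + (A + D), by positivity, fun g n hg hn lam hl u hu => ?_⟩
  have hL : 0 < max lam 1 := lt_max_of_lt_right one_pos
  set E := eLpNorm n q (volume.restrict (Icc 0 T))
  have hsplit : ENNReal.ofReal ((B + (A + D)) * max lam 1 ^ (-gainExp θ q)) * E =
      ENNReal.ofReal (B * max lam 1 ^ (-gainExp θ q)) * E +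
        (ENNReal.ofReal (A * max lam 1 ^ (-gainExp θ q)) * E +
          ENNReal.ofReal (D * max lam 1 ^ (-gainExp θ q)) * E) := by
    rw [← add_mul, ← add_mul, ← ENNReal.ofReal_add (by positivity) (by positivity),
      ← ENNReal.ofReal_add (by positivity) (by positivity)]
    congr 2
    ring
  rw [hsplit]
  refine add_le_add (iSup₂_le fun t ht => b g n hg hn lam t hl ht.2 _ (hu t ht.2))
    (add_le_add (iSup₂_le fun t ht => ?_) (iSup₂_le fun s hs => iSup₂_le fun t ht =>
      iSup_le fun hst => ?_))
  · refine ((hu t ht.2).normLinf_le fun z =>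
      enorm_weight_mul_duhamelFun_le (a g n hg lam t hl ht.2 z)).trans ?_
    -- The surplus power of 1/L ≤ 1 is discarded here.
    refine mul_le_mul_left (ENNReal.ofReal_le_ofReal ?_) _
    refine mul_le_of_le_one_right (by positivity) (Real.rpow_le_one (by positivity) ?_ (by linarith))
    exact inv_le_one_of_one_le₀ (le_max_right _ _)
  · have hpos : 0 < |t - s| ^ ((θ - β) / 2) :=
      Real.rpow_pos_of_pos (abs_pos.2 (sub_ne_zero.2 hst.symm)) _
    refine ENNReal.div_le_of_le_mul ?_
    refine (((hu t ht.2).sub ((hu s hs.2).transportDist (t - s))).normLinf_le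
      (e g n hg hn lam hl s hs t ht hst)).trans (le_of_eq ?_)
    rw [ENNReal.ofReal_mul (by positivity), mul_right_comm]

/-- The modification changes f only on a null set of times, so time integrals agree; the spatial
integrability, required at every time, holds for f itself. -/
theorem isDuhamel_of_isFun (hβ : 0 < β) (hβ2 : β < 2) (hθ : β < θ) (hθ2 : θ ≤ 2)
    (hT : 0 < T) (hq : 1 < q) (hγ : 0 ≤ gainExp θ q) {f g : ℝ → 𝓢'(Phase d, ℂ)} {n : ℝ → ℝ}
    (hg : IsRegular φ κ β g n) (hn : eLpNorm n q (volume.restrict (Icc 0 T)) ≠ ⊤)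
    (hfg : ∀ᵐ s ∂volume.restrict (Icc 0 T), g s = f s) {lam : ℝ} (hl : 0 ≤ lam)
    {u : ℝ → 𝓢'(Phase d, ℂ)} (hu : ∀ t ≤ T, IsFun (u t) (duhamelFun lam t g)) :
    IsDuhamel lam T f u := by
  obtain ⟨A, hA, a⟩ := exists_lintegral_kinSemigroup_le φ κ hβ hβ2 hθ hθ2 hT hq hγ
  have hae (t : ℝ) (ht : t ∈ Icc 0 T) (ψ : 𝓢(Phase d, ℂ)) :
      (fun s => (Real.exp (-lam * (t - s)) : ℂ) * ∫ z, kinSemigroup (t - s) (g s) z * ψ z)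
        =ᵐ[volume.restrict (Ioc 0 t)] fun s => (Real.exp (-lam * (t - s)) : ℂ) *
          ∫ z, kinSemigroup (t - s) (f s) z * ψ z := by
    have hsub : Ioc 0 t ⊆ Icc 0 T := fun s hs => ⟨hs.1.le, hs.2.trans ht.2⟩
    filter_upwards [ae_restrict_of_ae_restrict_of_subset hsub hfg] with s hs
    rw [hs]
  have hc (t : ℝ) := ENNReal.mul_ne_top (ENNReal.ofReal_ne_top
    (r := A * max lam 1 ^ (-gainExp θ q) * (max lam 1)⁻¹ ^ ((θ - β) / 2))) hn
  refine ⟨fun t _ s _ ψ => integrable_kinSemigroup_mul _ _ ψ, fun t ht ψ => ?_, fun t ht ψ => ?_⟩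
  · rw [intervalIntegrable_iff_integrableOn_Ioc_of_le ht.1]
    exact (hg.integrableOn_pairing (hc t) (a g n hg lam t hl ht.2) ψ).congr (hae t ht ψ)
  · rw [intervalIntegral.integral_of_le ht.1, (hu t ht.2).eq_integral,
      hg.integral_duhamelFun_mul (hc t) (a g n hg lam t hl ht.2)]
    exact integral_congr_ae (hae t ht ψ)

end Schauder

end Kinetic

end

/-! ### Assembly of the Schauder estimate. -/

theorem lemma3p10 (d : ℕ) (hd : 1 ≤ d) (φ : Kinetic.DyadicCutoff d) (κ β θ : ℝ)
    (hβ : β ∈ Set.Ioo 0 2) (hθ : θ ∈ Set.Ioc β 2)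
    (q : ℝ≥0∞) (hq : 2 / ENNReal.ofReal (2 - θ) ≤ q) (T : ℝ) (hT : 0 < T) :
    ∃ C : ℝ, 0 < C ∧ ∀ lam : ℝ, 0 ≤ lam → ∀ f : ℝ → 𝓢'(Kinetic.Phase d, ℂ),
      Kinetic.MemLqC φ (Kinetic.weight κ) (-β) q T f →
      ∃ u : ℝ → 𝓢'(Kinetic.Phase d, ℂ), Kinetic.IsDuhamel lam T f u ∧
        Kinetic.normS φ (Kinetic.weight κ) (θ - β) T u ≤
          ENNReal.ofReal (C * max lam 1 ^ (θ / 2 + (1 / q).toReal - 1)) *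
            Kinetic.normLqC φ (Kinetic.weight κ) (-β) q T f := by
  obtain ⟨hβ0, hβ2⟩ := hβ
  obtain ⟨hβθ, hθ2⟩ := hθ
  obtain ⟨hq1, hγ⟩ := Kinetic.one_lt_of_exponent_le (hβ0.trans hβθ) hθ2 hq
  obtain ⟨C, hC, h⟩ := Kinetic.exists_normS_le φ κ hβ0 hβ2 hβθ hθ2 hT hq1 hγ
  -- The constant found is only nonnegative; adding 1 makes it positive.
  refine ⟨C + 1, by positivity, fun lam hl f hf => ?_⟩
  obtain ⟨g, n, hgf, hm, hn, hb, hle⟩ := hf.exists_modification hβ0.le (zero_lt_one.trans hq1).ne'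
  have hg : Kinetic.IsRegular φ κ β g n := ⟨hm, hn, hb⟩
  have htop := (hle.trans_lt hf.norm_lt_top).ne
  obtain ⟨u, hu⟩ := Kinetic.exists_isFun_duhamelFun φ κ hβ0 hβ2 hβθ hθ2 hT hq1 hγ hg htop hl
  refine ⟨u, Kinetic.isDuhamel_of_isFun φ κ hβ0 hβ2 hβθ hθ2 hT hq1 hγ hg htop hgf hl hu,
    (h g n hg htop lam hl u hu).trans ?_⟩
  have he : θ / 2 + (1 / q).toReal - 1 = -Kinetic.gainExp θ q := by
    unfold Kinetic.gainExp
    ring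
  rw [he]
  gcongr
  linarith
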